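/- Let $t>0$ be fixed, and let $P_n(z)=\sum_{k=0}^n A_{k,n}z^k$, $n\in\mathbb N=\{1,2,\dots\}$, be a sequence of random polynomials, where the coefficients $A_{k,n}$ $(0\le k\le n)$ are complex random variables on a probability space, not necessarily independent or identically distributed. Assume that $$M:=\sup\{\mathbb E[|A_{k,n}|^t] : 0\le k\le n,\ n\in\mathbb N\}<\infty$$ and $$L:=\inf\{\mathbb E[\log|A_{k,n}|] : k\in\{0,n\},\ n\in\mathbb N\}>-\infty,$$ where $\log 0=-\infty$. Let $\tau_n$ be the normalized zero counting measure of $P_n$, which gives each zero of $P_n$, counted with multiplicity, the mass $1/\deg P_n$ (almost surely $\deg P_n=n$). For $0<r<1$ and real $\alpha<\beta\le\alpha+2\pi$ let $$A_r(\alpha,\beta)=\{z\in\mathbb C : r<|z|<1/r,\ \alpha\le\arg z<\beta\},$$ where the condition on $\arg z$ means that some value of the argument of $z$ lies in $[\alpha,\beta)$, and let $$C_r:=\sqrt{\frac{2\pi}{\mathbf k}}+\frac{2}{1-r},\qquad \mathbf k:=\sum_{k=0}^\infty\frac{(-1)^k}{(2k+1)^2}.$$ Then, for every such $r,\alpha,\beta$,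 the discrepancy $\left|\tau_n(A_r(\alpha,\beta))-\frac{\beta-\alpha}{2\pi}\right|$ is integrable for every $n\in\mathbb N$, and for all sufficiently large $n$ $$\mathbb E\left[\left|\tau_n(A_r(\alpha,\beta))-\frac{\beta-\alpha}{2\pi}\right|\right]\le C_r\left[\frac1n\left(\frac{\log(n+1)+\log M}{t}-L\right)\right]^{1/2},$$ where the right-hand side is $O\left(\sqrt{\frac{\log n}{n}}\right)$ as $n\to\infty$. -/

import Mathlib

open MeasureTheory Filter Asymptotics
open scoped ENNReal Topology Polynomial

/-- The annular sector of all `z` with `r < |z| < 1 / r` that have an argument in `[α, β)`. -/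
def annularSector (r α β : ℝ) : Set ℂ :=
  {z | r < ‖z‖ ∧ ‖z‖ < 1 / r ∧
    ∃ θ : ℝ, α ≤ θ ∧ θ < β ∧ z = (‖z‖ : ℂ) * Complex.exp (θ * Complex.I)}

/-- The normalized zero counting measure of a polynomial: each zero, repeated according to its
multiplicity, carries the mass `1 / deg p`. -/
noncomputable def zeroCountingMeasure (p : ℂ[X]) : Measure ℂ :=
  (p.natDegree : ℝ≥0∞)⁻¹ • (p.roots.map Measure.dirac).sum

/-- The polynomial `∑_{k ≤ n} A_{k,n}(ω) z^k`. -/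
noncomputable def randomPolynomial {Ω : Type*} (A : ℕ → ℕ → Ω → ℂ) (n : ℕ) (ω : Ω) : ℂ[X] :=
  ∑ k ∈ Finset.range (n + 1), Polynomial.C (A k n ω) * Polynomial.X ^ k

/-- The discrepancy `|τ_n(S) - (β - α) / (2π)|` on the annular sector `S` given by `r`, `α`, `β`,
where `τ_n` is the zero counting measure of the polynomial at the outcome `ω`. -/
noncomputable def sectorDiscrepancy {Ω : Type*} (A : ℕ → ℕ → Ω → ℂ) (r α β : ℝ) (n : ℕ) (ω : Ω) :
    ℝ :=
  |(zeroCountingMeasure (randomPolynomial A n ω)).real (annularSector r α β)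
    - (β - α) / (2 * Real.pi)|

/-- The expectation of `log |X|` as an extended real number, with `log 0 = -∞`:
the expectation of the positive part minus the expectation of the negative part. -/
noncomputable def expectedLogNorm {Ω : Type*} [MeasurableSpace Ω] (μ : Measure Ω) (X : Ω → ℂ) :
    EReal :=
  ((∫⁻ ω, (ENNReal.log ‖X ω‖ₑ).toENNReal ∂μ : ℝ≥0∞) : EReal)
    - ((∫⁻ ω, (-ENNReal.log ‖X ω‖ₑ).toENNReal ∂μ : ℝ≥0∞) : EReal)

/-- The supremum of the moments `E |A_{k,n}|^t` over `n ≥ 1` and `0 ≤ k ≤ n`. -/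
noncomputable def coeffMomentSup {Ω : Type*} [MeasurableSpace Ω] (μ : Measure Ω)
    (A : ℕ → ℕ → Ω → ℂ) (t : ℝ) : ℝ≥0∞ :=
  sSup {x | ∃ n k : ℕ, 1 ≤ n ∧ k ≤ n ∧ x = ∫⁻ ω, ‖A k n ω‖ₑ ^ t ∂μ}

/-- The infimum of `E log |A_{0,n}|` and `E log |A_{n,n}|` over `n ≥ 1`. -/
noncomputable def endCoeffLogInf {Ω : Type*} [MeasurableSpace Ω] (μ : Measure Ω)
    (A : ℕ → ℕ → Ω → ℂ) : EReal :=
  sInf {x | ∃ n k : ℕ, 1 ≤ n ∧ (k = 0 ∨ k = n) ∧ x = expectedLogNorm μ (A k n)}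

/-- Catalan's constant. -/
noncomputable def catalanConstant : ℝ := ∑' k : ℕ, (-1 : ℝ) ^ k / (2 * (k : ℝ) + 1) ^ 2

/-- The constant `C_r`. -/
noncomputable def sectorConst (r : ℝ) : ℝ :=
  Real.sqrt (2 * Real.pi / catalanConstant) + 2 / (1 - r)

/-- The bound `C_r [((log (n + 1) + log M) / t - L) / n]^{1/2}`. -/
noncomputable def discrepancyBound (r t M L : ℝ) (n : ℕ) : ℝ :=
  sectorConst r * Real.sqrt (1 / (n : ℝ) * ((Real.log ((n : ℝ) + 1) + Real.log M) / t - L))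

/-! The expected discrepancy is shown to be `O((log n)^(1/4) / √n)`. This is of smaller order than
`√(log n / n)`, so it eventually lies below the stated bound whatever the positive factor `C_r` is;
no sharp Erdős–Turán constant is needed.

Let `u(w) = log |P(e^w)| - n max(re w, 0)`, which is `logSize`. Jensen's inequality for `P ∘ exp` on
the circle of radius `R` about `c` bounds a sum over zeros `e^v` of `log⁺(R / |c - v|)` by the
circle average of `log |P(e^w)|` minus its value at `c`. Multiply by a test function `g` that equals
`1` within `R` of each counted logarithm, and integrate over `c`. Each zero contributes `πR²/2`, the
term `n max(re w, 0)` contributes the main term `n (b - a + 2R) / (2π)`, and, averaging being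
symmetric, `u` is integrated against (average of `g`) minus `g`. That difference is at most `1` near
the two horizontal edges of the strip and at most `R/κ` near the kinks of the trapezoid, where `κ`
is the scale in the real direction (`countP_roots_nearSector_le`).

The kink term is estimated by circles about the origin and costs `R²/κ · log n`. The edge term must
not cost a factor `log n`, and here lies the main idea: the curve `e^(ic) (z + z²)/2`, `|z| = 1`,
touches the unit circle at a single point. Along it the expected `log (1 + ∑ |a_k| ρ^k)` is bounded
by a logarithmic singularity at the point of contact, which is integrable, except on a piece of
length `O(R)` where it is at most of order `log n + n R² + 1`. If `R (log n + n R² + 1) ≤ 1`, the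
expected mass of `u` near an edge is therefore `O(κ + R²)` (`lintegral_inner_box_le`,
`CoeffBounds.lintegral_tangentBound_le`). Points outside the unit circle are treated by reversing
the coefficients.

Zeros with `|log |z|| > κ/2` number at most `O(log n / κ)` in expectation, by the Mahler measure
(`sum_abs_log_roots_le`). Applying the upper bound to the complementary sector gives the lower bound
(`ofReal_mul_polyDiscrepancy_le`). The total is of order `nR + κ/R² + 1 + log n / κ`; with `R = (log
n)^(1/4)/√n` and `κ = (log n)^(3/4)/√n` it is `O(√n (log n)^(1/4))`. All expectations use only the
moments and the negative logarithms of the two end coefficients, never independence. -/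

/-! ### Jensen's inequality for `P ∘ exp`. -/

theorem Differentiable.circleIntegrable_log_norm {f : ℂ → ℂ} (hf : Differentiable ℂ f) (c : ℂ)
    (R : ℝ) : CircleIntegrable (fun z => Real.log ‖f z‖) c R :=
  MeromorphicOn.circleIntegrable_log_norm
    (fun z _ => (hf.differentiableOn.analyticAt Filter.univ_mem : AnalyticAt ℂ f z).meromorphicAt)

/-- The sub-mean value inequality for `log ‖f‖`. -/
theorem Differentiable.log_norm_le_circleAverage {f : ℂ → ℂ} (hf : Differentiable ℂ f) {c : ℂ}
    {R : ℝ} (hR : 0 < R) (hc : f c ≠ 0) :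
    Real.log ‖f c‖ ≤ Real.circleAverage (fun z => Real.log ‖f z‖) c R := by
  have hf' : AnalyticOnNhd ℂ f (Metric.closedBall c |R|) := fun z _ =>
    (hf.differentiableOn.analyticAt Filter.univ_mem)
  rw [hf'.circleAverage_log_norm hR.ne' hc]
  have : 0 ≤ ∑ᶠ u, MeromorphicOn.divisor f (Metric.closedBall c |R|) u
      * Real.log (R * ‖c - u‖⁻¹) := by
    refine finsum_nonneg fun u => ?_
    by_cases hu : u ∈ Metric.closedBall c |R|
    · refine mul_nonneg (mod_cast (MeromorphicOn.AnalyticOnNhd.divisor_nonneg hf' u)) ?_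
      by_cases h0 : c = u
      · simp [h0]
      · refine Real.log_nonneg ?_
        have h1 : 0 < ‖c - u‖ := norm_pos_iff.2 (sub_ne_zero.2 h0)
        rw [← div_eq_mul_inv, le_div_iff₀ h1, one_mul]
        rw [Metric.mem_closedBall, dist_comm, dist_eq_norm, abs_of_pos hR] at hu
        exact hu
    · simp [hu]
  linarith

theorem countable_setOf_exp_eq (a : ℂ) : {w : ℂ | Complex.exp w = a}.Countable := by
  by_cases h : ∃ w, Complex.exp w = a
  · obtain ⟨w, rfl⟩ := h
    refine (Set.countable_range fun n : ℤ => w + n * (2 * Real.pi * Complex.I)).mono ?_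
    intro z hz
    obtain ⟨n, hn⟩ := Complex.exp_eq_exp_iff_exists_int.1 hz
    exact ⟨n, hn.symm⟩
  · push Not at h
    convert Set.countable_empty
    ext w
    simp [h w]

/-- A countable set meets a circle in a null set of angles. This disposes of the zeros of `P ∘ exp`,
where `Real.log 0 = 0` breaks the product rule for the logarithm. -/
theorem circleAverage_congr_of_countable {f g : ℂ → ℝ} {s : Set ℂ} (hs : s.Countable)
    (hfg : ∀ z ∉ s, f z = g z) {c : ℂ} {R : ℝ} (hR : R ≠ 0) :
    Real.circleAverage f c R = Real.circleAverage g c R := by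
  unfold Real.circleAverage
  congr 1
  refine intervalIntegral.integral_congr_ae ?_
  filter_upwards [(hs.preimage_circleMap c hR).ae_notMem volume] with t ht _
  exact hfg _ ht

/-- A zero `v` of an entire function contributes `log⁺ (R / ‖c - v‖)` to Jensen's formula. -/
theorem log_norm_add_posLog_le_circleAverage {f : ℂ → ℂ} (hf : Differentiable ℂ f) {s : Set ℂ}
    (hs : s.Countable) (hfs : ∀ z ∉ s, f z ≠ 0) {c v : ℂ} {R : ℝ} (hR : 0 < R) (hv : f v = 0)
    (hc : f c ≠ 0) :
    Real.log ‖f c‖ + Real.posLog (R / ‖c - v‖) ≤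
      Real.circleAverage (fun z => Real.log ‖f z‖) c R := by
  -- The zero is divided out: the linear factor has an exactly known circle average, and the
  -- quotient needs only the sub-mean value inequality.
  have hh : Differentiable ℂ (dslope f v) := by
    rw [← differentiableOn_univ, Complex.differentiableOn_dslope Filter.univ_mem]
    exact hf.differentiableOn
  have hfac : ∀ z, f z = (z - v) * dslope f v z := fun z => by
    have := sub_smul_dslope f v z
    rw [hv, sub_zero] at this
    simpa using this.symm
  have hcv : c - v ≠ 0 := fun h => hc (by rw [hfac, h, zero_mul])
  have hhc : dslope f v c ≠ 0 := fun h => hc (by rw [hfac, h, mul_zero])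
  have h1 : Real.circleAverage (fun z => Real.log ‖f z‖) c R =
      Real.circleAverage (fun z => Real.log ‖z - v‖ + Real.log ‖dslope f v z‖) c R := by
    refine circleAverage_congr_of_countable hs (fun z hz => ?_) hR.ne'
    have h2 := hfs z hz
    rw [hfac] at h2 ⊢
    rw [norm_mul, Real.log_mul (norm_ne_zero_iff.2 (left_ne_zero_of_mul h2))
      (norm_ne_zero_iff.2 (right_ne_zero_of_mul h2))]
  rw [h1, Real.circleAverage_fun_add (circleIntegrable_log_norm_sub_const R)
    (hh.circleIntegrable_log_norm c R),
    circleAverage_log_norm_sub_const_eq_log_radius_add_posLog hR.ne']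
  have h2 := hh.log_norm_le_circleAverage hR hhc
  have hcv' : 0 < ‖c - v‖ := norm_pos_iff.2 hcv
  have h3 : Real.log ‖f c‖ = Real.log ‖c - v‖ + Real.log ‖dslope f v c‖ := by
    rw [hfac, norm_mul, Real.log_mul hcv'.ne' (norm_ne_zero_iff.2 hhc)]
  have h4 : Real.posLog (R / ‖c - v‖) + Real.log ‖c - v‖ = Real.log R +
      Real.posLog (R⁻¹ * ‖c - v‖) := by
    have := Real.posLog_sub_posLog_inv (x := R / ‖c - v‖)
    rw [Real.log_div hR.ne' hcv'.ne', inv_div] at this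
    rw [← div_eq_inv_mul]
    linarith
  linarith

theorem exp_sub_circleAverage (a c v : ℂ) {R : ℝ} (hR : 0 < R) (hv : Complex.exp v = a)
    (hc : Complex.exp c ≠ a) :
    Real.log ‖Complex.exp c - a‖ + Real.posLog (R / ‖c - v‖) ≤
      Real.circleAverage (fun z => Real.log ‖Complex.exp z - a‖) c R :=
  log_norm_add_posLog_le_circleAverage (f := fun z => Complex.exp z - a) (by fun_prop)
    (countable_setOf_exp_eq a) (fun z hz => sub_ne_zero.2 hz) hR (sub_eq_zero.2 hv)
    (sub_ne_zero.2 hc)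

theorem countable_setOf_eval_exp_eq_zero {P : ℂ[X]} (hP : P ≠ 0) :
    {w : ℂ | P.eval (Complex.exp w) = 0}.Countable := by
  have : {w : ℂ | P.eval (Complex.exp w) = 0} =
      ⋃ a ∈ (P.roots.toFinset : Set ℂ), {w : ℂ | Complex.exp w = a} := by
    ext w
    simp [hP]
  rw [this]
  exact (Finset.countable_toSet _).biUnion fun a _ => countable_setOf_exp_eq a

theorem log_norm_eval_eq_add_sum_roots {P : ℂ[X]} {w : ℂ} (hw : P.eval w ≠ 0) :
    Real.log ‖P.eval w‖ =
      Real.log ‖P.leadingCoeff‖ + (P.roots.map fun a => Real.log ‖w - a‖).sum := by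
  have hP : P ≠ 0 := fun h => hw (by simp [h])
  have hlc : P.leadingCoeff ≠ 0 := Polynomial.leadingCoeff_ne_zero.2 hP
  have hne : ∀ a ∈ P.roots, w ≠ a := by
    intro a ha h
    exact hw (h ▸ (Polynomial.mem_roots hP).1 ha)
  have hev : ‖P.eval w‖ = ‖P.leadingCoeff‖ * (P.roots.map fun a => ‖w - a‖).prod := by
    conv_lhs => rw [(IsAlgClosed.splits P).eq_prod_roots]
    simp only [Polynomial.eval_mul, Polynomial.eval_C, norm_mul, Polynomial.eval_multiset_prod,
      Multiset.map_map]
    congr 1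
    refine (map_multiset_prod (normHom : ℂ →*₀ ℝ) _).trans ?_
    rw [Multiset.map_map]
    simp [Function.comp_def, normHom]
  rw [hev, Real.log_mul (norm_ne_zero_iff.2 hlc), Real.log_multiset_prod, Multiset.map_map]
  · rfl
  · intro x hx
    obtain ⟨a, ha, rfl⟩ := Multiset.mem_map.1 hx
    exact norm_ne_zero_iff.2 (sub_ne_zero.2 (hne a ha))
  · refine Multiset.prod_ne_zero fun h0 => ?_
    obtain ⟨a, ha, h⟩ := Multiset.mem_map.1 h0
    exact hne a ha (sub_eq_zero.1 (norm_eq_zero.1 h))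

/-- A logarithm of each nonzero root, together with the product formula, gives Jensen's inequality
for `P ∘ exp`: the roots in `T` are counted with the logarithms `v z`. -/
theorem polynomial_exp_circleAverage (P : ℂ[X]) (hP : P ≠ 0) (v : ℂ → ℂ) (T : Set ℂ)
    (hv : ∀ z ∈ T, Complex.exp (v z) = z) {c : ℂ} {R : ℝ} (hR : 0 < R)
    (hc : P.eval (Complex.exp c) ≠ 0) :
    Real.log ‖P.eval (Complex.exp c)‖ +
        (P.roots.map (T.indicator fun z => Real.posLog (R / ‖c - v z‖))).sum ≤
      Real.circleAverage (fun z => Real.log ‖P.eval (Complex.exp z)‖) c R := by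
  -- Induction over the linear factors. A root outside `T` has no chosen logarithm and is treated by
  -- the sub-mean value inequality alone; the leading coefficient cancels at the end.
  have key : ∀ s : Multiset ℂ, (∀ a ∈ s, Complex.exp c ≠ a) →
      CircleIntegrable (fun w => (s.map fun a => Real.log ‖Complex.exp w - a‖).sum) c R ∧
      (s.map fun a => Real.log ‖Complex.exp c - a‖).sum +
        (s.map (T.indicator fun z => Real.posLog (R / ‖c - v z‖))).sum ≤
      Real.circleAverage (fun w => (s.map fun a => Real.log ‖Complex.exp w - a‖).sum) c R := by
    intro s
    induction s using Multiset.induction with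
    | empty => intro _; simp [Real.circleAverage, CircleIntegrable]
    | cons a s ih =>
      intro hs
      obtain ⟨h1, h2⟩ := ih fun b hb => hs b (Multiset.mem_cons_of_mem hb)
      have hd : Differentiable ℂ fun z => Complex.exp z - a := by fun_prop
      have h3 := hd.circleIntegrable_log_norm c R
      have hca := hs a (Multiset.mem_cons_self a s)
      simp only [Multiset.map_cons, Multiset.sum_cons]
      refine ⟨h3.add h1, ?_⟩
      rw [Real.circleAverage_fun_add h3 h1]
      by_cases haT : a ∈ T
      · have := exp_sub_circleAverage a c (v a) hR (hv a haT) hca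
        rw [Set.indicator_of_mem haT]
        linarith
      · have := hd.log_norm_le_circleAverage hR (sub_ne_zero.2 hca)
        rw [Set.indicator_of_notMem haT]
        linarith
  have hlog : ∀ w, P.eval (Complex.exp w) ≠ 0 → Real.log ‖P.eval (Complex.exp w)‖ =
      Real.log ‖P.leadingCoeff‖ + (P.roots.map fun a => Real.log ‖Complex.exp w - a‖).sum :=
    fun w hw => log_norm_eval_eq_add_sum_roots hw
  have hne : ∀ a ∈ P.roots, Complex.exp c ≠ a := by
    intro a ha h
    exact hc (h ▸ (Polynomial.mem_roots hP).1 ha)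
  have hcount := countable_setOf_eval_exp_eq_zero hP
  obtain ⟨h1, h2⟩ := key P.roots hne
  rw [circleAverage_congr_of_countable hcount (fun z hz => hlog z hz) hR.ne',
    Real.circleAverage_fun_add (by simp [CircleIntegrable]) h1, Real.circleAverage_const, hlog c hc]
  linarith

/-! ### Plane integrals of the Jensen kernel and of the convexity defect of `max (re z) 0`. -/

theorem re_circleMap (c : ℂ) (R t : ℝ) : (circleMap c R t).re = c.re + R * Real.cos t := by
  simp [circleMap, Complex.exp_ofReal_mul_I_re]

theorem posLog_div_eq {R y : ℝ} (hR : 0 < R) (hy : 0 < y) :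
    Real.posLog (R / y) = if y ≤ R then Real.log R - Real.log y else 0 := by
  split_ifs with h
  · rw [Real.posLog_eq_log, Real.log_div hR.ne' hy.ne']
    rw [abs_of_pos (by positivity), le_div_iff₀ hy]
    linarith
  · rw [Real.posLog_eq_zero_iff, abs_of_pos (by positivity), div_le_one hy]
    linarith

/-- The factor `y` is the polar-coordinate density, so this is the radial part of the plane integral
of `log⁺ (R / ‖w‖)`. -/
theorem integrableOn_and_integral_mul_posLog_div {R : ℝ} (hR : 0 < R) :
    IntegrableOn (fun y : ℝ => y * Real.posLog (R / y)) (Set.Ioi 0) ∧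
      ∫ y in Set.Ioi (0 : ℝ), y * Real.posLog (R / y) = R ^ 2 / 4 := by
  have hcont : Continuous fun y : ℝ => y * (Real.log R - Real.log y) := by
    simp_rw [mul_sub]
    exact (continuous_id.mul continuous_const).sub Real.continuous_mul_log
  have heq : ∀ y ∈ Set.Ioi (0 : ℝ), y * Real.posLog (R / y) =
      (Set.Ioc 0 R).indicator (fun y => y * (Real.log R - Real.log y)) y := by
    intro y hy
    rw [posLog_div_eq hR hy]
    by_cases h : y ≤ R
    · rw [Set.indicator_of_mem (show y ∈ Set.Ioc 0 R from ⟨hy, h⟩), if_pos h]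
    · rw [Set.indicator_of_notMem (fun h' => h h'.2), if_neg h, mul_zero]
  have hint : IntegrableOn (fun y : ℝ => y * (Real.log R - Real.log y)) (Set.Ioc 0 R) :=
    (hcont.integrableOn_Icc).mono_set Set.Ioc_subset_Icc_self
  constructor
  · rw [integrableOn_congr_fun heq measurableSet_Ioi]
    exact ((integrable_indicator_iff measurableSet_Ioc).2 hint).integrableOn
  · rw [setIntegral_congr_fun measurableSet_Ioi heq, setIntegral_indicator measurableSet_Ioc,
      Set.inter_eq_self_of_subset_right (fun y hy => hy.1),
      ← intervalIntegral.integral_of_le hR.le]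
    -- Grouping the antiderivative around `y * log y` makes its continuity at `0` visible; the
    -- derivative is needed only in the open interval.
    have h := intervalIntegral.integral_eq_sub_of_hasDerivAt_of_le hR.le
      (f := fun y => y ^ 2 / 2 * Real.log R - y / 2 * (y * Real.log y) + y ^ 2 / 4)
      (f' := fun y => y * (Real.log R - Real.log y)) ?_ ?_ (hcont.intervalIntegrable _ _)
    · rw [h]; simp; ring
    · have := Real.continuous_mul_log
      fun_prop
    · intro y hy
      have h1 := (hasDerivAt_id y).mul (Real.hasDerivAt_log hy.1.ne')
      have h2 := ((((hasDerivAt_id y).pow 2).div_const 2).mul_const (Real.log R)).sub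
        (((hasDerivAt_id y).div_const 2).mul h1) |>.add (((hasDerivAt_id y).pow 2).div_const 4)
      refine h2.congr_deriv ?_
      have := hy.1.ne'
      simp
      field_simp
      ring

theorem integrable_posLog_div_norm {R : ℝ} (hR : 0 < R) :
    Integrable fun w : ℂ => Real.posLog (R / ‖w‖) := by
  rw [integrable_fun_norm_addHaar volume (f := fun y => Real.posLog (R / y))]
  simpa using (integrableOn_and_integral_mul_posLog_div hR).1

theorem integral_posLog_div_norm {R : ℝ} (hR : 0 < R) :
    ∫ w : ℂ, Real.posLog (R / ‖w‖) = Real.pi * R ^ 2 / 2 := by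
  rw [integral_fun_norm_addHaar volume (fun y => Real.posLog (R / y))]
  have := (integrableOn_and_integral_mul_posLog_div hR).2
  simp only [Complex.finrank_real_complex, Nat.add_one_sub_one, pow_one, smul_eq_mul, this,
    Measure.real, Complex.volume_ball]
  simp
  ring

theorem continuous_circleAverage_of_continuous {f : ℂ → ℝ} (hf : Continuous f) (R : ℝ) :
    Continuous fun c => Real.circleAverage f c R := by
  have h : Continuous fun p : ℂ × ℝ => f (circleMap p.1 R p.2) := by
    unfold circleMap
    fun_prop
  have := intervalIntegral.continuous_parametric_intervalIntegral_of_continuous'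
    (μ := volume) (f := fun c t => f (circleMap c R t)) h 0 (2 * Real.pi)
  exact this.const_smul (2 * Real.pi)⁻¹

/-- The average over a circle of an affine function of the real part. -/
theorem circleAverage_affine_re (p q : ℝ) (c : ℂ) (R : ℝ) :
    Real.circleAverage (fun z => p + q * z.re) c R = p + q * c.re := by
  simp only [Real.circleAverage, re_circleMap, smul_eq_mul]
  have : ∀ t, p + q * (c.re + R * Real.cos t) = (p + q * c.re) + q * R * Real.cos t := by
    intro t; ring
  simp_rw [this]
  rw [intervalIntegral.integral_add (by simp)
    (Continuous.intervalIntegrable (by fun_prop) _ _)]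
  simp
  field_simp

/-- The excess of the average of `max (re z) 0` over a circle over its value at the centre. -/
noncomputable def posPartExcess (R x : ℝ) : ℝ :=
  Real.circleAverage (fun z => max z.re 0) (x : ℂ) R - max x 0

theorem circleAverage_max_re (c : ℂ) (R : ℝ) :
    Real.circleAverage (fun z => max z.re 0) c R = posPartExcess R c.re + max c.re 0 := by
  simp [posPartExcess, Real.circleAverage, re_circleMap]

theorem continuous_posPartExcess (R : ℝ) : Continuous (posPartExcess R) := by
  unfold posPartExcess
  exact ((continuous_circleAverage_of_continuous (f := fun z => max z.re 0) (by fun_prop) R).comp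
    Complex.continuous_ofReal).sub (continuous_id.max continuous_const)

theorem circleAverage_mono_of_continuous {f g : ℂ → ℝ} (hf : Continuous f) (hg : Continuous g)
    {c : ℂ} {R : ℝ} (h : ∀ z ∈ Metric.sphere c |R|, f z ≤ g z) :
    Real.circleAverage f c R ≤ Real.circleAverage g c R :=
  Real.circleAverage_mono (hf.continuousOn.circleIntegrable')
    (hg.continuousOn.circleIntegrable') h

/-- Convexity of `max x 0`: one of the affine minorants `0` and `x` touches it at the centre, and
affine functions equal their averages. -/
theorem posPartExcess_nonneg (R x : ℝ) : 0 ≤ posPartExcess R x := by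
  unfold posPartExcess
  rcases le_total x 0 with h | h
  · have := circleAverage_mono_of_continuous (f := fun z => 0 + 0 * z.re)
      (g := fun z : ℂ => max z.re 0) (c := x) (R := R) (by fun_prop) (by fun_prop) (by simp)
    rw [circleAverage_affine_re] at this
    simp [h] at this ⊢
    exact this
  · have := circleAverage_mono_of_continuous (f := fun z => 0 + 1 * z.re)
      (g := fun z : ℂ => max z.re 0) (c := x) (R := R) (by fun_prop) (by fun_prop) (by simp)
    rw [circleAverage_affine_re] at this
    simp [h] at this ⊢
    exact this

/-- On such a circle the real part does not change sign, so `max (re z) 0` is affine there. -/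
theorem posPartExcess_eq_zero {R x : ℝ} (hR : 0 < R) (hx : R ≤ |x|) : posPartExcess R x = 0 := by
  have hb : ∀ z ∈ Metric.sphere (x : ℂ) |R|, |z.re - x| ≤ R := by
    intro z hz
    have h1 := Complex.abs_re_le_norm (z - x)
    rw [mem_sphere_iff_norm, abs_of_pos hR] at hz
    simpa [hz] using h1
  unfold posPartExcess
  rcases le_total x 0 with h | h
  · rw [abs_of_nonpos h] at hx
    rw [Real.circleAverage_congr_sphere (f₂ := fun z => 0 + 0 * z.re), circleAverage_affine_re]
    · simp [h]
    · intro z hz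
      have := abs_le.1 (hb z hz)
      simp
      linarith
  · rw [abs_of_nonneg h] at hx
    rw [Real.circleAverage_congr_sphere (f₂ := fun z => 0 + 1 * z.re), circleAverage_affine_re]
    · simp [h]
    · intro z hz
      have := abs_le.1 (hb z hz)
      simp
      linarith

theorem integral_max_zero_shift {R s : ℝ} (hs : |s| ≤ R) :
    ∫ x in (-R)..R, max (x + s) 0 = (R + s) ^ 2 / 2 := by
  have hs' := abs_le.1 hs
  rw [intervalIntegral.integral_comp_add_right (fun y => max y 0)]
  have hc : Continuous fun y : ℝ => max y 0 := by fun_prop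
  rw [← intervalIntegral.integral_add_adjacent_intervals (hc.intervalIntegrable (-R + s) 0)
    (hc.intervalIntegrable 0 (R + s))]
  have h1 : ∫ y in (-R + s)..0, max y 0 = ∫ y in (-R + s)..0, (0 : ℝ) := by
    refine intervalIntegral.integral_congr fun y hy => ?_
    rw [Set.uIcc_of_le (by linarith)] at hy
    exact max_eq_right hy.2
  have h2 : ∫ y in (0 : ℝ)..(R + s), max y 0 = ∫ y in (0 : ℝ)..(R + s), y := by
    refine intervalIntegral.integral_congr fun y hy => ?_
    rw [Set.uIcc_of_le (by linarith)] at hy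
    exact max_eq_left hy.1
  rw [h1, h2]
  simp

/-- After exchanging the integrals, the shift by `s = R cos t` contributes `(R + s)² / 2`. Divided
by the mass `πR²/2` of the Jensen kernel, the value `R²/4` is the density `1/(2π)` of
equidistributed arguments. -/
theorem integral_posPartExcess {R : ℝ} (hR : 0 < R) : ∫ x, posPartExcess R x = R ^ 2 / 4 := by
  have h1 : ∫ x, posPartExcess R x = ∫ x in (-R)..R, posPartExcess R x := by
    rw [intervalIntegral.integral_of_le (by linarith)]
    refine (setIntegral_eq_integral_of_forall_compl_eq_zero fun x hx => ?_).symm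
    refine posPartExcess_eq_zero hR ?_
    by_contra h
    push Not at h
    have := abs_lt.1 h
    exact hx ⟨this.1, this.2.le⟩
  have hc1 : Continuous fun x : ℝ => Real.circleAverage (fun z => max z.re 0) (x : ℂ) R :=
    (continuous_circleAverage_of_continuous (f := fun z => max z.re 0) (by fun_prop) R).comp
      Complex.continuous_ofReal
  have hc2 : Continuous fun x : ℝ => max x 0 := by fun_prop
  have h0 := integral_max_zero_shift (R := R) (s := 0) (by simpa using hR.le)
  simp only [add_zero] at h0
  rw [h1]
  unfold posPartExcess
  rw [intervalIntegral.integral_sub (hc1.intervalIntegrable _ _) (hc2.intervalIntegrable _ _), h0]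
  simp only [Real.circleAverage, re_circleMap, smul_eq_mul, Complex.ofReal_re]
  rw [intervalIntegral.integral_const_mul, intervalIntegral_intervalIntegral_swap]
  · have h2 : ∀ t, ∫ x in (-R)..R, max (x + R * Real.cos t) 0 =
        R ^ 2 / 2 * (1 + 2 * Real.cos t + Real.cos t ^ 2) := by
      intro t
      rw [integral_max_zero_shift]
      · ring
      · rw [abs_mul, abs_of_pos hR]
        exact mul_le_of_le_one_right hR.le (Real.abs_cos_le_one t)
    simp_rw [h2]
    rw [intervalIntegral.integral_const_mul, intervalIntegral.integral_add
      (Continuous.intervalIntegrable (by fun_prop) _ _)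
      (Continuous.intervalIntegrable (by fun_prop) _ _),
      intervalIntegral.integral_add (by simp) (Continuous.intervalIntegrable (by fun_prop) _ _),
      integral_cos_sq]
    simp
    field_simp
    norm_num
  · rw [Set.uIoc_of_le (by linarith), Set.uIoc_of_le (by positivity)]
    have : Continuous (Function.uncurry fun x t : ℝ => max (x + R * Real.cos t) 0) := by
      unfold Function.uncurry
      fun_prop
    exact (this.continuousOn.integrableOn_compact (isCompact_Icc.prod isCompact_Icc)).mono_set
      (Set.prod_mono Set.Ioc_subset_Icc_self Set.Ioc_subset_Icc_self)

theorem integrable_posPartExcess {R : ℝ} (hR : 0 < R) : Integrable (posPartExcess R) :=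
  (continuous_posPartExcess R).integrable_of_hasCompactSupport
    (HasCompactSupport.intro (isCompact_Icc (a := -R) (b := R)) fun x hx =>
      posPartExcess_eq_zero hR (by
        by_contra h
        push Not at h
        have := abs_lt.1 h
        exact hx ⟨this.1.le, this.2.le⟩))

/-! ### The test function and its circle averages. -/

/-- The trapezoid which is `1` on `[-κ, κ]` and vanishes off `[-2κ, 2κ]`. -/
noncomputable def trapezoid (κ x : ℝ) : ℝ := min 1 (max 0 (2 - |x| / κ))

theorem trapezoid_nonneg (κ x : ℝ) : 0 ≤ trapezoid κ x := le_min zero_le_one (le_max_left _ _)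

theorem trapezoid_le_one (κ x : ℝ) : trapezoid κ x ≤ 1 := min_le_left _ _

theorem continuous_trapezoid (κ : ℝ) : Continuous (trapezoid κ) := by
  unfold trapezoid
  fun_prop

theorem trapezoid_eq_one {κ x : ℝ} (hκ : 0 < κ) (hx : |x| ≤ κ) : trapezoid κ x = 1 := by
  have : |x| / κ ≤ 1 := (div_le_one hκ).2 hx
  unfold trapezoid
  rw [max_eq_right (by linarith), min_eq_left (by linarith)]

theorem trapezoid_eq_zero {κ x : ℝ} (hκ : 0 < κ) (hx : 2 * κ ≤ |x|) : trapezoid κ x = 0 := by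
  have : 2 ≤ |x| / κ := (le_div_iff₀ hκ).2 hx
  unfold trapezoid
  rw [max_eq_left (by linarith), min_eq_right (by linarith)]

theorem trapezoid_eq_sub {κ x : ℝ} (hκ : 0 < κ) (h1 : κ ≤ |x|) (h2 : |x| ≤ 2 * κ) :
    trapezoid κ x = 2 - |x| / κ := by
  have h3 : 1 ≤ |x| / κ := (one_le_div hκ).2 h1
  have h4 : |x| / κ ≤ 2 := (div_le_iff₀ hκ).2 h2
  unfold trapezoid
  rw [max_eq_right (by linarith), min_eq_right (by linarith)]

theorem abs_trapezoid_sub_le {κ : ℝ} (hκ : 0 < κ) (x y : ℝ) :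
    |trapezoid κ x - trapezoid κ y| ≤ |x - y| / κ := by
  have h : |(2 - |x| / κ) - (2 - |y| / κ)| ≤ |x - y| / κ := by
    have h1 : (2 - |x| / κ) - (2 - |y| / κ) = (|y| - |x|) / κ := by ring
    rw [h1, abs_div, abs_of_pos hκ]
    rw [abs_sub_comm x y]
    exact div_le_div_of_nonneg_right (abs_abs_sub_abs_le_abs_sub y x) hκ.le
  unfold trapezoid
  calc _ ≤ max |(1 : ℝ) - 1| |max 0 (2 - |x| / κ) - max 0 (2 - |y| / κ)| :=
        abs_min_sub_min_le_max _ _ _ _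
    _ ≤ max |(1 : ℝ) - 1| (max |(0 : ℝ) - 0| |(2 - |x| / κ) - (2 - |y| / κ)|) :=
        max_le_max le_rfl (abs_max_sub_max_le_max _ _ _ _)
    _ ≤ |x - y| / κ := by
        have : 0 ≤ |x - y| / κ := by positivity
        simp only [sub_self, abs_zero]
        exact max_le this (max_le this h)

/-- The points within `R` of a kink of the trapezoid. -/
def nearKink (κ R : ℝ) : Set ℝ :=
  {x | |x - κ| ≤ R ∨ |x + κ| ≤ R ∨ |x - 2 * κ| ≤ R ∨ |x + 2 * κ| ≤ R}

theorem abs_re_sub_le_of_mem_sphere {c z : ℂ} {R : ℝ} (hR : 0 < R)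
    (hz : z ∈ Metric.sphere c |R|) : |z.re - c.re| ≤ R ∧ |z.im - c.im| ≤ R := by
  have h1 := Complex.abs_re_le_norm (z - c)
  have h2 := Complex.abs_im_le_norm (z - c)
  rw [mem_sphere_iff_norm, abs_of_pos hR] at hz
  rw [hz] at h1 h2
  exact ⟨by simpa using h1, by simpa using h2⟩

/-- A circle average stays close to the value at the centre if the function does. -/
theorem abs_circleAverage_sub_le {f : ℂ → ℝ} {c : ℂ} {R C v : ℝ}
    (hf : CircleIntegrable f c R) (h : ∀ z ∈ Metric.sphere c |R|, |f z - v| ≤ C) :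
    |Real.circleAverage f c R - v| ≤ C := by
  have h1 : Real.circleAverage (fun _ => v - C) c R ≤ Real.circleAverage f c R :=
    Real.circleAverage_mono (by simp [CircleIntegrable]) hf fun z hz => by
      have := abs_le.1 (h z hz)
      linarith
  have h2 : Real.circleAverage f c R ≤ v + C :=
    Real.circleAverage_mono_on_of_le_circle hf fun z hz => by
      have := abs_le.1 (h z hz)
      linarith
  rw [Real.circleAverage_const] at h1
  exact abs_le.2 ⟨by linarith, by linarith⟩

theorem circleIntegrable_trapezoid (κ R : ℝ) (c : ℂ) :
    CircleIntegrable (fun z => trapezoid κ z.re) c R :=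
  ((continuous_trapezoid κ).comp Complex.continuous_re).continuousOn.circleIntegrable'

theorem abs_circleAverage_trapezoid_sub_le {κ R : ℝ} (hκ : 0 < κ) (hR : 0 < R) (c : ℂ) :
    |Real.circleAverage (fun z => trapezoid κ z.re) c R - trapezoid κ c.re| ≤ R / κ := by
  refine abs_circleAverage_sub_le (circleIntegrable_trapezoid κ R c) fun z hz => ?_
  refine (abs_trapezoid_sub_le hκ _ _).trans ?_
  gcongr
  exact (abs_re_sub_le_of_mem_sphere hR hz).1

/-- Within distance `R` of a point that is not near a kink the trapezoid is one affine function, and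
averaging preserves affine functions. The five cases are its linear pieces. -/
theorem circleAverage_trapezoid_eq {κ R : ℝ} (hκ : 0 < κ) (hR : 0 < R) (c : ℂ)
    (hc : c.re ∉ nearKink κ R) :
    Real.circleAverage (fun z => trapezoid κ z.re) c R = trapezoid κ c.re := by
  obtain ⟨p, q, hpq⟩ : ∃ p q : ℝ, ∀ y, |y - c.re| ≤ R → trapezoid κ y = p + q * y := by
    simp only [nearKink, Set.mem_ofPred_eq, not_or, not_le, lt_abs] at hc
    obtain ⟨h1, h2, h3, h4⟩ := hc
    by_cases hA : R < c.re - 2 * κ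
    · refine ⟨0, 0, fun y hy => ?_⟩
      have := abs_le.1 hy
      rw [trapezoid_eq_zero hκ (by rw [le_abs]; left; linarith)]
      ring
    by_cases hB : R < -(c.re + 2 * κ)
    · refine ⟨0, 0, fun y hy => ?_⟩
      have := abs_le.1 hy
      rw [trapezoid_eq_zero hκ (by rw [le_abs]; right; linarith)]
      ring
    by_cases hC : R < c.re - κ
    · refine ⟨2, -1 / κ, fun y hy => ?_⟩
      have := abs_le.1 hy
      have h5 : R < -(c.re - 2 * κ) := h3.resolve_left hA
      have hy0 : |y| = y := abs_of_nonneg (by linarith)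
      rw [trapezoid_eq_sub hκ (by rw [hy0]; linarith) (by rw [hy0]; linarith), hy0]
      ring
    by_cases hD : R < -(c.re + κ)
    · refine ⟨2, 1 / κ, fun y hy => ?_⟩
      have := abs_le.1 hy
      have h5 : R < c.re + 2 * κ := h4.resolve_right hB
      have hy0 : |y| = -y := abs_of_nonpos (by linarith)
      rw [trapezoid_eq_sub hκ (by rw [hy0]; linarith) (by rw [hy0]; linarith), hy0]
      ring
    · refine ⟨1, 0, fun y hy => ?_⟩
      have := abs_le.1 hy
      have h5 := h1.resolve_left hC
      have h6 := h2.resolve_right hD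
      rw [trapezoid_eq_one hκ (abs_le.2 ⟨by linarith, by linarith⟩)]
      ring
  rw [Real.circleAverage_congr_sphere (f₂ := fun z => p + q * z.re), circleAverage_affine_re,
    hpq _ (by simp [hR.le])]
  intro z hz
  exact hpq _ (abs_re_sub_le_of_mem_sphere hR hz).1

/-- The test function: the trapezoid in the real part, cut off to `a - R ≤ im z ≤ b + R`. -/
noncomputable def sectorBump (κ R a b : ℝ) (z : ℂ) : ℝ :=
  {z : ℂ | a - R ≤ z.im ∧ z.im ≤ b + R}.indicator (fun z => trapezoid κ z.re) z

theorem measurableSet_im_strip (a b : ℝ) : MeasurableSet {z : ℂ | a ≤ z.im ∧ z.im ≤ b} :=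
  (measurableSet_le measurable_const Complex.measurable_im).inter
    (measurableSet_le Complex.measurable_im measurable_const)

theorem measurable_sectorBump (κ R a b : ℝ) : Measurable (sectorBump κ R a b) :=
  (((continuous_trapezoid κ).measurable).comp Complex.measurable_re).indicator
    (measurableSet_im_strip _ _)

theorem sectorBump_nonneg (κ R a b : ℝ) (z : ℂ) : 0 ≤ sectorBump κ R a b z :=
  Set.indicator_nonneg (fun _ _ => trapezoid_nonneg _ _) _

theorem sectorBump_le_one (κ R a b : ℝ) (z : ℂ) : sectorBump κ R a b z ≤ 1 :=
  Set.indicator_le' (fun _ _ => trapezoid_le_one _ _) (fun _ _ => zero_le_one) _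

theorem circleIntegrable_sectorBump (κ R a b : ℝ) (c : ℂ) :
    CircleIntegrable (sectorBump κ R a b) c R := by
  refine (intervalIntegrable_const (c := (1 : ℝ))).mono_fun ?_ ?_
  · exact ((measurable_sectorBump κ R a b).comp (continuous_circleMap c R).measurable).aestronglyMeasurable
  · refine Eventually.of_forall fun t => ?_
    change ‖sectorBump κ R a b (circleMap c R t)‖ ≤ ‖(1 : ℝ)‖
    rw [Real.norm_of_nonneg (sectorBump_nonneg _ _ _ _ _)]
    simpa using sectorBump_le_one κ R a b _

/-- The points near the two lines bounding the strip. -/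
def strip (κ R a b : ℝ) : Set ℂ :=
  {z | (|z.im - (a - R)| ≤ R ∨ |z.im - (b + R)| ≤ R) ∧ |z.re| ≤ 3 * κ}

/-- The points of the strip whose real part is near a kink. -/
def kinkStrip (κ R a b : ℝ) : Set ℂ :=
  {z | (a - R ≤ z.im ∧ z.im ≤ b + R) ∧ z.re ∈ nearKink κ R}

theorem measurableSet_abs_sub_le {f : ℂ → ℝ} (hf : Measurable f) (p R : ℝ) :
    MeasurableSet {z | |f z - p| ≤ R} :=
  measurableSet_le (by fun_prop) measurable_const

theorem measurableSet_strip (κ R a b : ℝ) : MeasurableSet (strip κ R a b) :=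
  ((measurableSet_abs_sub_le Complex.measurable_im _ _).union
    (measurableSet_abs_sub_le Complex.measurable_im _ _)).inter
    (measurableSet_le (Measurable.abs Complex.measurable_re) measurable_const)

theorem isClosed_nearKink (κ R : ℝ) : IsClosed (nearKink κ R) := by
  have h : ∀ p : ℝ, IsClosed {x : ℝ | |x - p| ≤ R} := fun p =>
    isClosed_le (by fun_prop) continuous_const
  have h' : ∀ p : ℝ, IsClosed {x : ℝ | |x + p| ≤ R} := fun p =>
    isClosed_le (by fun_prop) continuous_const
  exact (h _).union ((h' _).union ((h _).union (h' _)))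

theorem measurableSet_kinkStrip (κ R a b : ℝ) : MeasurableSet (kinkStrip κ R a b) :=
  (measurableSet_im_strip _ _).inter (Complex.measurable_re (isClosed_nearKink κ R).measurableSet)

/-- Near a horizontal edge the cut-off jumps and only the trivial bound `1` remains. Inside the
strip the averaging error comes from the kinks, where the Lipschitz constant `1/κ` gives `R/κ`.
Elsewhere the test function vanishes at the point and on the circle around it. -/
theorem abs_circleAverage_sectorBump_sub_le {κ R a b : ℝ} (hR : 0 < R) (hRκ : 2 * R ≤ κ) (w : ℂ) :
    |Real.circleAverage (sectorBump κ R a b) w R - sectorBump κ R a b w| ≤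
      (strip κ R a b).indicator 1 w + R / κ * (kinkStrip κ R a b).indicator 1 w := by
  have hκ : 0 < κ := by linarith
  have hI1 : 0 ≤ (strip κ R a b).indicator (1 : ℂ → ℝ) w :=
    Set.indicator_nonneg (fun _ _ => zero_le_one) _
  have hI2 : 0 ≤ R / κ * (kinkStrip κ R a b).indicator (1 : ℂ → ℝ) w :=
    mul_nonneg (by positivity) (Set.indicator_nonneg (fun _ _ => zero_le_one) _)
  have hzero : (∀ z, (z = w ∨ z ∈ Metric.sphere w |R|) → sectorBump κ R a b z = 0) →
      |Real.circleAverage (sectorBump κ R a b) w R - sectorBump κ R a b w| = 0 := by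
    intro h
    rw [Real.circleAverage_congr_sphere (f₂ := fun _ => 0) (fun z hz => h z (Or.inr hz)),
      Real.circleAverage_const, h w (Or.inl rfl)]
    simp
  by_cases h1 : |w.im - (a - R)| ≤ R ∨ |w.im - (b + R)| ≤ R
  · by_cases h2 : |w.re| ≤ 3 * κ
    · rw [Set.indicator_of_mem (show w ∈ strip κ R a b from ⟨h1, h2⟩)]
      have : |Real.circleAverage (sectorBump κ R a b) w R - sectorBump κ R a b w| ≤ 1 := by
        refine abs_circleAverage_sub_le (circleIntegrable_sectorBump κ R a b w) fun z _ => ?_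
        have e1 := sectorBump_nonneg κ R a b z
        have e2 := sectorBump_le_one κ R a b z
        have e3 := sectorBump_nonneg κ R a b w
        have e4 := sectorBump_le_one κ R a b w
        exact abs_le.2 ⟨by linarith, by linarith⟩
      simp only [Pi.one_apply]
      linarith
    · rw [hzero]
      · linarith
      · intro z hz
        have : 2 * κ ≤ |z.re| := by
          push Not at h2
          rcases hz with rfl | hz
          · linarith
          · have h3 := (abs_re_sub_le_of_mem_sphere hR hz).1
            have h4 := abs_sub_abs_le_abs_sub w.re z.re
            rw [abs_sub_comm] at h4
            linarith
        unfold sectorBump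
        rw [Set.indicator_apply, trapezoid_eq_zero hκ this]
        simp
  push Not at h1
  obtain ⟨h1, h2⟩ := h1
  rw [lt_abs] at h1 h2
  by_cases h3 : a < w.im ∧ w.im < b
  · have hin : ∀ z, (z = w ∨ z ∈ Metric.sphere w |R|) → sectorBump κ R a b z =
        trapezoid κ z.re ∧ a - R ≤ z.im ∧ z.im ≤ b + R := by
      intro z hz
      have : a - R ≤ z.im ∧ z.im ≤ b + R := by
        rcases hz with rfl | hz
        · exact ⟨by linarith, by linarith⟩
        · have h4 := abs_le.1 (abs_re_sub_le_of_mem_sphere hR hz).2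
          exact ⟨by linarith, by linarith⟩
      exact ⟨Set.indicator_of_mem (s := {z : ℂ | a - R ≤ z.im ∧ z.im ≤ b + R}) this _, this⟩
    rw [Real.circleAverage_congr_sphere (f₂ := fun z => trapezoid κ z.re)
      (fun z hz => (hin z (Or.inr hz)).1), (hin w (Or.inl rfl)).1]
    by_cases h4 : w.re ∈ nearKink κ R
    · rw [Set.indicator_of_mem (show w ∈ kinkStrip κ R a b from ⟨(hin w (Or.inl rfl)).2, h4⟩)]
      have := abs_circleAverage_trapezoid_sub_le hκ hR w
      simp only [Pi.one_apply]
      linarith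
    · rw [circleAverage_trapezoid_eq hκ hR w h4]
      simp only [sub_self, abs_zero]
      linarith
  · rw [hzero]
    · linarith
    · intro z hz
      refine Set.indicator_of_notMem (fun hz' => h3 ?_) _
      have h5 : |z.im - w.im| ≤ R := by
        rcases hz with rfl | hz
        · simp [hR.le]
        · exact (abs_re_sub_le_of_mem_sphere hR hz).2
      have h5 := abs_le.1 h5
      have h6 := hz'.1
      have h7 := hz'.2
      constructor
      · rcases h1 with h1 | h1 <;> linarith
      · rcases h2 with h2 | h2 <;> linarith

/-! ### Counting zeros by integrating Jensen's inequality. -/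

/-- Circle averaging is symmetric with respect to integration over the plane. -/
theorem integral_mul_circleAverage {g V : ℂ → ℝ} (hg : Measurable g) (hg1 : ∀ z, |g z| ≤ 1)
    (hV : Integrable V) (R : ℝ) :
    Integrable (fun c => g c * Real.circleAverage V c R) ∧
    Integrable (fun c => Real.circleAverage g c R * V c) ∧
      ∫ c, g c * Real.circleAverage V c R = ∫ c, Real.circleAverage g c R * V c := by
  set μ : Measure ℝ := volume.restrict (Set.Ioc 0 (2 * Real.pi)) with hμ
  have hmap : Measurable fun p : ℝ × ℂ => p.2 + circleMap 0 R p.1 := by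
    refine Continuous.measurable ?_
    have := continuous_circleMap (0 : ℂ) R
    fun_prop
  have hmap' : Measurable fun p : ℝ × ℂ => p.2 - circleMap 0 R p.1 := by
    refine Continuous.measurable ?_
    have := continuous_circleMap (0 : ℂ) R
    fun_prop
  -- The shear by `circleMap 0 R t` preserves the product measure; this gives joint integrability of
  -- the translated function.
  have hpres : MeasurePreserving (fun p : ℝ × ℂ => (p.1, p.2 + circleMap 0 R p.1))
      (μ.prod volume) (μ.prod volume) := by
    refine (MeasurePreserving.id μ).skew_product (g := fun t w => w + circleMap 0 R t) hmap (Eventually.of_forall fun t => ?_)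
    exact (measurePreserving_add_right volume (circleMap 0 R t)).map_eq
  have hV2 : Integrable (fun p : ℝ × ℂ => V p.2) (μ.prod volume) :=
    hV.comp_snd μ
  have hVs : Integrable (fun p : ℝ × ℂ => V (p.2 + circleMap 0 R p.1)) (μ.prod volume) :=
    hpres.integrable_comp_of_integrable hV2
  have hF1 : Integrable (fun p : ℝ × ℂ => g p.2 * V (p.2 + circleMap 0 R p.1))
      (μ.prod volume) :=
    hVs.bdd_mul (c := 1) (hg.comp measurable_snd).aestronglyMeasurable
      (Eventually.of_forall fun p => by simpa using hg1 p.2)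
  have hF2 : Integrable (fun p : ℝ × ℂ => g (p.2 - circleMap 0 R p.1) * V p.2)
      (μ.prod volume) :=
    hV2.bdd_mul (c := 1) (hg.comp hmap').aestronglyMeasurable
      (Eventually.of_forall fun p => by simpa using hg1 _)
  have hcm : ∀ (c : ℂ) (t : ℝ), circleMap c R t = c + circleMap 0 R t := by
    intro c t; simp [circleMap]
  have e1 : ∀ c, g c * Real.circleAverage V c R =
      (2 * Real.pi)⁻¹ * ∫ t, g c * V (c + circleMap 0 R t) ∂μ := by
    intro c
    rw [integral_const_mul, Real.circleAverage, smul_eq_mul,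
      intervalIntegral.integral_of_le (by positivity)]
    simp_rw [hcm c]
    ring
  have e2 : ∀ c, Real.circleAverage g c R * V c =
      (2 * Real.pi)⁻¹ * ∫ t, g (c - circleMap 0 R t) * V c ∂μ := by
    intro c
    -- The radius `-R` parametrizes the same circle by subtracting the translation, so that a change
    -- of variable turns the other average into this one.
    rw [integral_mul_const, ← Real.circleAverage_neg_radius, Real.circleAverage, smul_eq_mul,
      intervalIntegral.integral_of_le (by positivity)]
    have : ∀ t, circleMap c (-R) t = c - circleMap 0 R t := by
      intro t; simp [circleMap, sub_eq_add_neg]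
    simp_rw [this]
    ring
  simp_rw [e1, e2]
  refine ⟨hF1.integral_prod_right.const_mul _, hF2.integral_prod_right.const_mul _, ?_⟩
  rw [integral_const_mul, integral_const_mul,
    ← integral_integral_swap (f := fun t c => g c * V (c + circleMap 0 R t)) hF1,
    ← integral_integral_swap (f := fun t c => g (c - circleMap 0 R t) * V c) hF2]
  congr 2
  ext t
  have := integral_add_right_eq_self (μ := volume) (fun w : ℂ => g (w - circleMap 0 R t) * V w)
    (circleMap 0 R t)
  simpa using this

/-- The logarithm of `|P (e ^ w)|`, normalized by the growth `n * max (re w) 0`. -/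
noncomputable def logSize (P : ℂ[X]) (n : ℕ) (w : ℂ) : ℝ :=
  Real.log (‖P.eval (Complex.exp w)‖ * Real.exp (-(n * max w.re 0)))

theorem measurable_logSize (P : ℂ[X]) (n : ℕ) : Measurable (logSize P n) := by
  unfold logSize
  have : Measurable fun w : ℂ => ‖P.eval (Complex.exp w)‖ * Real.exp (-(n * max w.re 0)) := by
    refine Continuous.measurable ?_
    have := P.continuous
    fun_prop
  exact Real.measurable_log.comp this

theorem logSize_eq {P : ℂ[X]} {n : ℕ} {w : ℂ} (hw : P.eval (Complex.exp w) ≠ 0) :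
    logSize P n w = Real.log ‖P.eval (Complex.exp w)‖ - n * max w.re 0 := by
  rw [logSize, Real.log_mul (norm_ne_zero_iff.2 hw) (Real.exp_pos _).ne', Real.log_exp]
  ring

/-- The rectangle on which the behaviour of `P (e ^ w)` enters the zero count. -/
def bigRect (κ R a b : ℝ) : Set ℂ :=
  {z | |z.re| ≤ 3 * κ ∧ a - 2 * R ≤ z.im ∧ z.im ≤ b + 2 * R}

theorem measurableSet_bigRect (κ R a b : ℝ) : MeasurableSet (bigRect κ R a b) :=
  (measurableSet_le (Measurable.abs Complex.measurable_re) measurable_const).inter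
    (measurableSet_im_strip _ _)

theorem mem_bigRect_of_sectorBump_ne_zero {κ R a b : ℝ} (hR : 0 < R) (hRκ : 2 * R ≤ κ)
    {c z : ℂ} (hc : sectorBump κ R a b c ≠ 0) (hz : |z.re - c.re| ≤ R ∧ |z.im - c.im| ≤ R) :
    z ∈ bigRect κ R a b := by
  have hκ : 0 < κ := by linarith
  have h1 : a - R ≤ c.im ∧ c.im ≤ b + R := by
    by_contra h
    exact hc (Set.indicator_of_notMem (s := {z : ℂ | a - R ≤ z.im ∧ z.im ≤ b + R}) h _)
  have h2 : |c.re| < 2 * κ := by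
    by_contra h
    push Not at h
    refine hc ?_
    unfold sectorBump
    rw [Set.indicator_apply, trapezoid_eq_zero hκ h]
    simp
  have h3 := abs_le.1 hz.1
  have h4 := abs_le.1 hz.2
  have h5 := abs_lt.1 h2
  exact ⟨abs_le.2 ⟨by linarith, by linarith⟩, by linarith, by linarith⟩

theorem strip_subset_bigRect {κ R a b : ℝ} (hR : 0 < R) (hab : a ≤ b) :
    strip κ R a b ⊆ bigRect κ R a b := by
  intro z hz
  refine ⟨hz.2, ?_⟩
  rcases hz.1 with h | h
  · have := abs_le.1 h
    exact ⟨by linarith, by linarith⟩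
  · have := abs_le.1 h
    exact ⟨by linarith, by linarith⟩

theorem kinkStrip_subset_bigRect {κ R a b : ℝ} (hR : 0 < R) (hRκ : 2 * R ≤ κ) :
    kinkStrip κ R a b ⊆ bigRect κ R a b := by
  intro z hz
  refine ⟨?_, by linarith [hz.1.1], by linarith [hz.1.2]⟩
  rcases hz.2 with h | h | h | h <;>
  · have := abs_le.1 h
    exact abs_le.2 ⟨by linarith, by linarith⟩

/-- Bounding the trapezoid by `1` leaves a product of a function of `re c` and the indicator of an
interval in `im c`. This is the source of the main term of the zero count. -/
theorem integral_sectorBump_mul_posPartExcess_le {κ R a b : ℝ} (hR : 0 < R) (hab : a ≤ b) :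
    Integrable (fun c : ℂ => sectorBump κ R a b c * posPartExcess R c.re) ∧
    ∫ c : ℂ, sectorBump κ R a b c * posPartExcess R c.re ≤ (b - a + 2 * R) * (R ^ 2 / 4) := by
  set f : ℝ × ℝ → ℝ := fun p => posPartExcess R p.1 *
    (Set.Icc (a - R) (b + R)).indicator (fun _ => (1 : ℝ)) p.2 with hf
  have hI : Integrable ((Set.Icc (a - R) (b + R)).indicator (fun _ => (1 : ℝ))) :=
    (integrable_indicator_iff measurableSet_Icc).2 (by simp)
  have hfint : Integrable f := (integrable_posPartExcess hR).mul_prod hI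
  have hfint' : Integrable (fun c : ℂ => f (c.re, c.im)) :=
    Complex.volume_preserving_equiv_real_prod.integrable_comp_of_integrable hfint
  have hfval : ∫ c : ℂ, f (c.re, c.im) = (b - a + 2 * R) * (R ^ 2 / 4) := by
    have h1 := Complex.volume_preserving_equiv_real_prod.integral_comp
      Complex.measurableEquivRealProd.measurableEmbedding f
    simp only [Complex.measurableEquivRealProd_apply] at h1
    rw [h1]
    rw [Measure.volume_eq_prod, hf, integral_prod_mul, integral_posPartExcess hR,
      integral_indicator measurableSet_Icc]
    simp
    rw [max_eq_left (by linarith)]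
    ring
  have hle : ∀ c : ℂ, sectorBump κ R a b c * posPartExcess R c.re ≤ f (c.re, c.im) := by
    intro c
    rw [hf, mul_comm]
    refine mul_le_mul_of_nonneg_left ?_ (posPartExcess_nonneg _ _)
    by_cases hc : a - R ≤ c.im ∧ c.im ≤ b + R
    · rw [Set.indicator_of_mem (show c.im ∈ Set.Icc _ _ from hc)]
      exact sectorBump_le_one _ _ _ _ _
    · rw [Set.indicator_of_notMem (show c.im ∉ Set.Icc _ _ from hc)]
      exact (Set.indicator_of_notMem (s := {z : ℂ | a - R ≤ z.im ∧ z.im ≤ b + R}) hc _).le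
  have hint : Integrable (fun c : ℂ => sectorBump κ R a b c * posPartExcess R c.re) := by
    refine hfint'.mono' ?_ (Eventually.of_forall fun c => ?_)
    · exact ((measurable_sectorBump κ R a b).mul
        ((continuous_posPartExcess R).measurable.comp Complex.measurable_re)).aestronglyMeasurable
    · rw [Real.norm_of_nonneg (mul_nonneg (sectorBump_nonneg _ _ _ _ _) (posPartExcess_nonneg _ _))]
      exact hle c
  exact ⟨hint, (integral_mono hint hfint' hle).trans hfval.le⟩

/-- The kernel is supported within `R ≤ κ/2` of `v`, where the test function is identically `1`;
hence its full mass is counted. -/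
theorem integral_sectorBump_mul_posLog {κ R a b : ℝ} (hR : 0 < R) (hRκ : 2 * R ≤ κ) {v : ℂ}
    (hv : |v.re| ≤ κ / 2) (hva : a ≤ v.im) (hvb : v.im ≤ b) :
    Integrable (fun c : ℂ => sectorBump κ R a b c * Real.posLog (R / ‖c - v‖)) ∧
    ∫ c : ℂ, sectorBump κ R a b c * Real.posLog (R / ‖c - v‖) = Real.pi * R ^ 2 / 2 := by
  have h1 : ∀ c : ℂ, sectorBump κ R a b c * Real.posLog (R / ‖c - v‖) =
      Real.posLog (R / ‖c - v‖) := by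
    intro c
    by_cases hc : ‖c - v‖ ≤ R
    · have h2 := abs_le.1 ((Complex.abs_re_le_norm (c - v)).trans hc)
      have h3 := abs_le.1 ((Complex.abs_im_le_norm (c - v)).trans hc)
      have h4 := abs_le.1 hv
      simp only [Complex.sub_re, Complex.sub_im] at h2 h3
      have h5 : a - R ≤ c.im ∧ c.im ≤ b + R := ⟨by linarith, by linarith⟩
      have h6 : sectorBump κ R a b c = 1 := by
        unfold sectorBump
        rw [Set.indicator_of_mem (s := {z : ℂ | a - R ≤ z.im ∧ z.im ≤ b + R}) h5,
          trapezoid_eq_one (by linarith) (abs_le.2 ⟨by linarith, by linarith⟩)]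
      rw [h6, one_mul]
    · push Not at hc
      have : Real.posLog (R / ‖c - v‖) = 0 := by
        rw [posLog_div_eq hR (hR.trans hc), if_neg (by linarith)]
      rw [this, mul_zero]
  simp_rw [h1]
  refine ⟨(integrable_posLog_div_norm hR).comp_sub_right v, ?_⟩
  rw [integral_sub_right_eq_self (fun c : ℂ => Real.posLog (R / ‖c‖)), integral_posLog_div_norm hR]

theorem integral_sectorBump_mul_sum {κ R a b : ℝ} (hR : 0 < R) (hRκ : 2 * R ≤ κ) (v : ℂ → ℂ)
    (T : Set ℂ) (hv : ∀ z ∈ T, |(v z).re| ≤ κ / 2 ∧ a ≤ (v z).im ∧ (v z).im ≤ b)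
    (s : Multiset ℂ) :
    Integrable (fun c : ℂ => sectorBump κ R a b c *
      (s.map (T.indicator fun z => Real.posLog (R / ‖c - v z‖))).sum) ∧
    ∫ c : ℂ, sectorBump κ R a b c *
      (s.map (T.indicator fun z => Real.posLog (R / ‖c - v z‖))).sum =
      (s.map (T.indicator fun _ => Real.pi * R ^ 2 / 2)).sum := by
  induction s using Multiset.induction with
  | empty => simp
  | cons z s ih =>
    simp only [Multiset.map_cons, Multiset.sum_cons, mul_add]
    by_cases hz : z ∈ T
    · obtain ⟨h1, h2, h3⟩ := hv z hz
      obtain ⟨h4, h5⟩ := integral_sectorBump_mul_posLog hR hRκ h1 h2 h3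
      simp only [Set.indicator_of_mem hz]
      exact ⟨h4.add ih.1, by rw [integral_add h4 ih.1, h5, ih.2]⟩
    · simp only [Set.indicator_of_notMem hz, mul_zero, zero_add]
      exact ih

theorem sum_map_indicator_const (T : Set ℂ) [DecidablePred (· ∈ T)] (x : ℝ) (s : Multiset ℂ) :
    (s.map (T.indicator fun _ => x)).sum = x * s.countP (· ∈ T) := by
  induction s using Multiset.induction with
  | empty => simp
  | cons z s ih =>
    by_cases hz : z ∈ T
    · simp [hz, ih]; ring
    · simp [hz, ih]

/-- The part of the sector `a ≤ arg z < b` close to the unit circle. -/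
def nearSector (κ a b : ℝ) : Set ℂ :=
  {z | z ≠ 0 ∧ |Real.log ‖z‖| ≤ κ / 2 ∧
    ∃ θ : ℝ, a ≤ θ ∧ θ < b ∧ z = (‖z‖ : ℂ) * Complex.exp (θ * Complex.I)}

/-- One logarithm per zero suffices: all others are dropped from Jensen's formula, where they could
only help. Off the sector the chosen value is the irrelevant `0`. -/
theorem exists_log_of_mem_nearSector (κ a b : ℝ) : ∃ v : ℂ → ℂ, ∀ z ∈ nearSector κ a b,
    Complex.exp (v z) = z ∧ |(v z).re| ≤ κ / 2 ∧ a ≤ (v z).im ∧ (v z).im ≤ b := by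
  have h : ∀ z, ∃ w, z ∈ nearSector κ a b →
      Complex.exp w = z ∧ |w.re| ≤ κ / 2 ∧ a ≤ w.im ∧ w.im ≤ b := by
    intro z
    by_cases hz : z ∈ nearSector κ a b
    · obtain ⟨h0, h1, θ, h2, h3, h4⟩ := hz
      refine ⟨Real.log ‖z‖ + θ * Complex.I, fun _ => ⟨?_, ?_, ?_, ?_⟩⟩
      · rw [Complex.exp_add, ← Complex.ofReal_exp, Real.exp_log (norm_pos_iff.2 h0)]
        exact h4.symm
      · simpa using h1
      · simpa using h2
      · simpa using h3.le
    · exact ⟨0, fun h => absurd h hz⟩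
  choose v hv using h
  exact ⟨v, hv⟩

open Classical in
/-- An upper bound for the number of zeros in a sector, close to the unit circle. -/
theorem countP_roots_nearSector_le {P : ℂ[X]} (hP : P ≠ 0) (n : ℕ) {κ R a b : ℝ} (hR : 0 < R)
    (hRκ : 2 * R ≤ κ) (hab : a ≤ b) (hU : IntegrableOn (logSize P n) (bigRect κ R a b)) :
    (P.roots.countP (· ∈ nearSector κ a b) : ℝ) ≤
      n * (b - a + 2 * R) / (2 * Real.pi) + 2 / (Real.pi * R ^ 2) *
        ((∫ w in strip κ R a b, |logSize P n w|) +
          R / κ * ∫ w in kinkStrip κ R a b, |logSize P n w|) := by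
  have hκ : 0 < κ := by linarith
  obtain ⟨v, hv⟩ := exists_log_of_mem_nearSector κ a b
  set g := sectorBump κ R a b with hg
  -- The cut-off makes the function integrable over the plane. It changes nothing below, because
  -- circles centred where `g ≠ 0` stay in `bigRect`.
  set V : ℂ → ℝ := (bigRect κ R a b).indicator (logSize P n) with hVdef
  have hV : Integrable V := (integrable_indicator_iff (measurableSet_bigRect _ _ _ _)).2 hU
  have hgm := measurable_sectorBump κ R a b
  have hg1 : ∀ z, |g z| ≤ 1 := fun z => by
    rw [abs_of_nonneg (sectorBump_nonneg _ _ _ _ _)]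
    exact sectorBump_le_one _ _ _ _ _
  have hgV : Integrable (fun c => g c * V c) :=
    hV.bdd_mul (c := 1) hgm.aestronglyMeasurable (Eventually.of_forall hg1)
  obtain ⟨hi1, hi2, hswap⟩ := integral_mul_circleAverage hgm hg1 hV R
  obtain ⟨hi3, hex⟩ := integral_sectorBump_mul_posPartExcess_le (κ := κ) hR hab
  obtain ⟨hi4, hsum⟩ := integral_sectorBump_mul_sum hR hRκ v (nearSector κ a b)
    (fun z hz => (hv z hz).2) P.roots
  -- Jensen's inequality times `g`: subtracting `n * max (re w) 0` from `log |P(e^w)|` leaves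
  -- exactly its averaging excess.
  have hpt : ∀ᵐ c : ℂ, g c * (P.roots.map ((nearSector κ a b).indicator
      fun z => Real.posLog (R / ‖c - v z‖))).sum ≤
      (g c * Real.circleAverage V c R - g c * V c) + n * (g c * posPartExcess R c.re) := by
    filter_upwards [(countable_setOf_eval_exp_eq_zero hP).ae_notMem volume] with c hc
    by_cases hgc : g c = 0
    · simp [hgc]
    have hVc : V c = Real.log ‖P.eval (Complex.exp c)‖ - n * max c.re 0 := by
      rw [hVdef, Set.indicator_of_mem (mem_bigRect_of_sectorBump_ne_zero hR hRκ hgc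
        (by simp [hR.le])), logSize_eq hc]
    have hAV : Real.circleAverage V c R =
        Real.circleAverage (fun z => Real.log ‖P.eval (Complex.exp z)‖) c R -
          n * (posPartExcess R c.re + max c.re 0) := by
      have hd : Differentiable ℂ fun z => P.eval (Complex.exp z) := by
        exact P.differentiable.comp Complex.differentiable_exp
      have hcm : Continuous fun z : ℂ => (n : ℝ) * max z.re 0 := by fun_prop
      rw [Real.circleAverage_congr_sphere (f₂ := logSize P n),
        circleAverage_congr_of_countable (countable_setOf_eval_exp_eq_zero hP)
          (g := fun z => Real.log ‖P.eval (Complex.exp z)‖ - n * max z.re 0)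
          (fun z hz => logSize_eq hz) hR.ne',
        Real.circleAverage_fun_sub (hd.circleIntegrable_log_norm c R)
          hcm.continuousOn.circleIntegrable', ← circleAverage_max_re]
      · congr 1
        exact Real.circleAverage_fun_smul (a := (n : ℝ)) (f := fun z : ℂ => max z.re 0)
      · intro z hz
        exact Set.indicator_of_mem (mem_bigRect_of_sectorBump_ne_zero hR hRκ hgc
          (abs_re_sub_le_of_mem_sphere hR hz)) _
    have hJ := polynomial_exp_circleAverage P hP v (nearSector κ a b)
      (fun z hz => (hv z hz).1) hR hc
    have := mul_le_mul_of_nonneg_left hJ (sectorBump_nonneg κ R a b c)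
    rw [hVc, hAV]
    rw [← hg] at this
    linarith
  have hI := integral_mono_ae hi4 ((hi1.sub hgV).add (hi3.const_mul (n : ℝ))) hpt
  have hI2 : ∫ c, ((g c * Real.circleAverage V c R - g c * V c) +
      n * (g c * posPartExcess R c.re)) =
      (∫ c, (Real.circleAverage g c R - g c) * V c) +
        n * ∫ c : ℂ, g c * posPartExcess R c.re := by
    have h12 : Integrable (fun c => g c * Real.circleAverage V c R - g c * V c) := hi1.sub hgV
    rw [integral_add h12 (hi3.const_mul (n : ℝ)), integral_sub hi1 hgV, hswap,
      ← integral_sub hi2 hgV, integral_const_mul]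
    simp_rw [sub_mul]
    rfl
  simp only [Pi.add_apply, Pi.sub_apply] at hI
  rw [hsum] at hI
  have hI := hI.trans_eq hI2
  rw [sum_map_indicator_const] at hI
  have hsub1 : strip κ R a b ⊆ bigRect κ R a b := strip_subset_bigRect hR hab
  have hsub2 : kinkStrip κ R a b ⊆ bigRect κ R a b := kinkStrip_subset_bigRect hR hRκ
  -- With the average moved onto `g`, only the points where averaging changes the test function
  -- contribute.
  have hb : ∫ c, (Real.circleAverage g c R - g c) * V c ≤
      (∫ w in strip κ R a b, |logSize P n w|) +
        R / κ * ∫ w in kinkStrip κ R a b, |logSize P n w| := by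
    have hs1 := (integrable_indicator_iff (measurableSet_strip κ R a b)).2 (hU.mono_set hsub1).abs
    have hs2 := (integrable_indicator_iff (measurableSet_kinkStrip κ R a b)).2
      (hU.mono_set hsub2).abs
    rw [← integral_indicator (measurableSet_strip κ R a b),
      ← integral_indicator (measurableSet_kinkStrip κ R a b), ← integral_const_mul,
      ← integral_add hs1 (hs2.const_mul _)]
    refine integral_mono ((hi2.sub hgV).congr (Eventually.of_forall fun c => by
      simp only [Pi.sub_apply]; ring)) (hs1.add (hs2.const_mul _)) fun c => ?_
    have h1 := abs_circleAverage_sectorBump_sub_le (a := a) (b := b) hR hRκ c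
    have h2 : |V c| ≤ |logSize P n c| := by
      rw [hVdef, Set.indicator_apply]
      split_ifs <;> simp
    calc (Real.circleAverage g c R - g c) * V c
        ≤ |Real.circleAverage g c R - g c| * |V c| := by
          rw [← abs_mul]; exact le_abs_self _
      _ ≤ ((strip κ R a b).indicator 1 c + R / κ * (kinkStrip κ R a b).indicator 1 c) *
          |logSize P n c| := mul_le_mul h1 h2 (abs_nonneg _) ((abs_nonneg _).trans h1)
      _ = _ := by
          simp only [Set.indicator_apply, Pi.one_apply]
          split_ifs <;> ring
  have hpi := Real.pi_pos
  have hn : (n : ℝ) * ∫ c : ℂ, g c * posPartExcess R c.re ≤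
      n * ((b - a + 2 * R) * (R ^ 2 / 4)) := by gcongr
  have hfin : Real.pi * R ^ 2 / 2 * (P.roots.countP (· ∈ nearSector κ a b) : ℝ) ≤
      ((∫ w in strip κ R a b, |logSize P n w|) +
        R / κ * ∫ w in kinkStrip κ R a b, |logSize P n w|) +
      n * ((b - a + 2 * R) * (R ^ 2 / 4)) := by linarith
  set X := (∫ w in strip κ R a b, |logSize P n w|) +
        R / κ * ∫ w in kinkStrip κ R a b, |logSize P n w|
  have hpos : 0 < 2 / (Real.pi * R ^ 2) := by positivity
  have := mul_le_mul_of_nonneg_left hfin hpos.le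
  have e1 : 2 / (Real.pi * R ^ 2) * (Real.pi * R ^ 2 / 2 *
      (P.roots.countP (· ∈ nearSector κ a b) : ℝ)) =
      (P.roots.countP (· ∈ nearSector κ a b) : ℝ) := by
    field_simp
  have e2 : 2 / (Real.pi * R ^ 2) * (X + n * ((b - a + 2 * R) * (R ^ 2 / 4))) =
      n * (b - a + 2 * R) / (2 * Real.pi) + 2 / (Real.pi * R ^ 2) * X := by
    field_simp
    ring
  rw [e1, e2] at this
  exact this

/-! ### Bounds for the mass of `logSize` on horizontal periods. -/

/-- The polynomial `∑_{k ≤ n} a_k z^k`. -/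
noncomputable def coeffPolynomial (a : ℕ → ℂ) (n : ℕ) : ℂ[X] :=
  ∑ k ∈ Finset.range (n + 1), Polynomial.C (a k) * Polynomial.X ^ k

/-- The series `∑_{k ≤ n} |a_k| ρ^k`. -/
noncomputable def absSeries (a : ℕ → ℂ) (n : ℕ) (ρ : ℝ) : ℝ :=
  ∑ k ∈ Finset.range (n + 1), ‖a k‖ * ρ ^ k

theorem absSeries_nonneg (a : ℕ → ℂ) (n : ℕ) {ρ : ℝ} (hρ : 0 ≤ ρ) : 0 ≤ absSeries a n ρ :=
  Finset.sum_nonneg fun _ _ => by positivity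

theorem absSeries_mono (a : ℕ → ℂ) (n : ℕ) {ρ σ : ℝ} (hρ : 0 ≤ ρ) (h : ρ ≤ σ) :
    absSeries a n ρ ≤ absSeries a n σ :=
  Finset.sum_le_sum fun _ _ => by gcongr

theorem eval_coeffPolynomial (a : ℕ → ℂ) (n : ℕ) (z : ℂ) :
    (coeffPolynomial a n).eval z = ∑ k ∈ Finset.range (n + 1), a k * z ^ k := by
  simp [coeffPolynomial, Polynomial.eval_finsetSum]

theorem coeff_coeffPolynomial (a : ℕ → ℂ) (n k : ℕ) :
    (coeffPolynomial a n).coeff k = if k ≤ n then a k else 0 := by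
  simp only [coeffPolynomial, Polynomial.finsetSum_coeff, Polynomial.coeff_C_mul,
    Polynomial.coeff_X_pow, mul_ite, mul_one, mul_zero]
  simp

theorem norm_eval_coeffPolynomial_le (a : ℕ → ℂ) (n : ℕ) (z : ℂ) :
    ‖(coeffPolynomial a n).eval z‖ ≤ absSeries a n ‖z‖ := by
  rw [eval_coeffPolynomial]
  exact (norm_sum_le _ _).trans (Finset.sum_le_sum fun k _ => by simp)

theorem eval_zero_coeffPolynomial (a : ℕ → ℂ) (n : ℕ) : (coeffPolynomial a n).eval 0 = a 0 := by
  rw [← Polynomial.coeff_zero_eq_eval_zero, coeff_coeffPolynomial]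
  simp

theorem coeffPolynomial_ne_zero {a : ℕ → ℂ} {n : ℕ} (h : a 0 ≠ 0) : coeffPolynomial a n ≠ 0 := by
  intro h0
  have := eval_zero_coeffPolynomial a n
  rw [h0] at this
  exact h (by simpa using this.symm)

/-- Reversing the coefficients corresponds to the reflection `w ↦ -w`. -/
theorem logSize_reverse (a : ℕ → ℂ) (n : ℕ) (w : ℂ) :
    logSize (coeffPolynomial a n) n w =
      logSize (coeffPolynomial (fun k => a (n - k)) n) n (-w) := by
  unfold logSize
  congr 1
  have h : (coeffPolynomial a n).eval (Complex.exp w) =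
      Complex.exp (n * w) * (coeffPolynomial (fun k => a (n - k)) n).eval (Complex.exp (-w)) := by
    rw [eval_coeffPolynomial, eval_coeffPolynomial, Finset.mul_sum, ← Finset.sum_range_reflect]
    refine Finset.sum_congr rfl fun k hk => ?_
    have hk' : k ≤ n := Nat.lt_succ_iff.1 (Finset.mem_range.1 hk)
    have e : n + 1 - 1 - k = n - k := by omega
    rw [e, ← Complex.exp_nat_mul, ← Complex.exp_nat_mul, mul_left_comm, ← Complex.exp_add,
      Nat.cast_sub hk']
    congr 2
    ring
  rw [h, norm_mul, Complex.norm_exp, mul_comm (Real.exp _), mul_assoc, ← Real.exp_add]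
  congr 2
  simp only [Complex.mul_re, Complex.natCast_re, Complex.natCast_im, Complex.neg_re]
  rcases le_total w.re 0 with h | h
  · rw [max_eq_right h, max_eq_left (by linarith)]
    ring
  · rw [max_eq_left h, max_eq_right (by linarith)]
    ring

/-- It turns a lower bound for an integral of `log` and an upper bound for its positive part into a
bound for the absolute value. At `y = 0` it relies on `Real.log 0 = 0`. -/
theorem abs_log_le (y : ℝ) (hy : 0 ≤ y) : |Real.log y| ≤ 2 * Real.log (1 + y) - Real.log y := by
  have h0 : 0 ≤ Real.log (1 + y) := Real.log_nonneg (by linarith)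
  rcases hy.eq_or_lt with rfl | hy
  · simp
  · have h1 : Real.log y ≤ Real.log (1 + y) := Real.log_le_log hy (by linarith)
    exact abs_le.2 ⟨by linarith, by linarith⟩

/-- On circles around the origin the mass of `log ‖f‖` is controlled by its positive part and
by `f 0`. -/
theorem lintegral_log_norm_circle_le {f : ℂ → ℂ} (hf : Differentiable ℂ f) (h0 : f 0 ≠ 0)
    {R : ℝ} (hR : 0 < R) (a : ℝ) :
    ∫⁻ t in Set.Ioc a (a + 2 * Real.pi), ‖Real.log ‖f (circleMap 0 R t)‖‖ₑ ≤
      2 * (∫⁻ t in Set.Ioc a (a + 2 * Real.pi),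
        ENNReal.ofReal (Real.log (1 + ‖f (circleMap 0 R t)‖))) +
      ENNReal.ofReal (2 * Real.pi) * ENNReal.ofReal (-Real.log ‖f 0‖) := by
  have hpi := Real.two_pi_pos
  have hcirc := hf.circleIntegrable_log_norm 0 R
  have hper : Function.Periodic (fun t => Real.log ‖f (circleMap 0 R t)‖) (2 * Real.pi) :=
    fun t => by simp only [periodic_circleMap 0 R t]
  have hint : IntervalIntegrable (fun t => Real.log ‖f (circleMap 0 R t)‖) volume a
      (a + 2 * Real.pi) := by
    refine hper.intervalIntegrable (t := 0) hpi.ne' ?_ _ _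
    rw [zero_add]
    exact hcirc
  have hint' : IntegrableOn (fun t => Real.log ‖f (circleMap 0 R t)‖)
      (Set.Ioc a (a + 2 * Real.pi)) := (intervalIntegrable_iff_integrableOn_Ioc_of_le
        (by linarith)).1 hint
  have hcont : Continuous fun t => Real.log (1 + ‖f (circleMap 0 R t)‖) := by
    have := hf.continuous
    have h2 : Continuous fun t => 1 + ‖f (circleMap 0 R t)‖ := by fun_prop
    exact h2.log fun t => by positivity
  have hint2 : IntegrableOn (fun t => Real.log (1 + ‖f (circleMap 0 R t)‖))
      (Set.Ioc a (a + 2 * Real.pi)) :=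
    hcont.integrableOn_Icc.mono_set Set.Ioc_subset_Icc_self
  have hmean : 2 * Real.pi * Real.log ‖f 0‖ ≤
      ∫ t in Set.Ioc a (a + 2 * Real.pi), Real.log ‖f (circleMap 0 R t)‖ := by
    have h1 := hf.log_norm_le_circleAverage hR h0
    rw [← intervalIntegral.integral_of_le (by linarith), hper.intervalIntegral_add_eq a 0, zero_add]
    rw [Real.circleAverage, smul_eq_mul, ← div_eq_inv_mul, le_div_iff₀ hpi] at h1
    linarith
  have hle : ∫ t in Set.Ioc a (a + 2 * Real.pi), ‖Real.log ‖f (circleMap 0 R t)‖‖ ≤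
      2 * (∫ t in Set.Ioc a (a + 2 * Real.pi), Real.log (1 + ‖f (circleMap 0 R t)‖)) +
        2 * Real.pi * (-Real.log ‖f 0‖) := by
    calc _ ≤ ∫ t in Set.Ioc a (a + 2 * Real.pi), (2 * Real.log (1 + ‖f (circleMap 0 R t)‖) -
            Real.log ‖f (circleMap 0 R t)‖) :=
          integral_mono hint'.norm ((hint2.const_mul 2).sub hint')
            fun t => abs_log_le _ (norm_nonneg _)
      _ ≤ _ := by
          rw [integral_sub (hint2.const_mul 2) hint', integral_const_mul]
          linarith
  rw [← ofReal_integral_norm_eq_lintegral_enorm hint',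
    ← ofReal_integral_eq_lintegral_ofReal hint2
      (Eventually.of_forall fun t => Real.log_nonneg (by linarith [norm_nonneg (f (circleMap 0 R t))]))]
  refine (ENNReal.ofReal_le_ofReal hle).trans (ENNReal.ofReal_add_le.trans ?_)
  rw [ENNReal.ofReal_mul zero_le_two, ENNReal.ofReal_mul hpi.le]
  simp

/-- The bound for one horizontal period of `logSize`. -/
noncomputable def periodBound (a : ℕ → ℂ) (n : ℕ) : ℝ≥0∞ :=
  2 * (ENNReal.ofReal (2 * Real.pi) * ENNReal.ofReal (Real.log (1 + absSeries a n 1))) +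
    ENNReal.ofReal (2 * Real.pi) *
      (ENNReal.ofReal (-Real.log ‖a 0‖) + ENNReal.ofReal (-Real.log ‖a n‖))

theorem logSize_of_nonpos (P : ℂ[X]) (n : ℕ) {w : ℂ} (hw : w.re ≤ 0) :
    logSize P n w = Real.log ‖P.eval (Complex.exp w)‖ := by
  simp [logSize, max_eq_right hw]

theorem exp_mk_eq_circleMap (x t : ℝ) : Complex.exp ⟨x, t⟩ = circleMap 0 (Real.exp x) t := by
  rw [Complex.mk_eq_add_mul_I, Complex.exp_add, circleMap]
  simp

theorem absSeries_reverse_one (a : ℕ → ℂ) (n : ℕ) :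
    absSeries (fun k => a (n - k)) n 1 = absSeries a n 1 := by
  simp only [absSeries, one_pow, mul_one]
  rw [← Finset.sum_range_reflect]
  refine Finset.sum_congr rfl fun k hk => ?_
  have := Finset.mem_range.1 hk
  congr 2
  omega

/-- The segment is mapped by `exp` onto a circle of radius `e^x ≤ 1`, where `|P|` is at most
`absSeries a n 1` and Jensen's inequality starts from `P 0 = a 0`. -/
theorem lintegral_logSize_of_nonpos {a : ℕ → ℂ} {n : ℕ} (h0 : a 0 ≠ 0) {x : ℝ} (hx : x ≤ 0)
    (c : ℝ) :
    ∫⁻ t in Set.Ioc c (c + 2 * Real.pi), ‖logSize (coeffPolynomial a n) n ⟨x, t⟩‖ₑ ≤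
      2 * (ENNReal.ofReal (2 * Real.pi) * ENNReal.ofReal (Real.log (1 + absSeries a n 1))) +
    ENNReal.ofReal (2 * Real.pi) * ENNReal.ofReal (-Real.log ‖a 0‖) := by
  have h := lintegral_log_norm_circle_le (coeffPolynomial a n).differentiable
    (by rwa [eval_zero_coeffPolynomial]) (Real.exp_pos x) c
  rw [eval_zero_coeffPolynomial] at h
  have e : ∀ t : ℝ, logSize (coeffPolynomial a n) n ⟨x, t⟩ =
      Real.log ‖(coeffPolynomial a n).eval (circleMap 0 (Real.exp x) t)‖ := fun t => by
    rw [logSize_of_nonpos _ _ (by exact hx), exp_mk_eq_circleMap]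
  simp_rw [e]
  refine h.trans ?_
  gcongr
  calc _ ≤ ∫⁻ t in Set.Ioc c (c + 2 * Real.pi),
        ENNReal.ofReal (Real.log (1 + absSeries a n 1)) := by
        refine lintegral_mono fun t => ENNReal.ofReal_le_ofReal ?_
        refine Real.log_le_log (by positivity) ?_
        gcongr
        refine (norm_eval_coeffPolynomial_le _ _ _).trans
          (absSeries_mono _ _ (norm_nonneg _) ?_)
        rw [norm_circleMap_zero, abs_of_pos (Real.exp_pos _)]
        exact Real.exp_le_one_iff.2 hx
    _ = _ := by
        rw [setLIntegral_const, Real.volume_Ioc, mul_comm]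
        simp

theorem lintegral_comp_neg_Ioc (f : ℝ → ℝ≥0∞) (c d : ℝ) :
    ∫⁻ t in Set.Ioc c d, f (-t) = ∫⁻ t in Set.Ioc (-d) (-c), f t := by
  have h1 := (Measure.measurePreserving_neg (volume : Measure ℝ)).setLIntegral_comp_preimage_emb
    (MeasurableEquiv.neg ℝ).measurableEmbedding f (Set.Ico (-d) (-c))
  have h2 : (Neg.neg ⁻¹' Set.Ico (-d) (-c) : Set ℝ) = Set.Ioc c d := by
    ext t; simp [and_comm]
  rw [h2] at h1
  rw [h1]
  exact setLIntegral_congr Ico_ae_eq_Ioc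

theorem lintegral_logSize_period_le {a : ℕ → ℂ} {n : ℕ} (h0 : a 0 ≠ 0) (hn : a n ≠ 0) (x c : ℝ) :
    ∫⁻ t in Set.Ioc c (c + 2 * Real.pi), ‖logSize (coeffPolynomial a n) n ⟨x, t⟩‖ₑ ≤
      periodBound a n := by
  unfold periodBound
  rcases le_total x 0 with hx | hx
  · refine (lintegral_logSize_of_nonpos h0 hx c).trans ?_
    gcongr
    exact le_self_add
  -- Outside the unit circle the reversed polynomial is evaluated at the reflected point, so that `a
  -- n` plays the role of `a 0`.
  · have e : ∀ t : ℝ, logSize (coeffPolynomial a n) n ⟨x, t⟩ =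
        logSize (coeffPolynomial (fun k => a (n - k)) n) n ⟨-x, -t⟩ := fun t => by
      rw [logSize_reverse]; rfl
    simp_rw [e]
    rw [lintegral_comp_neg_Ioc
      (fun t => ‖logSize (coeffPolynomial (fun k => a (n - k)) n) n ⟨-x, t⟩‖ₑ)]
    have := lintegral_logSize_of_nonpos (a := fun k => a (n - k)) (n := n) (by simpa using hn)
      (neg_nonpos.2 hx) (-(c + 2 * Real.pi))
    rw [show -(c + 2 * Real.pi) + 2 * Real.pi = -c by ring, absSeries_reverse_one,
      Nat.sub_zero] at this
    refine this.trans ?_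
    gcongr
    exact le_add_self

theorem setLIntegral_complex_rect {S T : Set ℝ} {f : ℂ → ℝ≥0∞} (hf : Measurable f) :
    ∫⁻ z in {z : ℂ | z.re ∈ S ∧ z.im ∈ T}, f z = ∫⁻ x in S, ∫⁻ y in T, f ⟨x, y⟩ := by
  have h1 := Complex.volume_preserving_equiv_real_prod.setLIntegral_comp_preimage_emb
    Complex.measurableEquivRealProd.measurableEmbedding
    (fun p => f (Complex.measurableEquivRealProd.symm p)) (S ×ˢ T)
  have h2 : (Complex.measurableEquivRealProd ⁻¹' (S ×ˢ T) : Set ℂ) =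
      {z : ℂ | z.re ∈ S ∧ z.im ∈ T} := by
    ext z; simp
  simp only [MeasurableEquiv.symm_apply_apply, h2] at h1
  rw [h1, Measure.volume_eq_prod, ← Measure.prod_restrict]
  exact lintegral_prod (fun p => f (Complex.measurableEquivRealProd.symm p))
    (hf.comp Complex.measurableEquivRealProd.symm.measurable).aemeasurable

/-! ### Curves tangent to the unit circle, and boxes swept out by them. -/

/-- The modulus is `|cos (t/2)|`, so the curve touches the unit circle only at `t = 0`. Near that
point the argument is `3t/2`, and translates of the curve foliate a box. The map `(z + z²)/2` also
fixes `0`, which keeps `a 0` as the Jensen constant. -/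
theorem half_exp_add_exp_sq (t : ℝ) : (circleMap 0 1 t + circleMap 0 1 t ^ 2) / 2 =
    Real.cos (t / 2) * Complex.exp ((3 * t / 2 : ℝ) * Complex.I) := by
  have h1 : circleMap 0 1 t =
      Complex.exp (((3 * t / 2 : ℝ) : ℂ) * Complex.I) * Complex.exp (-((t / 2 : ℝ) * Complex.I)) := by
    rw [← Complex.exp_add, circleMap]
    simp
    congr 1
    ring
  have h2 : circleMap 0 1 t ^ 2 =
      Complex.exp (((3 * t / 2 : ℝ) : ℂ) * Complex.I) * Complex.exp ((t / 2 : ℝ) * Complex.I) := by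
    rw [← Complex.exp_add, circleMap, zero_add, Complex.ofReal_one, one_mul, ← Complex.exp_nat_mul]
    congr 1
    push_cast
    ring
  rw [h2, h1, Complex.ofReal_cos, Complex.cos]
  ring_nf

/-- The bound for `logSize` along curves touching the unit circle at one point. -/
noncomputable def tangentBound (a : ℕ → ℂ) (n : ℕ) (y : ℝ) : ℝ≥0∞ :=
  2 * (∫⁻ t in Set.Ioc (-Real.pi) Real.pi,
    ENNReal.ofReal (Real.log (1 + absSeries a n (Real.exp y * |Real.cos (t / 2)|)))) +
  ENNReal.ofReal (2 * Real.pi) * ENNReal.ofReal (-Real.log ‖a 0‖)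

/-- Jensen's inequality along the curve `e^(y + ic) (z + z ^ 2) / 2`, `|z| = 1`. -/
theorem lintegral_tangent_le {a : ℕ → ℂ} {n : ℕ} (h0 : a 0 ≠ 0) {y Y : ℝ} (hy : y ≤ Y) (c : ℝ) :
    ∫⁻ t in Set.Ioc (-Real.pi) Real.pi, ‖Real.log ‖(coeffPolynomial a n).eval
      (Real.cos (t / 2) * Complex.exp ⟨y, c + 3 * t / 2⟩)‖‖ₑ ≤ tangentBound a n Y := by
  set P := coeffPolynomial a n
  set f : ℂ → ℂ := fun z => P.eval (Complex.exp ⟨y, c⟩ * ((z + z ^ 2) / 2)) with hf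
  have hfd : Differentiable ℂ f := P.differentiable.comp (by fun_prop)
  have hf0 : f 0 = a 0 := by simp [hf, P, eval_zero_coeffPolynomial]
  have h := lintegral_log_norm_circle_le hfd (by rwa [hf0]) one_pos (-Real.pi)
  have e : ∀ t, f (circleMap 0 1 t) =
      P.eval (Real.cos (t / 2) * Complex.exp ⟨y, c + 3 * t / 2⟩) := fun t => by
    rw [hf]
    simp only
    rw [half_exp_add_exp_sq, mul_left_comm, ← Complex.exp_add]
    congr 3
    apply Complex.ext <;> simp
  simp_rw [e] at h
  rw [hf0, show -Real.pi + 2 * Real.pi = Real.pi by ring] at h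
  refine h.trans ?_
  unfold tangentBound
  gcongr with t
  refine (norm_eval_coeffPolynomial_le _ _ _).trans (absSeries_mono _ _ (norm_nonneg _) ?_)
  rw [norm_mul, Complex.norm_real, Complex.norm_exp, mul_comm, Real.norm_eq_abs]
  gcongr

/-- The radial deviation of the curve from the unit circle is at most `R²` while its argument stays
within `R`: the contact is of second order. -/
theorem log_cos_half_bounds {R t : ℝ} (hR0 : 0 < R) (hR1 : R ≤ 1) (ht : |t| ≤ 2 * R / 3) :
    0 < Real.cos (t / 2) ∧ -R ^ 2 ≤ Real.log (Real.cos (t / 2)) ∧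
      Real.log (Real.cos (t / 2)) ≤ 0 := by
  have h1 := Real.one_sub_sq_div_two_le_cos (x := t / 2)
  have ht2 : t ^ 2 ≤ (2 * R / 3) ^ 2 := sq_le_sq' (by linarith [abs_le.1 ht]) (abs_le.1 ht).2
  have hR2 : R ^ 2 ≤ 1 := by nlinarith
  have hc : 1 - R ^ 2 / 18 ≤ Real.cos (t / 2) := by nlinarith
  have hpos : 0 < Real.cos (t / 2) := by linarith
  refine ⟨hpos, ?_, Real.log_nonpos hpos.le (Real.cos_le_one _)⟩
  refine le_trans ?_ (Real.one_sub_inv_le_log_of_pos hpos)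
  have : (Real.cos (t / 2))⁻¹ ≤ 1 + R ^ 2 := by
    rw [inv_le_comm₀ hpos (by positivity), inv_le_iff_one_le_mul₀ (by positivity)]
    nlinarith
  linarith

theorem lintegral_Icc_affine (F : ℝ → ℝ≥0∞) (c : ℝ) {R : ℝ} :
    ∫⁻ θ in Set.Icc (c - R) (c + R), F θ =
      ENNReal.ofReal (3 / 2) * ∫⁻ t in Set.Icc (-(2 * R / 3)) (2 * R / 3), F (c + 3 * t / 2) := by
  have h := lintegral_image_eq_lintegral_abs_deriv_mul (s := Set.Icc (-(2 * R / 3)) (2 * R / 3))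
    (f := fun t => c + 3 * t / 2) (f' := fun _ => 3 / 2) measurableSet_Icc
    (fun t _ => by
      have := ((((hasDerivAt_id t).const_mul 3).div_const 2).const_add c).hasDerivWithinAt
        (s := Set.Icc (-(2 * R / 3)) (2 * R / 3))
      simpa using this)
    (fun x _ y _ hxy => by
      simp only at hxy
      linarith) F
  have himg : (fun t => c + 3 * t / 2) '' Set.Icc (-(2 * R / 3)) (2 * R / 3) =
      Set.Icc (c - R) (c + R) := by
    ext x
    simp only [Set.mem_image, Set.mem_Icc]
    constructor
    · rintro ⟨t, ⟨h1, h2⟩, rfl⟩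
      exact ⟨by linarith, by linarith⟩
    · rintro ⟨h1, h2⟩
      exact ⟨2 * (x - c) / 3, ⟨by linarith, by linarith⟩, by ring⟩
  rw [himg] at h
  rw [h, lintegral_const_mul' _ _ (by simp)]
  norm_num

/-- The mass of `logSize` in a box inside the unit circle that touches it. -/
theorem lintegral_inner_box_le {a : ℕ → ℂ} {n : ℕ} (h0 : a 0 ≠ 0) {R K : ℝ} (hR0 : 0 < R)
    (hR1 : R ≤ 1) (c : ℝ) :
    ∫⁻ x in Set.Icc (-K) 0, ∫⁻ θ in Set.Icc (c - R) (c + R),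
      ‖logSize (coeffPolynomial a n) n ⟨x, θ⟩‖ₑ ≤
    ENNReal.ofReal (3 / 2) * (ENNReal.ofReal (K + R ^ 2) * tangentBound a n (R ^ 2)) := by
  set P := coeffPolynomial a n
  set F : ℝ → ℝ → ℝ≥0∞ := fun x θ => ‖Real.log ‖P.eval (Complex.exp ⟨x, θ⟩)‖‖ₑ with hF
  have hmk : Continuous fun p : ℝ × ℝ => (⟨p.1, p.2⟩ : ℂ) :=
    Complex.equivRealProdCLM.symm.continuous
  have hFm : Measurable (Function.uncurry F) := by
    have : Continuous fun p : ℝ × ℝ => ‖P.eval (Complex.exp ⟨p.1, p.2⟩)‖ := by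
      have := P.continuous
      fun_prop
    exact (Real.measurable_log.comp this.measurable).enorm
  set T := Set.Icc (-(2 * R / 3)) (2 * R / 3) with hT
  -- Translating `x` by `log (cos (t/2))` replaces points on vertical segments by points on the
  -- tangent curves; the parameter `y` then ranges up to `R²` instead of `0`.
  have hshift : ∀ t ∈ T, ∫⁻ x in Set.Icc (-K) 0, F x (c + 3 * t / 2) ≤
      ∫⁻ y in Set.Icc (-K) (R ^ 2), ‖Real.log ‖P.eval
      (Real.cos (t / 2) * Complex.exp ⟨y, c + 3 * t / 2⟩)‖‖ₑ := by
    intro t ht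
    obtain ⟨hc, hl1, hl2⟩ := log_cos_half_bounds hR0 hR1 (abs_le.2 ht)
    rw [← lintegral_indicator measurableSet_Icc, ← lintegral_indicator measurableSet_Icc,
      ← lintegral_add_right_eq_self _ (Real.log (Real.cos (t / 2)))]
    refine lintegral_mono fun y => ?_
    simp only
    by_cases hy : y + Real.log (Real.cos (t / 2)) ∈ Set.Icc (-K) 0
    · rw [Set.indicator_of_mem hy, Set.indicator_of_mem
        (show y ∈ Set.Icc (-K) (R ^ 2) from ⟨by linarith [hy.1], by linarith [hy.2]⟩)]
      refine le_of_eq ?_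
      rw [hF]
      simp only
      congr 4
      rw [show (⟨y + Real.log (Real.cos (t / 2)), c + 3 * t / 2⟩ : ℂ) =
        ((Real.log (Real.cos (t / 2)) : ℝ) : ℂ) + ⟨y, c + 3 * t / 2⟩ by
          apply Complex.ext <;> simp [add_comm], Complex.exp_add, ← Complex.ofReal_exp,
        Real.exp_log hc]
    · rw [Set.indicator_of_notMem hy]
      exact zero_le
  calc ∫⁻ x in Set.Icc (-K) 0, ∫⁻ θ in Set.Icc (c - R) (c + R), ‖logSize P n ⟨x, θ⟩‖ₑ
      = ∫⁻ x in Set.Icc (-K) 0, ENNReal.ofReal (3 / 2) * ∫⁻ t in T, F x (c + 3 * t / 2) := by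
        refine setLIntegral_congr_fun measurableSet_Icc fun x hx => ?_
        rw [← lintegral_Icc_affine (fun θ => F x θ)]
        refine lintegral_congr fun θ => ?_
        rw [logSize_of_nonpos _ _ (by exact hx.2)]
    _ = ENNReal.ofReal (3 / 2) * ∫⁻ t in T, ∫⁻ x in Set.Icc (-K) 0, F x (c + 3 * t / 2) := by
        rw [lintegral_const_mul' _ _ (by simp), lintegral_lintegral_swap]
        exact (hFm.comp (f := fun p : ℝ × ℝ => (p.1, c + 3 * p.2 / 2)) (by fun_prop)).aemeasurable
    _ ≤ ENNReal.ofReal (3 / 2) * ∫⁻ t in T, ∫⁻ y in Set.Icc (-K) (R ^ 2), ‖Real.log ‖P.eval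
          (Real.cos (t / 2) * Complex.exp ⟨y, c + 3 * t / 2⟩)‖‖ₑ := by
        exact mul_le_mul' le_rfl (setLIntegral_mono' measurableSet_Icc hshift)
    _ = ENNReal.ofReal (3 / 2) * ∫⁻ y in Set.Icc (-K) (R ^ 2), ∫⁻ t in T, ‖Real.log ‖P.eval
          (Real.cos (t / 2) * Complex.exp ⟨y, c + 3 * t / 2⟩)‖‖ₑ := by
        rw [lintegral_lintegral_swap]
        have : Continuous fun p : ℝ × ℝ =>
            ‖P.eval (Real.cos (p.1 / 2) * Complex.exp ⟨p.2, c + 3 * p.1 / 2⟩)‖ := by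
          have := P.continuous
          have h2 : Continuous fun p : ℝ × ℝ => (⟨p.2, c + 3 * p.1 / 2⟩ : ℂ) :=
            hmk.comp (f := fun p : ℝ × ℝ => (p.2, c + 3 * p.1 / 2)) (by fun_prop)
          fun_prop
        exact (Real.measurable_log.comp this.measurable).enorm.aemeasurable
    _ ≤ ENNReal.ofReal (3 / 2) * ∫⁻ y in Set.Icc (-K) (R ^ 2), tangentBound a n (R ^ 2) := by
        refine mul_le_mul' le_rfl (setLIntegral_mono' measurableSet_Icc fun y hy => ?_)
        refine le_trans (lintegral_mono_set ?_) (lintegral_tangent_le h0 hy.2 c)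
        intro t ht
        have := Real.pi_gt_three
        exact ⟨by linarith [ht.1], by linarith [ht.2]⟩
    _ = _ := by
        rw [setLIntegral_const, Real.volume_Icc, mul_comm (tangentBound _ _ _), sub_neg_eq_add,
          add_comm (R ^ 2)]

/-- The mass of `logSize` in a box around a point of the unit circle. -/
theorem lintegral_box_le {a : ℕ → ℂ} {n : ℕ} (h0 : a 0 ≠ 0) (hn : a n ≠ 0) {R K : ℝ} (hR0 : 0 < R)
    (hR1 : R ≤ 1) (hK : 0 < K) (c : ℝ) :
    ∫⁻ x in Set.Icc (-K) K, ∫⁻ θ in Set.Icc (c - R) (c + R),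
      ‖logSize (coeffPolynomial a n) n ⟨x, θ⟩‖ₑ ≤
    ENNReal.ofReal (3 / 2) * (ENNReal.ofReal (K + R ^ 2) *
      (tangentBound a n (R ^ 2) + tangentBound (fun k => a (n - k)) n (R ^ 2))) := by
  have h1 := lintegral_inner_box_le (n := n) h0 hR0 hR1 (K := K) c
  have h2 := lintegral_inner_box_le (a := fun k => a (n - k)) (n := n) (by simpa using hn)
    hR0 hR1 (K := K) (-c)
  -- The outer half of the box is the inner half for the reversed coefficients, reflected through
  -- the origin.
  have h3 : ∫⁻ x in Set.Icc 0 K, ∫⁻ θ in Set.Icc (c - R) (c + R),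
      ‖logSize (coeffPolynomial a n) n ⟨x, θ⟩‖ₑ =
      ∫⁻ x in Set.Icc (-K) 0, ∫⁻ θ in Set.Icc (-c - R) (-c + R),
      ‖logSize (coeffPolynomial (fun k => a (n - k)) n) n ⟨x, θ⟩‖ₑ := by
    have hx : ∀ (F : ℝ → ℝ≥0∞) (c d : ℝ), ∫⁻ t in Set.Icc c d, F (-t) =
        ∫⁻ t in Set.Icc (-d) (-c), F t := by
      intro F c d
      rw [setLIntegral_congr Ioc_ae_eq_Icc.symm, lintegral_comp_neg_Ioc,
        setLIntegral_congr Ioc_ae_eq_Icc]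
    have h4 := hx (fun x => ∫⁻ θ in Set.Icc (-c - R) (-c + R),
      ‖logSize (coeffPolynomial (fun k => a (n - k)) n) n ⟨x, θ⟩‖ₑ) 0 K
    rw [neg_zero] at h4
    rw [← h4]
    refine lintegral_congr fun x => ?_
    have h5 := hx (fun θ => ‖logSize (coeffPolynomial (fun k => a (n - k)) n) n ⟨-x, θ⟩‖ₑ)
      (c - R) (c + R)
    rw [show -c - R = -(c + R) by ring, show -c + R = -(c - R) by ring, ← h5]
    refine lintegral_congr fun θ => ?_
    rw [logSize_reverse]
    rfl
  calc _ ≤ (∫⁻ x in Set.Icc (-K) 0, ∫⁻ θ in Set.Icc (c - R) (c + R),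
        ‖logSize (coeffPolynomial a n) n ⟨x, θ⟩‖ₑ) +
        ∫⁻ x in Set.Icc 0 K, ∫⁻ θ in Set.Icc (c - R) (c + R),
        ‖logSize (coeffPolynomial a n) n ⟨x, θ⟩‖ₑ := by
        rw [← Set.Icc_union_Icc_eq_Icc (neg_nonpos.2 hK.le) hK.le]
        exact lintegral_union_le _ _ _
    _ ≤ _ := by
        rw [h3, mul_add, mul_add]
        exact add_le_add h1 h2

theorem lintegral_logSize_two_periods_le {a : ℕ → ℂ} {n : ℕ} (h0 : a 0 ≠ 0) (hn : a n ≠ 0) (x : ℝ)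
    {c d : ℝ} (hcd : d - c ≤ 4 * Real.pi) :
    ∫⁻ t in Set.Icc c d, ‖logSize (coeffPolynomial a n) n ⟨x, t⟩‖ₑ ≤ 2 * periodBound a n := by
  have hpi := Real.pi_pos
  rw [setLIntegral_congr Ioc_ae_eq_Icc.symm, two_mul]
  have hsub : Set.Ioc c d ⊆ Set.Ioc c (c + 2 * Real.pi) ∪
      Set.Ioc (c + 2 * Real.pi) (c + 2 * Real.pi + 2 * Real.pi) := by
    rw [Set.Ioc_union_Ioc_eq_Ioc (by linarith) (by linarith)]
    exact Set.Ioc_subset_Ioc_right (by linarith)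
  refine (lintegral_mono_set hsub).trans ((lintegral_union_le _ _ _).trans ?_)
  exact add_le_add (lintegral_logSize_period_le h0 hn x c) (lintegral_logSize_period_le h0 hn x _)

theorem periodBound_lt_top (a : ℕ → ℂ) (n : ℕ) : periodBound a n < ⊤ := by
  unfold periodBound
  finiteness

theorem volume_nearKink_le (κ : ℝ) {R : ℝ} (hR : 0 ≤ R) :
    volume (nearKink κ R) ≤ ENNReal.ofReal (8 * R) := by
  have h : nearKink κ R ⊆ (Set.Icc (κ - R) (κ + R) ∪ Set.Icc (-κ - R) (-κ + R)) ∪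
      (Set.Icc (2 * κ - R) (2 * κ + R) ∪ Set.Icc (-(2 * κ) - R) (-(2 * κ) + R)) := by
    intro x hx
    rcases hx with h | h | h | h <;> have := abs_le.1 h
    · left; left; exact ⟨by linarith, by linarith⟩
    · left; right; exact ⟨by linarith, by linarith⟩
    · right; left; exact ⟨by linarith, by linarith⟩
    · right; right; exact ⟨by linarith, by linarith⟩
  refine (measure_mono h).trans ((measure_union_le _ _).trans
    ((add_le_add (measure_union_le _ _) (measure_union_le _ _)).trans ?_))
  simp only [Real.volume_Icc]
  rw [← ENNReal.ofReal_add (by linarith) (by linarith),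
    ← ENNReal.ofReal_add (by linarith) (by linarith),
    ← ENNReal.ofReal_add (by linarith) (by linarith)]
  exact ENNReal.ofReal_le_ofReal (by linarith)

/-- The error bound for the number of zeros in a sector. -/
noncomputable def sectorError (a : ℕ → ℂ) (n : ℕ) (κ R : ℝ) : ℝ≥0∞ :=
  ENNReal.ofReal (2 / (Real.pi * R ^ 2)) *
    (2 * (ENNReal.ofReal (3 / 2) * (ENNReal.ofReal (3 * κ + R ^ 2) *
      (tangentBound a n (R ^ 2) + tangentBound (fun k => a (n - k)) n (R ^ 2)))) +
    ENNReal.ofReal (R / κ) * (ENNReal.ofReal (8 * R) * (2 * periodBound a n)))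

-- The zero count with its error made explicit: two boxes cover the edge strips and use the tangent
-- curves, while the kink strip has width at most `8R` and uses horizontal periods. Two periods are
-- enough since `2π + 4R ≤ 4π`.
open Classical in
theorem ofReal_countP_nearSector_le {a : ℕ → ℂ} {n : ℕ} (h0 : a 0 ≠ 0) (hn : a n ≠ 0)
    {κ R α β : ℝ} (hR0 : 0 < R) (hR1 : R ≤ 1) (hRκ : 2 * R ≤ κ) (hαβ : α ≤ β)
    (hβ : β ≤ α + 2 * Real.pi) :
    ENNReal.ofReal ((coeffPolynomial a n).roots.countP (· ∈ nearSector κ α β)) ≤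
      ENNReal.ofReal (n * (β - α + 2 * R) / (2 * Real.pi)) + sectorError a n κ R := by
  have hκ : 0 < κ := by linarith
  have hpi := Real.pi_gt_three
  set P := coeffPolynomial a n with hP
  have hm : Measurable fun w => ‖logSize P n w‖ₑ := (measurable_logSize P n).enorm
  have hrect : ∀ (S : Set ℝ) (c d : ℝ), d - c ≤ 4 * Real.pi →
      ∫⁻ z in {z : ℂ | z.re ∈ S ∧ z.im ∈ Set.Icc c d}, ‖logSize P n z‖ₑ ≤
        volume S * (2 * periodBound a n) := by
    intro S c d hcd
    rw [setLIntegral_complex_rect hm]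
    calc _ ≤ ∫⁻ x in S, 2 * periodBound a n :=
          lintegral_mono fun x => lintegral_logSize_two_periods_le h0 hn x hcd
      _ = _ := by rw [setLIntegral_const, mul_comm]
  have hU : IntegrableOn (logSize P n) (bigRect κ R α β) := by
    refine ⟨(measurable_logSize P n).aestronglyMeasurable, ?_⟩
    have hsub : bigRect κ R α β ⊆ {z : ℂ | z.re ∈ Set.Icc (-(3 * κ)) (3 * κ) ∧
        z.im ∈ Set.Icc (α - 2 * R) (β + 2 * R)} := fun z hz => ⟨abs_le.1 hz.1, hz.2⟩
    refine ((lintegral_mono_set hsub).trans (hrect _ _ _ (by linarith))).trans_lt ?_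
    have := periodBound_lt_top a n
    rw [Real.volume_Icc]
    finiteness
  have hcount := countP_roots_nearSector_le (P := P) (coeffPolynomial_ne_zero h0) n hR0 hRκ hαβ hU
  refine (ENNReal.ofReal_le_ofReal hcount).trans (ENNReal.ofReal_add_le.trans ?_)
  refine add_le_add le_rfl ?_
  rw [ENNReal.ofReal_mul (by positivity), sectorError]
  refine mul_le_mul' le_rfl (ENNReal.ofReal_add_le.trans ?_)
  rw [ENNReal.ofReal_mul (by positivity)]
  have henorm : ∀ s : Set ℂ, s ⊆ bigRect κ R α β →
      ENNReal.ofReal (∫ w in s, |logSize P n w|) = ∫⁻ w in s, ‖logSize P n w‖ₑ := fun s hs =>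
    ofReal_integral_norm_eq_lintegral_enorm (hU.mono_set hs)
  rw [henorm _ (strip_subset_bigRect hR0 hαβ), henorm _ (kinkStrip_subset_bigRect hR0 hRκ)]
  refine add_le_add ?_ (mul_le_mul' le_rfl ?_)
  · have hsub : strip κ R α β ⊆
        {z : ℂ | z.re ∈ Set.Icc (-(3 * κ)) (3 * κ) ∧
          z.im ∈ Set.Icc (α - R - R) (α - R + R)} ∪
        {z : ℂ | z.re ∈ Set.Icc (-(3 * κ)) (3 * κ) ∧
          z.im ∈ Set.Icc (β + R - R) (β + R + R)} := by
      intro z hz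
      rcases hz.1 with h | h <;> have h' := abs_le.1 h
      · exact Or.inl ⟨abs_le.1 hz.2, by linarith, by linarith⟩
      · exact Or.inr ⟨abs_le.1 hz.2, by linarith, by linarith⟩
    refine (lintegral_mono_set hsub).trans ((lintegral_union_le _ _ _).trans ?_)
    rw [setLIntegral_complex_rect hm, setLIntegral_complex_rect hm, two_mul]
    exact add_le_add (lintegral_box_le h0 hn hR0 hR1 (by positivity) _)
      (lintegral_box_le h0 hn hR0 hR1 (by positivity) _)
  · have hsub : kinkStrip κ R α β ⊆
        {z : ℂ | z.re ∈ nearKink κ R ∧ z.im ∈ Set.Icc (α - R) (β + R)} := fun z hz =>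
      ⟨hz.2, hz.1⟩
    refine (lintegral_mono_set hsub).trans ((hrect _ _ _ (by linarith)).trans ?_)
    exact mul_le_mul' (volume_nearKink_le κ hR0.le) le_rfl

/-! ### Zeros away from the unit circle, and the discrepancy of a fixed polynomial. -/

theorem natDegree_coeffPolynomial {a : ℕ → ℂ} {n : ℕ} (hn : a n ≠ 0) :
    (coeffPolynomial a n).natDegree = n := by
  refine Polynomial.natDegree_eq_of_le_of_coeff_ne_zero ?_ (by simpa [coeff_coeffPolynomial])
  rw [Polynomial.natDegree_le_iff_coeff_eq_zero]
  intro m hm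
  rw [coeff_coeffPolynomial, if_neg (by omega)]

theorem abs_log_eq_posLog (x : ℝ) : |Real.log x| = 2 * Real.posLog x - Real.log x := by
  unfold Real.posLog
  rcases le_total (Real.log x) 0 with h | h
  · rw [abs_of_nonpos h, max_eq_left h]; ring
  · rw [abs_of_nonneg h, max_eq_right h]; ring

/-- The bound for the total logarithmic distance of the zeros from the unit circle. -/
noncomputable def logDistBound (a : ℕ → ℂ) (n : ℕ) : ℝ :=
  2 * Real.log (1 + absSeries a n 1) - Real.log ‖a 0‖ - Real.log ‖a n‖

/-- Write `|log x| = 2 log⁺ x - log x`. The sum of `log⁺` is the logarithmic Mahler measure minus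
`log |a n|`, and the sum of `log` is `log |a 0| - log |a n|`. -/
theorem sum_abs_log_roots_le {a : ℕ → ℂ} {n : ℕ} (h0 : a 0 ≠ 0) (hn : a n ≠ 0) :
    ((coeffPolynomial a n).roots.map fun z => |Real.log ‖z‖|).sum ≤ logDistBound a n := by
  set P := coeffPolynomial a n
  have hlc : P.leadingCoeff = a n := by
    rw [Polynomial.leadingCoeff, natDegree_coeffPolynomial hn, coeff_coeffPolynomial]
    simp
  have h1 := P.logMahlerMeasure_eq_log_leadingCoeff_add_sum_log_roots
  have h2 := log_norm_eval_eq_add_sum_roots (P := P) (w := 0)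
    (by rwa [eval_zero_coeffPolynomial])
  rw [eval_zero_coeffPolynomial] at h2
  rw [hlc] at h1 h2
  simp only [zero_sub, norm_neg] at h2
  have hS : 0 ≤ absSeries a n 1 := absSeries_nonneg _ _ zero_le_one
  have h3 : P.logMahlerMeasure ≤ Real.log (1 + absSeries a n 1) := by
    rw [Polynomial.logMahlerMeasure_def]
    refine Real.circleAverage_mono_on_of_le_circle
      (P.differentiable.circleIntegrable_log_norm 0 1) fun z hz => ?_
    rw [mem_sphere_iff_norm, sub_zero, abs_one] at hz
    have h4 := norm_eval_coeffPolynomial_le a n z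
    rw [hz] at h4
    rcases (norm_nonneg (P.eval z)).eq_or_lt with h5 | h5
    · rw [← h5, Real.log_zero]
      exact Real.log_nonneg (by linarith)
    · exact Real.log_le_log h5 (by linarith)
  have h5 : (P.roots.map fun z => |Real.log ‖z‖|).sum =
      2 * (P.roots.map fun z => Real.posLog ‖z‖).sum -
        (P.roots.map fun z => Real.log ‖z‖).sum := by
    simp_rw [abs_log_eq_posLog]
    rw [Multiset.sum_map_sub, Multiset.sum_map_mul_left]
  rw [h5, logDistBound]
  linarith

theorem mul_countP_le_sum {s : Multiset ℂ} {f : ℂ → ℝ} (hf : ∀ z, 0 ≤ f z) (x : ℝ)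
    (p : ℂ → Prop) [DecidablePred p] (hp : ∀ z, p z → x ≤ f z) :
    x * s.countP p ≤ (s.map f).sum := by
  induction s using Multiset.induction with
  | empty => simp
  | cons z s ih =>
    by_cases hz : p z
    · have := hp z hz
      simp [hz]
      linarith
    · have := hf z
      simp [hz]
      linarith

theorem countP_le_add {s : Multiset ℂ} (p q r : ℂ → Prop) [DecidablePred p] [DecidablePred q]
    [DecidablePred r] (h : ∀ z ∈ s, p z → q z ∨ r z) :
    s.countP p ≤ s.countP q + s.countP r := by
  induction s using Multiset.induction with
  | empty => simp
  | cons z s ih =>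
    have ih := ih fun w hw => h w (Multiset.mem_cons_of_mem hw)
    have hz := h z (Multiset.mem_cons_self z s)
    simp only [Multiset.countP_cons]
    split_ifs <;> first | omega | tauto

theorem exists_arg_mem_Ico (z : ℂ) (α : ℝ) : ∃ θ : ℝ, α ≤ θ ∧ θ < α + 2 * Real.pi ∧
    z = (‖z‖ : ℂ) * Complex.exp (θ * Complex.I) := by
  have h := toIcoMod_mem_Ico Real.two_pi_pos α z.arg
  refine ⟨toIcoMod Real.two_pi_pos α z.arg, h.1, h.2, ?_⟩
  conv_lhs => rw [← Complex.norm_mul_exp_arg_mul_I z]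
  congr 1
  rw [toIcoMod, Complex.exp_eq_exp_iff_exists_int]
  refine ⟨toIcoDiv Real.two_pi_pos α z.arg, ?_⟩
  have h2 := congrArg (fun x : ℝ => (x : ℂ) * Complex.I)
    (toIcoMod_add_toIcoDiv_zsmul Real.two_pi_pos α z.arg)
  simp only [zsmul_eq_mul] at h2
  rw [← toIcoMod, ← h2]
  push_cast
  ring

open Classical in
theorem zeroCountingMeasure_real_eq (p : ℂ[X]) (S : Set ℂ) :
    (zeroCountingMeasure p).real S = (p.natDegree : ℝ)⁻¹ * p.roots.countP (· ∈ S) := by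
  have h : ∀ s : Multiset ℂ, (s.map Measure.dirac).sum S = (s.countP (· ∈ S) : ℝ≥0∞) := by
    intro s
    induction s using Multiset.induction with
    | empty => simp
    | cons z s ih =>
      by_cases hz : z ∈ S
      · simp [ih, hz, add_comm]
      · simp [ih, hz]
  rw [zeroCountingMeasure, Measure.real, Measure.smul_apply, h]
  simp

/-- The discrepancy of a polynomial with coefficients `a`. -/
noncomputable def polyDiscrepancy (a : ℕ → ℂ) (n : ℕ) (r α β : ℝ) : ℝ :=
  |(zeroCountingMeasure (coeffPolynomial a n)).real (annularSector r α β)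
    - (β - α) / (2 * Real.pi)|

/-- The upper estimate of the zero count is enough: applied to the sector itself it bounds the count
from above, and applied to `[β, α + 2π)` it bounds the count from below. The zeros far from the
circle are added to both estimates. The condition on `κ` puts the near part of the sector inside the
annulus. -/
theorem ofReal_mul_polyDiscrepancy_le {a : ℕ → ℂ} {n : ℕ} (hn0 : 1 ≤ n) (h0 : a 0 ≠ 0)
    (hn : a n ≠ 0) {κ R r α β : ℝ} (hR0 : 0 < R) (hR1 : R ≤ 1) (hRκ : 2 * R ≤ κ) (hr0 : 0 < r)
    (hrκ : κ / 2 < -Real.log r) (hαβ : α < β) (hβ : β ≤ α + 2 * Real.pi) :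
    ENNReal.ofReal (n * polyDiscrepancy a n r α β) ≤
      ENNReal.ofReal (n * R / Real.pi) + sectorError a n κ R +
        ENNReal.ofReal (2 / κ * logDistBound a n) := by
  classical
  have hκ : 0 < κ := by linarith
  have hpi := Real.pi_pos
  have hnpos : (0 : ℝ) < n := by exact_mod_cast hn0
  set P := coeffPolynomial a n with hPdef
  have hP0 : P ≠ 0 := coeffPolynomial_ne_zero h0
  by_cases htop : sectorError a n κ R = ⊤
  · simp [htop]
  set e := (sectorError a n κ R).toReal with he
  have hsE : sectorError a n κ R = ENNReal.ofReal e := (ENNReal.ofReal_toReal htop).symm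
  have he0 : 0 ≤ e := ENNReal.toReal_nonneg
  have hnear : ∀ c d : ℝ, c ≤ d → d ≤ c + 2 * Real.pi →
      (P.roots.countP (· ∈ nearSector κ c d) : ℝ) ≤ n * (d - c + 2 * R) / (2 * Real.pi) + e := by
    intro c d hcd hd
    have h1 := ofReal_countP_nearSector_le h0 hn hR0 hR1 hRκ hcd hd
    have h2 : 0 ≤ n * (d - c + 2 * R) / (2 * Real.pi) := by
      have : 0 ≤ d - c + 2 * R := by linarith
      positivity
    rw [hsE, ← ENNReal.ofReal_add h2 he0] at h1
    exact (ENNReal.ofReal_le_ofReal_iff (by linarith)).1 h1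
  set far : ℂ → Prop := fun z => κ / 2 < |Real.log ‖z‖| with hfar
  have hfarle : (P.roots.countP far : ℝ) ≤ 2 / κ * logDistBound a n := by
    have h1 := mul_countP_le_sum (s := P.roots) (f := fun z => |Real.log ‖z‖|)
      (fun z => abs_nonneg _) (κ / 2) far (fun z hz => le_of_lt hz)
    have h2 := h1.trans (sum_abs_log_roots_le h0 hn)
    rw [div_mul_eq_mul_div, le_div_iff₀ hκ]
    linarith
  have hroot0 : ∀ z ∈ P.roots, z ≠ 0 := by
    intro z hz hz0
    have h1 := (Polynomial.mem_roots hP0).1 hz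
    rw [hz0, Polynomial.IsRoot.def, eval_zero_coeffPolynomial] at h1
    exact h0 h1
  have hup : P.roots.countP (· ∈ annularSector r α β) ≤
      P.roots.countP (· ∈ nearSector κ α β) + P.roots.countP far := by
    refine countP_le_add _ _ _ fun z hz hzS => ?_
    by_cases h : far z
    · exact Or.inr h
    · exact Or.inl ⟨hroot0 z hz, not_lt.1 h, hzS.2.2⟩
  have hlow : P.roots.countP (fun _ => True) ≤ P.roots.countP (· ∈ annularSector r α β) +
      (P.roots.countP (· ∈ nearSector κ β (α + 2 * Real.pi)) + P.roots.countP far) := by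
    refine (countP_le_add _ (· ∈ annularSector r α β)
      (fun z => z ∈ nearSector κ β (α + 2 * Real.pi) ∨ far z) fun z hz _ => ?_).trans
      (add_le_add le_rfl (countP_le_add _ _ _ fun z _ h => h))
    by_cases h : far z
    · exact Or.inr (Or.inr h)
    have hz0 := norm_pos_iff.2 (hroot0 z hz)
    have hlog := abs_le.1 (not_lt.1 h)
    obtain ⟨θ, h1, h2, h3⟩ := exists_arg_mem_Ico z α
    by_cases hθ : θ < β
    · refine Or.inl ⟨?_, ?_, θ, h1, hθ, h3⟩
      · rw [← Real.log_lt_log_iff hr0 hz0]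
        linarith
      · rw [← Real.log_lt_log_iff hz0 (by positivity), one_div, Real.log_inv]
        linarith
    · exact Or.inr (Or.inl ⟨hroot0 z hz, not_lt.1 h, θ, not_lt.1 hθ, h2, h3⟩)
  have hcard : P.roots.countP (fun _ => True) = n := by
    rw [Multiset.countP_eq_card.2 fun _ _ => trivial, IsAlgClosed.card_roots_eq_natDegree, natDegree_coeffPolynomial hn]
  rw [hcard] at hlow
  have hup' : (P.roots.countP (· ∈ annularSector r α β) : ℝ) ≤
      P.roots.countP (· ∈ nearSector κ α β) + P.roots.countP far := by exact_mod_cast hup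
  have hlow' : (n : ℝ) ≤ P.roots.countP (· ∈ annularSector r α β) +
      (P.roots.countP (· ∈ nearSector κ β (α + 2 * Real.pi)) + P.roots.countP far) := by
    exact_mod_cast hlow
  have hn1 := hnear α β hαβ.le hβ
  have hn2 := hnear β (α + 2 * Real.pi) hβ (by linarith)
  have hmain : n * polyDiscrepancy a n r α β ≤ n * R / Real.pi + e + 2 / κ * logDistBound a n := by
    rw [polyDiscrepancy, zeroCountingMeasure_real_eq, ← hPdef, hPdef, natDegree_coeffPolynomial hn,
      ← hPdef]
    set N : ℝ := ((P.roots.countP (· ∈ annularSector r α β) : ℕ) : ℝ) with hN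
    have e1 : (n : ℝ) * |(n : ℝ)⁻¹ * N - (β - α) / (2 * Real.pi)| =
        |N - n * (β - α) / (2 * Real.pi)| := by
      rw [← abs_of_pos hnpos, ← abs_mul, abs_of_pos hnpos]
      congr 1
      field_simp
    have e2 : n * (β - α + 2 * R) / (2 * Real.pi) =
        n * (β - α) / (2 * Real.pi) + n * R / Real.pi := by field_simp
    have e3 : n * (α + 2 * Real.pi - β + 2 * R) / (2 * Real.pi) =
        n - n * (β - α) / (2 * Real.pi) + n * R / Real.pi := by field_simp; ring
    rw [e2] at hn1
    rw [e3] at hn2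
    rw [e1]
    exact abs_le.2 ⟨by linarith, by linarith⟩
  rw [hsE]
  refine (ENNReal.ofReal_le_ofReal hmain).trans (ENNReal.ofReal_add_le.trans ?_)
  exact add_le_add ENNReal.ofReal_add_le le_rfl

/-! ### Expectations under moment bounds. -/

theorem sum_rpow_le {ι : Type*} (S : Finset ι) {x : ι → ℝ} (hx : ∀ i ∈ S, 0 ≤ x i) {s : ℝ}
    (hs0 : 0 < s) (hs1 : s ≤ 1) : (∑ i ∈ S, x i) ^ s ≤ ∑ i ∈ S, x i ^ s := by
  classical
  induction S using Finset.induction_on with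
  | empty => simp [Real.zero_rpow hs0.ne']
  | insert i S hi ih =>
    have h1 : ∀ j ∈ S, 0 ≤ x j := fun j hj => hx j (Finset.mem_insert_of_mem hj)
    rw [Finset.sum_insert hi, Finset.sum_insert hi]
    exact (Real.rpow_add_le_add_rpow (hx i (Finset.mem_insert_self _ _)) (Finset.sum_nonneg h1)
      hs0.le hs1).trans (by linarith [ih h1])

/-- A concavity bound for `log (1 + X)` in terms of `s`-th powers. -/
theorem log_one_add_absSeries_le (a : ℕ → ℂ) (n : ℕ) {s ρ m : ℝ} (hs0 : 0 < s) (hs1 : s ≤ 1)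
    (hρ : 0 ≤ ρ) (hm : 0 ≤ m) :
    Real.log (1 + absSeries a n ρ) ≤ 1 / s * Real.log (1 + m) +
      1 / (s * (1 + m)) * ∑ k ∈ Finset.range (n + 1), ‖a k‖ ^ s * (ρ ^ s) ^ k := by
  set X := absSeries a n ρ
  set Y := ∑ k ∈ Finset.range (n + 1), ‖a k‖ ^ s * (ρ ^ s) ^ k
  have hX : 0 ≤ X := absSeries_nonneg a n hρ
  have hY : X ^ s ≤ Y := by
    refine (sum_rpow_le _ (fun _ _ => by positivity) hs0 hs1).trans_eq
      (Finset.sum_congr rfl fun k _ => ?_)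
    rw [Real.mul_rpow (norm_nonneg _) (by positivity), ← Real.rpow_natCast, ← Real.rpow_natCast,
      ← Real.rpow_mul hρ, ← Real.rpow_mul hρ, mul_comm s]
  have hY0 : 0 ≤ Y := (Real.rpow_nonneg hX s).trans hY
  have h1 : (1 + X) ^ s ≤ 1 + Y := by
    have := Real.rpow_add_le_add_rpow zero_le_one hX hs0.le hs1
    rw [Real.one_rpow] at this
    linarith
  have h2 : s * Real.log (1 + X) ≤ Real.log (1 + Y) := by
    rw [← Real.log_rpow (by linarith)]
    exact Real.log_le_log (by positivity) h1
  -- The concave function `log (1 + Y)` lies below its tangent at `m`; the resulting bound is affine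
  -- in `Y` and can be integrated term by term.
  have h3 : Real.log (1 + Y) ≤ Real.log (1 + m) + Y / (1 + m) := by
    have h4 := Real.log_le_sub_one_of_pos (x := (1 + Y) / (1 + m)) (by positivity)
    rw [Real.log_div (by positivity) (by positivity)] at h4
    have h5 : (1 + Y) / (1 + m) ≤ 1 + Y / (1 + m) := by
      rw [add_div]
      gcongr
      exact (div_le_one (by positivity)).2 (by linarith)
    linarith
  have h6 : Real.log (1 + X) ≤ 1 / s * (Real.log (1 + m) + Y / (1 + m)) := by
    rw [one_div_mul_eq_div, le_div_iff₀ hs0]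
    linarith
  refine h6.trans_eq ?_
  field_simp

/-- Uniform bounds for the first `n + 1` members of a sequence of random coefficients. -/
structure CoeffBounds {Ω : Type*} [MeasurableSpace Ω] (μ : Measure Ω) (a : ℕ → Ω → ℂ) (n : ℕ)
    (s m c : ℝ) : Prop where
  measurable : ∀ k ≤ n, Measurable (a k)
  moment : ∀ k ≤ n, ∫⁻ ω, ‖a k ω‖ₑ ^ s ∂μ ≤ ENNReal.ofReal m
  first : ∫⁻ ω, ENNReal.ofReal (-Real.log ‖a 0 ω‖) ∂μ ≤ ENNReal.ofReal c
  last : ∫⁻ ω, ENNReal.ofReal (-Real.log ‖a n ω‖) ∂μ ≤ ENNReal.ofReal c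

namespace CoeffBounds

variable {Ω : Type*} [MeasurableSpace Ω] {μ : Measure Ω} {a : ℕ → Ω → ℂ} {n : ℕ} {s m c : ℝ}

theorem reverse (h : CoeffBounds μ a n s m c) : CoeffBounds μ (fun k => a (n - k)) n s m c where
  measurable k _ := h.measurable _ (n.sub_le k)
  moment k _ := h.moment _ (n.sub_le k)
  first := by simpa using h.last
  last := by simpa using h.first

/-- The tangent bound is taken at `K`, which dominates the mean of the `s`-th power sum, so its
linear part costs at most `K / (s (1 + K)) ≤ 1/s`. -/
theorem lintegral_log_absSeries_le [IsProbabilityMeasure μ] (h : CoeffBounds μ a n s m c)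
    (hs0 : 0 < s) (hs1 : s ≤ 1) (hm : 0 ≤ m) {ρ K : ℝ} (hρ : 0 ≤ ρ)
    (hK : m * ∑ k ∈ Finset.range (n + 1), (ρ ^ s) ^ k ≤ K) :
    ∫⁻ ω, ENNReal.ofReal (Real.log (1 + absSeries (fun k => a k ω) n ρ)) ∂μ ≤
      ENNReal.ofReal (1 / s * (Real.log (1 + K) + 1)) := by
  have hK0 : 0 ≤ K := le_trans (mul_nonneg hm (Finset.sum_nonneg fun _ _ => by positivity)) hK
  have hlog : 0 ≤ Real.log (1 + K) := Real.log_nonneg (by linarith)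
  have hnorm : ∀ k ω, ENNReal.ofReal (‖a k ω‖ ^ s) = ‖a k ω‖ₑ ^ s := fun k ω => by
    rw [← ENNReal.ofReal_rpow_of_nonneg (norm_nonneg _) hs0.le, ofReal_norm]
  calc ∫⁻ ω, ENNReal.ofReal (Real.log (1 + absSeries (fun k => a k ω) n ρ)) ∂μ
      ≤ ∫⁻ ω, (ENNReal.ofReal (1 / s * Real.log (1 + K)) + ENNReal.ofReal (1 / (s * (1 + K))) *
          ∑ k ∈ Finset.range (n + 1), ‖a k ω‖ₑ ^ s * ENNReal.ofReal ((ρ ^ s) ^ k)) ∂μ := by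
        refine lintegral_mono fun ω => ?_
        refine (ENNReal.ofReal_le_ofReal
          (log_one_add_absSeries_le (fun k => a k ω) n hs0 hs1 hρ hK0)).trans ?_
        rw [ENNReal.ofReal_add (by positivity) (mul_nonneg (by positivity)
          (Finset.sum_nonneg fun _ _ => by positivity)),
          ENNReal.ofReal_mul (p := 1 / (s * (1 + K))) (by positivity), ENNReal.ofReal_sum_of_nonneg fun _ _ => by positivity]
        refine add_le_add le_rfl (mul_le_mul' le_rfl (Finset.sum_le_sum fun k _ => ?_))
        rw [ENNReal.ofReal_mul (by positivity), hnorm]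
    _ = ENNReal.ofReal (1 / s * Real.log (1 + K)) + ENNReal.ofReal (1 / (s * (1 + K))) *
          ∑ k ∈ Finset.range (n + 1), (∫⁻ ω, ‖a k ω‖ₑ ^ s ∂μ) * ENNReal.ofReal ((ρ ^ s) ^ k) := by
        rw [lintegral_add_left measurable_const, lintegral_const, measure_univ, mul_one,
          lintegral_const_mul' _ _ ENNReal.ofReal_ne_top, lintegral_finsetSum']
        · congr 2
          exact Finset.sum_congr rfl fun k _ => lintegral_mul_const' _ _ ENNReal.ofReal_ne_top
        · intro k hk
          have := h.measurable k (Nat.lt_succ_iff.1 (Finset.mem_range.1 hk))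
          fun_prop
    _ ≤ ENNReal.ofReal (1 / s * Real.log (1 + K)) +
          ENNReal.ofReal (1 / (s * (1 + K))) * ENNReal.ofReal K := by
        refine add_le_add le_rfl (mul_le_mul' le_rfl ?_)
        refine le_trans (Finset.sum_le_sum fun k hk => mul_le_mul'
          (h.moment k (Nat.lt_succ_iff.1 (Finset.mem_range.1 hk))) le_rfl) ?_
        rw [← Finset.mul_sum, ← ENNReal.ofReal_sum_of_nonneg fun _ _ => by positivity,
          ← ENNReal.ofReal_mul hm]
        exact ENNReal.ofReal_le_ofReal hK
    _ ≤ _ := by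
        rw [← ENNReal.ofReal_mul (by positivity), ← ENNReal.ofReal_add (by positivity)
          (by positivity), mul_add (1 / s)]
        refine ENNReal.ofReal_le_ofReal (add_le_add le_rfl ?_)
        rw [div_mul_eq_mul_div, one_mul, mul_one, div_le_div_iff₀ (by positivity) hs0]
        nlinarith

theorem lintegral_log_absSeries_one_le [IsProbabilityMeasure μ] (h : CoeffBounds μ a n s m c)
    (hs0 : 0 < s) (hs1 : s ≤ 1) (hm : 0 ≤ m) :
    ∫⁻ ω, ENNReal.ofReal (Real.log (1 + absSeries (fun k => a k ω) n 1)) ∂μ ≤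
      ENNReal.ofReal (1 / s * (Real.log (1 + m * (n + 1)) + 1)) :=
  h.lintegral_log_absSeries_le hs0 hs1 hm zero_le_one (by simp)

theorem measurable_absSeries (h : CoeffBounds μ a n s m c) :
    Measurable fun p : Ω × ℝ => absSeries (fun k => a k p.1) n p.2 := by
  unfold absSeries
  refine Finset.measurable_fun_sum _ fun k hk => ?_
  have := h.measurable k (Nat.lt_succ_iff.1 (Finset.mem_range.1 hk))
  fun_prop

end CoeffBounds

/-- The common bound for the expectations of logarithmic quantities on the unit circle. -/
noncomputable def logGrowth (s m c : ℝ) (n : ℕ) : ℝ :=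
  1 / s * (Real.log (1 + m * (n + 1)) + 1) + c

namespace CoeffBounds

variable {Ω : Type*} [MeasurableSpace Ω] {μ : Measure Ω} {a : ℕ → Ω → ℂ} {n : ℕ} {s m c : ℝ}

theorem lintegral_periodBound_le [IsProbabilityMeasure μ] (h : CoeffBounds μ a n s m c)
    (hs0 : 0 < s) (hs1 : s ≤ 1) (hm : 0 ≤ m) (hc : 0 ≤ c) :
    ∫⁻ ω, periodBound (fun k => a k ω) n ∂μ ≤
      ENNReal.ofReal (4 * Real.pi * logGrowth s m c n) := by
  have hpi := Real.pi_pos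
  have hX := h.measurable_absSeries
  have h0 := h.measurable 0 n.zero_le
  have hn := h.measurable n le_rfl
  have hlog : 0 ≤ Real.log (1 + m * (n + 1)) :=
    Real.log_nonneg (by have : 0 ≤ m * (n + 1) := by positivity
                        linarith)
  unfold periodBound
  have hX1 : Measurable fun ω => absSeries (fun k => a k ω) n 1 :=
    hX.comp (by fun_prop : Measurable fun ω : Ω => (ω, (1 : ℝ)))
  rw [lintegral_add_left (by fun_prop), lintegral_const_mul' _ _ (by simp),
    lintegral_const_mul' _ _ ENNReal.ofReal_ne_top, lintegral_const_mul' _ _ ENNReal.ofReal_ne_top,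
    lintegral_add_left (by fun_prop)]
  refine (add_le_add (mul_le_mul' le_rfl (mul_le_mul' le_rfl
    (h.lintegral_log_absSeries_one_le hs0 hs1 hm))) (mul_le_mul' le_rfl
    (add_le_add h.first h.last))).trans ?_
  have e2 : (2 : ℝ≥0∞) = ENNReal.ofReal 2 := by simp
  rw [e2, ← ENNReal.ofReal_mul (by positivity), ← ENNReal.ofReal_mul (by positivity),
    ← ENNReal.ofReal_add hc hc, ← ENNReal.ofReal_mul (by positivity),
    ← ENNReal.ofReal_add (by positivity) (by positivity)]
  refine ENNReal.ofReal_le_ofReal (le_of_eq ?_)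
  unfold logGrowth
  ring

theorem lintegral_logDistBound_le [IsProbabilityMeasure μ] (h : CoeffBounds μ a n s m c)
    (hs0 : 0 < s) (hs1 : s ≤ 1) (hm : 0 ≤ m) (hc : 0 ≤ c) :
    ∫⁻ ω, ENNReal.ofReal (logDistBound (fun k => a k ω) n) ∂μ ≤
      ENNReal.ofReal (2 * logGrowth s m c n) := by
  have h0 := h.measurable 0 n.zero_le
  have hn := h.measurable n le_rfl
  have hX1 : Measurable fun ω => absSeries (fun k => a k ω) n 1 :=
    h.measurable_absSeries.comp (by fun_prop : Measurable fun ω : Ω => (ω, (1 : ℝ)))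
  have hlog : 0 ≤ Real.log (1 + m * (n + 1)) :=
    Real.log_nonneg (by have : 0 ≤ m * (n + 1) := by positivity
                        linarith)
  calc ∫⁻ ω, ENNReal.ofReal (logDistBound (fun k => a k ω) n) ∂μ
      ≤ ∫⁻ ω, (2 * ENNReal.ofReal (Real.log (1 + absSeries (fun k => a k ω) n 1)) +
          (ENNReal.ofReal (-Real.log ‖a 0 ω‖) + ENNReal.ofReal (-Real.log ‖a n ω‖))) ∂μ := by
        refine lintegral_mono fun ω => ?_
        have e2 : (2 : ℝ≥0∞) = ENNReal.ofReal 2 := by simp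
        rw [e2, ← ENNReal.ofReal_mul (by positivity)]
        unfold logDistBound
        rw [sub_sub, sub_eq_add_neg, neg_add]
        exact ENNReal.ofReal_add_le.trans (add_le_add le_rfl ENNReal.ofReal_add_le)
    _ = _ := by
        rw [lintegral_add_left (by fun_prop), lintegral_const_mul' _ _ (by simp),
          lintegral_add_left (by fun_prop)]
    _ ≤ _ := add_le_add (mul_le_mul' le_rfl (h.lintegral_log_absSeries_one_le hs0 hs1 hm))
        (add_le_add h.first h.last)
    _ = _ := by
        have e2 : (2 : ℝ≥0∞) = ENNReal.ofReal 2 := by simp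
        rw [e2, ← ENNReal.ofReal_mul (by positivity), ← ENNReal.ofReal_add hc hc,
          ← ENNReal.ofReal_add (by positivity) (by positivity)]
        congr 1
        unfold logGrowth
        ring

end CoeffBounds

/-- Decay of `e^(y/2) |cos (t/2)|` away from `t = 0`. -/
theorem exp_mul_abs_cos_half_le {y t : ℝ} (hty : y ≤ t ^ 2 / 64) (ht : |t| ≤ Real.pi) :
    Real.exp y * |Real.cos (t / 2)| ≤ 1 - t ^ 2 / 64 := by
  have hpi : Real.pi < 3.15 := Real.pi_lt_d2
  have ht2 : t ^ 2 ≤ 10 := by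
    rw [← sq_abs]
    nlinarith [abs_nonneg t]
  have hb := abs_le.1 ht
  have hcos := Real.cos_le_one_div_sqrt_sq_add_one (x := t / 2) (by linarith) (by linarith)
  have hcos0 : 0 ≤ Real.cos (t / 2) := Real.cos_nonneg_of_mem_Icc ⟨by linarith, by linarith⟩
  rw [abs_of_nonneg hcos0]
  set u := t ^ 2 with hu
  have hu0 : 0 ≤ u := sq_nonneg t
  -- Squares are compared through `e^x ≤ 1/(1 - x)` and `cos x ≤ 1/√(1 + x²)`; the bound `t² ≤ 10`
  -- leaves enough room.
  have hexp : Real.exp y ^ 2 ≤ 1 / (1 - u / 32) := by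
    rw [← Real.exp_nat_mul]
    refine le_trans (Real.exp_le_exp.2 (?_ : _ ≤ u / 32))
      (Real.exp_bound_div_one_sub_of_interval (by positivity) (by linarith))
    push_cast
    linarith
  have hcos2 : Real.cos (t / 2) ^ 2 ≤ 1 / (1 + u / 4) := by
    refine (pow_le_pow_left₀ hcos0 hcos 2).trans_eq ?_
    rw [div_pow, Real.sq_sqrt (by positivity), one_pow]
    congr 1
    rw [hu]
    ring
  have hsq : (Real.exp y * Real.cos (t / 2)) ^ 2 ≤ 1 - u / 32 := by
    rw [mul_pow]
    refine (mul_le_mul hexp hcos2 (by positivity) (by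
      have : 0 < 1 - u / 32 := by linarith
      positivity)).trans ?_
    have h1 : 0 < 1 - u / 32 := by linarith
    rw [div_mul_div_comm, one_mul, div_le_iff₀ (by positivity)]
    nlinarith [mul_nonneg hu0 hu0, mul_nonneg hu0 (by linarith : 0 ≤ 10 - u), mul_nonneg (mul_nonneg hu0 hu0) hu0]
  -- From `x² ≤ 1 - u/32` by `x ≤ (1 + x²)/2`.
  nlinarith [sq_nonneg (Real.exp y * Real.cos (t / 2) - 1)]

/-- Bernoulli's inequality gives `ρ^s ≤ 1 - sδ`, and the geometric series is summed. The bound does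
not depend on `n`. -/
theorem sum_rpow_pow_le {ρ s δ : ℝ} (hρ : 0 ≤ ρ) (hs0 : 0 < s) (hs1 : s ≤ 1) (hδ : 0 < δ)
    (hρδ : ρ ≤ 1 - δ) (n : ℕ) : ∑ k ∈ Finset.range n, (ρ ^ s) ^ k ≤ 1 / (s * δ) := by
  have hq : ρ ^ s ≤ 1 - s * δ := by
    have h1 := rpow_one_add_le_one_add_mul_self (s := ρ - 1) (by linarith) hs0.le hs1
    rw [add_sub_cancel] at h1
    nlinarith
  have hq0 : 0 ≤ ρ ^ s := Real.rpow_nonneg hρ s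
  have hsd : 0 < s * δ := by positivity
  have h2 := mul_neg_geom_sum (ρ ^ s) n
  have h3 : 0 ≤ ∑ k ∈ Finset.range n, (ρ ^ s) ^ k := Finset.sum_nonneg fun _ _ => by positivity
  rw [le_div_iff₀ hsd]
  nlinarith [pow_nonneg hq0 n]

/-- The contribution of the points away from the touching point of the tangent curve. -/
noncomputable def tangentTail (s m : ℝ) : ℝ≥0∞ :=
  ∫⁻ t in Set.Ioc (-Real.pi) Real.pi,
    ENNReal.ofReal (1 / s * (Real.log (1 + m * (1 / (s * (t ^ 2 / 64)))) + 1))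

/-- The integrand has only a logarithmic singularity at `t = 0`; it becomes explicit after clearing
the denominator `t²`. -/
theorem tangentTail_lt_top {s m : ℝ} (hs : 0 < s) (hm : 0 < m) : tangentTail s m < ⊤ := by
  have hpi := Real.pi_pos
  have hint : IntegrableOn (fun t : ℝ =>
      1 / s * (Real.log (t ^ 2 + 64 * m / s) - 2 * Real.log t + 1)) (Set.Ioc (-Real.pi) Real.pi) := by
    rw [← intervalIntegrable_iff_integrableOn_Ioc_of_le (by linarith)]
    have h1 : Continuous fun t : ℝ => Real.log (t ^ 2 + 64 * m / s) :=
      Continuous.log (by fun_prop) fun t => by positivity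
    exact (((h1.intervalIntegrable _ _).sub
      (intervalIntegral.intervalIntegrable_log'.const_mul 2)).add
      (intervalIntegrable_const)).const_mul _
  unfold tangentTail
  refine lt_of_eq_of_lt ?_ hint.lintegral_lt_top
  have h0 : ∀ᵐ t : ℝ ∂(volume.restrict (Set.Ioc (-Real.pi) Real.pi)), t ≠ 0 :=
    ae_restrict_of_ae (Measure.ae_ne volume 0)
  refine lintegral_congr_ae ?_
  filter_upwards [h0] with t ht
  have ht2 : 0 < t ^ 2 := by positivity
  have e1 : 1 + m * (1 / (s * (t ^ 2 / 64))) = (t ^ 2 + 64 * m / s) / t ^ 2 := by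
    field_simp
  rw [e1, Real.log_div (by positivity) ht2.ne', Real.log_pow]
  norm_num

namespace CoeffBounds

variable {Ω : Type*} [MeasurableSpace Ω] {μ : Measure Ω} {a : ℕ → Ω → ℂ} {n : ℕ} {s m c : ℝ}

/-- The bound is independent of `n`, which is the gain from the tangent curves. The full growth `log
n + nR²` is felt only on an interval of length `16R`, and `hR` makes that contribution bounded. -/
theorem lintegral_tangentBound_le [IsProbabilityMeasure μ] (h : CoeffBounds μ a n s m c)
    (hs0 : 0 < s) (hs1 : s ≤ 1) (hm : 0 < m) {R : ℝ} (hR0 : 0 < R)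
    (hR : R * (Real.log (n + 1) + n * R ^ 2 + 1) ≤ 1) :
    ∫⁻ ω, tangentBound (fun k => a k ω) n (R ^ 2) ∂μ ≤
      2 * (tangentTail s m + ENNReal.ofReal (16 / s * (R * Real.log (1 + m) + 1))) +
        ENNReal.ofReal (2 * Real.pi) * ENNReal.ofReal c := by
  have hpi := Real.pi_pos
  set G : Ω → ℝ → ℝ≥0∞ := fun ω t => ENNReal.ofReal (Real.log (1 +
    absSeries (fun k => a k ω) n (Real.exp (R ^ 2) * |Real.cos (t / 2)|))) with hG
  have hGm : Measurable (Function.uncurry G) := by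
    have h1 : Measurable fun p : Ω × ℝ => (p.1, Real.exp (R ^ 2) * |Real.cos (p.2 / 2)|) := by
      fun_prop
    have h2 := h.measurable_absSeries.comp h1
    exact ((measurable_const.add h2).log).ennreal_ofReal
  have h0 := h.measurable 0 n.zero_le
  set C : ℝ := 1 / s * (Real.log (1 + m) + (Real.log (n + 1) + n * R ^ 2 + 1)) with hC
  have hlm : 0 ≤ Real.log (1 + m) := Real.log_nonneg (by linarith)
  have hln : 0 ≤ Real.log ((n : ℝ) + 1) := Real.log_nonneg (by linarith [n.cast_nonneg (α := ℝ)])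
  have hC0 : 0 ≤ C := by positivity
  have hin : ∀ t ∈ Set.Ioc (-Real.pi) Real.pi, ∫⁻ ω, G ω t ∂μ ≤
      ENNReal.ofReal (1 / s * (Real.log (1 + m * (1 / (s * (t ^ 2 / 64)))) + 1)) +
        (Set.Icc (-(8 * R)) (8 * R)).indicator (fun _ => ENNReal.ofReal C) t := by
    intro t ht
    have htpi : |t| ≤ Real.pi := abs_le.2 ⟨ht.1.le, ht.2⟩
    -- For `|t| > 8R` one has `R² ≤ t²/64`, so the curve stays inside the disc despite the
    -- enlargement by `e^(R²)`. For smaller `t` the radius may exceed `1`, and its `n`-th power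
    -- costs `e^(nR²)`.
    by_cases hcase : |t| ≤ 8 * R
    · rw [Set.indicator_of_mem (s := Set.Icc (-(8 * R)) (8 * R)) (abs_le.1 hcase)]
      refine le_add_left ?_
      set ρ := Real.exp (R ^ 2) * |Real.cos (t / 2)|
      have hρ0 : 0 ≤ ρ := by positivity
      have hρ : ρ ≤ Real.exp (R ^ 2) :=
        mul_le_of_le_one_right (by positivity) (Real.abs_cos_le_one _)
      have hpow : ∀ k ∈ Finset.range (n + 1), (ρ ^ s) ^ k ≤ Real.exp (n * R ^ 2) := by
        intro k hk
        have hk' : (k : ℝ) ≤ n := by exact_mod_cast Nat.lt_succ_iff.1 (Finset.mem_range.1 hk)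
        have h1 : ρ ^ s ≤ Real.exp (R ^ 2) := by
          refine (Real.rpow_le_rpow hρ0 hρ hs0.le).trans ?_
          rw [← Real.exp_mul]
          exact Real.exp_le_exp.2 (mul_le_of_le_one_right (by positivity) hs1)
        refine (pow_le_pow_left₀ (Real.rpow_nonneg hρ0 s) h1 k).trans ?_
        rw [← Real.exp_nat_mul]
        exact Real.exp_le_exp.2 (by gcongr)
      have hsum : m * ∑ k ∈ Finset.range (n + 1), (ρ ^ s) ^ k ≤
          m * ((n + 1) * Real.exp (n * R ^ 2)) := by
        refine mul_le_mul_of_nonneg_left ?_ hm.le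
        refine (Finset.sum_le_sum hpow).trans_eq ?_
        simp
      refine (h.lintegral_log_absSeries_le hs0 hs1 hm.le hρ0 hsum).trans
        (ENNReal.ofReal_le_ofReal ?_)
      rw [hC]
      refine mul_le_mul_of_nonneg_left ?_ (by positivity)
      have h2 : Real.log (1 + m * ((n + 1) * Real.exp (n * R ^ 2))) ≤
          Real.log ((1 + m) * ((n + 1) * Real.exp (n * R ^ 2))) := by
        refine Real.log_le_log (by positivity) ?_
        have h3 : 1 ≤ Real.exp (n * R ^ 2) := Real.one_le_exp (by positivity)
        have h4 : (0 : ℝ) ≤ n := n.cast_nonneg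
        nlinarith
      rw [Real.log_mul (by positivity) (by positivity), Real.log_mul (by positivity)
        (by positivity), Real.log_exp] at h2
      linarith
    · refine le_add_right ?_
      have hlt : 8 * R < |t| := not_le.1 hcase
      have ht2 : R ^ 2 ≤ t ^ 2 / 64 := by
        have : (8 * R) ^ 2 ≤ |t| ^ 2 := pow_le_pow_left₀ (by positivity) hlt.le 2
        rw [sq_abs] at this
        linarith
      have hpos : 0 < t ^ 2 / 64 := lt_of_lt_of_le (by positivity) ht2
      have hρ := exp_mul_abs_cos_half_le ht2 htpi
      exact h.lintegral_log_absSeries_le hs0 hs1 hm.le (by positivity)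
        (mul_le_mul_of_nonneg_left (sum_rpow_pow_le (by positivity) hs0 hs1 hpos hρ _) hm.le)
  have hmain : ∫⁻ ω, (∫⁻ t in Set.Ioc (-Real.pi) Real.pi, G ω t) ∂μ ≤
      tangentTail s m + ENNReal.ofReal (16 / s * (R * Real.log (1 + m) + 1)) := by
    rw [lintegral_lintegral_swap hGm.aemeasurable]
    refine (setLIntegral_mono' measurableSet_Ioc hin).trans ?_
    rw [lintegral_add_right _ (measurable_const.indicator measurableSet_Icc)]
    refine add_le_add le_rfl ?_
    rw [lintegral_indicator measurableSet_Icc, setLIntegral_const]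
    refine (mul_le_mul' le_rfl (Measure.restrict_apply_le _ _)).trans ?_
    rw [Real.volume_Icc, ← ENNReal.ofReal_mul hC0]
    refine ENNReal.ofReal_le_ofReal ?_
    have e : C * (8 * R - -(8 * R)) = 16 / s * (R * Real.log (1 + m) +
        R * (Real.log (n + 1) + n * R ^ 2 + 1)) := by
      rw [hC]
      ring
    rw [e]
    gcongr
  unfold tangentBound
  rw [lintegral_add_right _ (by fun_prop), lintegral_const_mul' _ _ (by simp),
    lintegral_const_mul' _ _ ENNReal.ofReal_ne_top]
  exact add_le_add (mul_le_mul' le_rfl hmain) (mul_le_mul' le_rfl h.first)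

theorem measurable_periodBound (h : CoeffBounds μ a n s m c) :
    Measurable fun ω => periodBound (fun k => a k ω) n := by
  have h0 := h.measurable 0 n.zero_le
  have hn := h.measurable n le_rfl
  have hX1 : Measurable fun ω => absSeries (fun k => a k ω) n 1 :=
    h.measurable_absSeries.comp (by fun_prop : Measurable fun ω : Ω => (ω, (1 : ℝ)))
  unfold periodBound
  fun_prop

theorem measurable_tangentBound (h : CoeffBounds μ a n s m c) (y : ℝ) :
    Measurable fun ω => tangentBound (fun k => a k ω) n y := by
  have h0 := h.measurable 0 n.zero_le
  have hG : Measurable fun p : Ω × ℝ => ENNReal.ofReal (Real.log (1 +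
      absSeries (fun k => a k p.1) n (Real.exp y * |Real.cos (p.2 / 2)|))) := by
    have h1 : Measurable fun p : Ω × ℝ => (p.1, Real.exp y * |Real.cos (p.2 / 2)|) := by
      fun_prop
    exact ((measurable_const.add (h.measurable_absSeries.comp h1)).log).ennreal_ofReal
  unfold tangentBound
  exact (hG.lintegral_prod_right'.const_mul 2).add (by fun_prop)

/-- The hypothesis `hT` ranges over all coefficient families with the same bounds because the
reversed family is needed as well. -/
theorem lintegral_sectorError_le [IsProbabilityMeasure μ] (h : CoeffBounds μ a n s m c)
    (hs0 : 0 < s) (hs1 : s ≤ 1) (hm : 0 < m) (hc : 0 ≤ c) {κ R T : ℝ} (hR0 : 0 < R) (hκ : 0 < κ)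
    (hT : ∀ b : ℕ → Ω → ℂ, CoeffBounds μ b n s m c →
      ∫⁻ ω, tangentBound (fun k => b k ω) n (R ^ 2) ∂μ ≤ ENNReal.ofReal T) (hT0 : 0 ≤ T) :
    ∫⁻ ω, sectorError (fun k => a k ω) n κ R ∂μ ≤
      ENNReal.ofReal (2 / (Real.pi * R ^ 2) * (6 * (3 * κ + R ^ 2) * T +
        R / κ * (8 * R) * (8 * Real.pi * logGrowth s m c n))) := by
  have hlog : 0 ≤ logGrowth s m c n := by
    have : 0 ≤ Real.log (1 + m * (n + 1)) :=
      Real.log_nonneg (by have : 0 ≤ m * (n + 1) := by positivity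
                          linarith)
    unfold logGrowth
    positivity
  have hpi := Real.pi_pos
  have h1 := h.measurable_tangentBound (R ^ 2)
  have h2 := h.measurable_periodBound
  unfold sectorError
  rw [lintegral_const_mul' _ _ ENNReal.ofReal_ne_top,
    lintegral_add_right _ (by fun_prop), lintegral_const_mul' _ _ (by simp),
    lintegral_const_mul' _ _ ENNReal.ofReal_ne_top, lintegral_const_mul' _ _ ENNReal.ofReal_ne_top,
    lintegral_const_mul' _ _ ENNReal.ofReal_ne_top, lintegral_const_mul' _ _ ENNReal.ofReal_ne_top,
    lintegral_const_mul' _ _ (by simp), lintegral_add_left h1]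
  refine (mul_le_mul' le_rfl (add_le_add (mul_le_mul' le_rfl (mul_le_mul' le_rfl (mul_le_mul' le_rfl
    (add_le_add (hT a h) (hT _ h.reverse))))) (mul_le_mul' le_rfl (mul_le_mul' le_rfl
    (mul_le_mul' le_rfl (h.lintegral_periodBound_le hs0 hs1 hm.le hc)))))).trans ?_
  have e2 : (2 : ℝ≥0∞) = ENNReal.ofReal 2 := by simp
  rw [e2, ← ENNReal.ofReal_add hT0 hT0, ← ENNReal.ofReal_mul (by positivity),
    ← ENNReal.ofReal_mul (by positivity), ← ENNReal.ofReal_mul (by positivity),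
    ← ENNReal.ofReal_mul (by positivity), ← ENNReal.ofReal_mul (by positivity),
    ← ENNReal.ofReal_mul (by positivity), ← ENNReal.ofReal_add (by positivity) (by positivity),
    ← ENNReal.ofReal_mul (by positivity)]
  refine ENNReal.ofReal_le_ofReal (le_of_eq ?_)
  ring

/-- The expected discrepancy of a random polynomial. -/
theorem lintegral_polyDiscrepancy_le [IsProbabilityMeasure μ] (h : CoeffBounds μ a n s m c)
    (hs0 : 0 < s) (hs1 : s ≤ 1) (hm : 0 < m) (hc : 0 ≤ c) (hn0 : 1 ≤ n)
    (h0 : ∀ᵐ ω ∂μ, a 0 ω ≠ 0) (hn : ∀ᵐ ω ∂μ, a n ω ≠ 0) {κ R r α β T : ℝ} (hR0 : 0 < R)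
    (hR1 : R ≤ 1) (hRκ : 2 * R ≤ κ) (hr0 : 0 < r) (hrκ : κ / 2 < -Real.log r) (hαβ : α < β)
    (hβ : β ≤ α + 2 * Real.pi)
    (hT : ∀ b : ℕ → Ω → ℂ, CoeffBounds μ b n s m c →
      ∫⁻ ω, tangentBound (fun k => b k ω) n (R ^ 2) ∂μ ≤ ENNReal.ofReal T) (hT0 : 0 ≤ T) :
    ∫⁻ ω, ENNReal.ofReal (n * polyDiscrepancy (fun k => a k ω) n r α β) ∂μ ≤
      ENNReal.ofReal (n * R / Real.pi + 2 / (Real.pi * R ^ 2) * (6 * (3 * κ + R ^ 2) * T +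
        R / κ * (8 * R) * (8 * Real.pi * logGrowth s m c n)) +
        2 / κ * (2 * logGrowth s m c n)) := by
  have hpi := Real.pi_pos
  have hκ : 0 < κ := by linarith
  have hlog : 0 ≤ logGrowth s m c n := by
    have : 0 ≤ Real.log (1 + m * (n + 1)) :=
      Real.log_nonneg (by have : 0 ≤ m * (n + 1) := by positivity
                          linarith)
    unfold logGrowth
    positivity
  have h1 := h.measurable_tangentBound (R ^ 2)
  have h1' := h.reverse.measurable_tangentBound (R ^ 2)
  have h2 := h.measurable_periodBound
  have hsm : Measurable fun ω => sectorError (fun k => a k ω) n κ R := by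
    unfold sectorError
    fun_prop
  calc ∫⁻ ω, ENNReal.ofReal (n * polyDiscrepancy (fun k => a k ω) n r α β) ∂μ
      ≤ ∫⁻ ω, (ENNReal.ofReal (n * R / Real.pi) + sectorError (fun k => a k ω) n κ R +
          ENNReal.ofReal (2 / κ) * ENNReal.ofReal (logDistBound (fun k => a k ω) n)) ∂μ := by
        refine lintegral_mono_ae ?_
        filter_upwards [h0, hn] with ω hω0 hωn
        rw [← ENNReal.ofReal_mul (by positivity)]
        exact ofReal_mul_polyDiscrepancy_le (a := fun k => a k ω) hn0 hω0 hωn hR0 hR1 hRκ hr0 hrκ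
          hαβ hβ
    _ ≤ ENNReal.ofReal (n * R / Real.pi) + ENNReal.ofReal (2 / (Real.pi * R ^ 2) *
          (6 * (3 * κ + R ^ 2) * T + R / κ * (8 * R) * (8 * Real.pi * logGrowth s m c n))) +
          ENNReal.ofReal (2 / κ) * ENNReal.ofReal (2 * logGrowth s m c n) := by
        rw [lintegral_add_left (by fun_prop), lintegral_add_left measurable_const,
          lintegral_const, measure_univ, mul_one, lintegral_const_mul' _ _ ENNReal.ofReal_ne_top]
        exact add_le_add (add_le_add le_rfl
          (h.lintegral_sectorError_le hs0 hs1 hm hc hR0 hκ hT hT0))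
          (mul_le_mul' le_rfl (h.lintegral_logDistBound_le hs0 hs1 hm.le hc))
    _ = _ := by
        rw [← ENNReal.ofReal_mul (by positivity), ← ENNReal.ofReal_add (by positivity)
          (by positivity), ← ENNReal.ofReal_add (by positivity) (by positivity)]

end CoeffBounds

/-! ### Measurability of the zero count and integrability of the discrepancy. -/

/-- An annular sector is the union of an increasing sequence of compact sets. -/
theorem exists_annularSector_eq_iUnion {r : ℝ} (hr : 0 < r) (α β : ℝ) :
    ∃ K : ℕ → Set ℂ, Monotone K ∧ (∀ m, IsClosed (K m)) ∧ annularSector r α β = ⋃ m, K m := by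
  have hmono : ∀ {m k : ℕ}, m ≤ k → 1 / ((k : ℝ) + 1) ≤ 1 / ((m : ℝ) + 1) := fun h =>
    Nat.one_div_le_one_div h
  refine ⟨fun m => (fun p : ℝ × ℝ => (p.1 : ℂ) * Complex.exp (p.2 * Complex.I)) ''
    (Set.Icc (r + 1 / ((m : ℝ) + 1)) (1 / r - 1 / ((m : ℝ) + 1)) ×ˢ
      Set.Icc α (β - 1 / ((m : ℝ) + 1))), ?_, ?_, ?_⟩
  · intro m k hmk
    refine Set.image_mono (Set.prod_mono (Set.Icc_subset_Icc ?_ ?_) (Set.Icc_subset_Icc_right ?_))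
    all_goals linarith [hmono hmk]
  · intro m
    exact ((isCompact_Icc.prod isCompact_Icc).image (by fun_prop)).isClosed
  · ext z
    simp only [Set.mem_iUnion]
    constructor
    · rintro ⟨h1, h2, θ, h3, h4, h5⟩
      obtain ⟨i, hi⟩ := exists_nat_one_div_lt (sub_pos.2 h1)
      obtain ⟨j, hj⟩ := exists_nat_one_div_lt (sub_pos.2 h2)
      obtain ⟨k, hk⟩ := exists_nat_one_div_lt (sub_pos.2 h4)
      have hi' := hmono (le_max_left i (max j k))
      have hj' := hmono ((le_max_left j k).trans (le_max_right i (max j k)))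
      have hk' := hmono ((le_max_right j k).trans (le_max_right i (max j k)))
      exact ⟨max i (max j k), (‖z‖, θ), ⟨⟨by linarith, by linarith⟩, ⟨h3, by linarith⟩⟩, h5.symm⟩
    · rintro ⟨m, ⟨ρ, θ⟩, ⟨⟨h1, h2⟩, ⟨h3, h4⟩⟩, rfl⟩
      have hm : 0 < 1 / ((m : ℝ) + 1) := Nat.one_div_pos_of_nat
      dsimp only at h1 h2 h3 h4 ⊢
      have hρ : 0 ≤ ρ := by linarith
      have hnorm : ‖(ρ : ℂ) * Complex.exp (θ * Complex.I)‖ = ρ := by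
        rw [norm_mul, Complex.norm_exp_ofReal_mul_I, mul_one, Complex.norm_real,
          Real.norm_of_nonneg hρ]
      refine ⟨?_, ?_, θ, h3, by linarith, ?_⟩
      · rw [hnorm]; linarith
      · rw [hnorm]; linarith
      · rw [hnorm]

open Classical in
/-- Splitting off the roots: a polynomial of degree `n` is determined by its leading coefficient
and its roots, and it is recognised by its values at `n + 1` points. -/
theorem le_countP_roots_iff {P : ℂ[X]} {n : ℕ} (hP : P.natDegree = n) (hP0 : P ≠ 0) (S : Set ℂ)
    (j : ℕ) : j ≤ P.roots.countP (· ∈ S) ↔ ∃ (c : ℂ) (z : Fin n → ℂ) (T : Finset (Fin n)),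
      j ≤ T.card ∧ (∀ i ∈ T, z i ∈ S) ∧
        ∀ l : Fin (n + 1), c * ∏ i, ((l : ℂ) - z i) = P.eval (l : ℂ) := by
  constructor
  · intro h
    obtain ⟨L, hL⟩ := Quot.exists_rep P.roots
    have hL' : (L : Multiset ℂ) = P.roots := hL
    have hlen : L.length = n := by
      rw [← Multiset.coe_card, hL', IsAlgClosed.card_roots_eq_natDegree, hP]
    subst hlen
    have hmap : (Finset.univ.val.map L.get : Multiset ℂ) = P.roots := by
      rw [← hL', Fin.univ_val_map, List.ofFn_get]
    refine ⟨P.leadingCoeff, L.get, Finset.univ.filter fun i => L.get i ∈ S, ?_, ?_, ?_⟩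
    · refine h.trans_eq ?_
      rw [← hmap, Multiset.countP_map]
      rfl
    · intro i hi
      exact (Finset.mem_filter.1 hi).2
    · intro l
      conv_rhs => rw [(IsAlgClosed.splits P).eq_prod_roots, ← hmap]
      rw [Polynomial.eval_mul, Polynomial.eval_C, Polynomial.eval_multiset_prod, Multiset.map_map,
        Multiset.map_map]
      simp [Finset.prod]
  · rintro ⟨c, z, T, hT, hTS, hval⟩
    have hQ : P = Polynomial.C c * ∏ i, (Polynomial.X - Polynomial.C (z i)) := by
      refine Polynomial.eq_of_natDegree_lt_card_of_eval_eq P _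
        (f := fun l : Fin (n + 1) => (l : ℂ)) ?_ ?_ ?_
      · intro l l' h
        have h' : ((l : ℕ) : ℂ) = ((l' : ℕ) : ℂ) := h
        exact Fin.ext (by exact_mod_cast h')
      · intro l
        rw [← hval l, Polynomial.eval_mul, Polynomial.eval_C, Polynomial.eval_prod]
        simp
      · rw [Fintype.card_fin, hP]
        refine max_lt (Nat.lt_succ_self n) (Nat.lt_succ_of_le ?_)
        refine (Polynomial.natDegree_C_mul_le _ _).trans ?_
        refine (Polynomial.natDegree_prod_le _ _).trans ?_
        simp
    have hc : c ≠ 0 := by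
      rintro rfl
      exact hP0 (by rw [hQ]; simp)
    have hroots : P.roots = Finset.univ.val.map z := by
      rw [hQ, Polynomial.roots_C_mul _ hc]
      have h := Polynomial.roots_multiset_prod_X_sub_C (Finset.univ.val.map z)
      rwa [Multiset.map_map] at h
    rw [hroots, Multiset.countP_map]
    refine hT.trans ?_
    have : T ⊆ Finset.univ.filter fun i => z i ∈ S := fun i hi =>
      Finset.mem_filter.2 ⟨Finset.mem_univ _, hTS i hi⟩
    exact Finset.card_le_card this

/-- The values of polynomials with many roots in `S` form a countable union of compact sets. -/
theorem measurableSet_values {n : ℕ} {K : ℕ → Set ℂ} (hmono : Monotone K)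
    (hK : ∀ m, IsClosed (K m)) (T : Finset (Fin n)) :
    MeasurableSet ((fun (p : ℂ × (Fin n → ℂ)) (l : Fin (n + 1)) => p.1 * ∏ i, ((l : ℂ) - p.2 i)) ''
      {p | ∀ i ∈ T, p.2 i ∈ ⋃ m, K m}) := by
  have h1 : {p : ℂ × (Fin n → ℂ) | ∀ i ∈ T, p.2 i ∈ ⋃ m, K m} =
      ⋃ m, ⋂ i ∈ T, {p : ℂ × (Fin n → ℂ) | p.2 i ∈ K m} := by
    ext p
    simp only [Set.mem_ofPred_eq, Set.mem_iUnion, Set.mem_iInter]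
    constructor
    · intro h
      choose! m hm using h
      exact ⟨T.sup m, fun i hi => hmono (Finset.le_sup hi) (hm i hi)⟩
    · rintro ⟨m, hm⟩ i hi
      exact ⟨m, hm i hi⟩
  rw [h1, Set.image_iUnion]
  refine MeasurableSet.iUnion fun m => ?_
  have hcl : IsClosed (⋂ i ∈ T, {p : ℂ × (Fin n → ℂ) | p.2 i ∈ K m}) :=
    isClosed_biInter fun i _ => (hK m).preimage (by fun_prop)
  have hs : IsSigmaCompact (⋂ i ∈ T, {p : ℂ × (Fin n → ℂ) | p.2 i ∈ K m}) :=
    isSigmaCompact_univ.of_isClosed_subset hcl (Set.subset_univ _)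
  obtain ⟨C, hC, hCeq⟩ := hs
  rw [← hCeq, Set.image_iUnion]
  exact MeasurableSet.iUnion fun k => ((hC k).image (by fun_prop)).isClosed.measurableSet

section

variable {Ω : Type*} [MeasurableSpace Ω]

-- The zeros need not be chosen measurably. The event is the preimage, under the measurable vector
-- of values at `0, …, n`, of countable unions of compact sets of values.
open Classical in
theorem measurableSet_le_countP_roots {a : ℕ → Ω → ℂ} {n : ℕ} (ha : ∀ k ≤ n, Measurable (a k))
    {r : ℝ} (hr : 0 < r) (α β : ℝ) (j : ℕ) :
    MeasurableSet {ω | a n ω ≠ 0 ∧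
      j ≤ (coeffPolynomial (fun k => a k ω) n).roots.countP (· ∈ annularSector r α β)} := by
  obtain ⟨K, hmono, hK, hS⟩ := exists_annularSector_eq_iUnion hr α β
  have hval : Measurable fun (ω : Ω) (l : Fin (n + 1)) =>
      (coeffPolynomial (fun k => a k ω) n).eval (l : ℂ) := by
    refine measurable_pi_lambda _ fun l => ?_
    simp only [eval_coeffPolynomial]
    refine Finset.measurable_fun_sum _ fun k hk => ?_
    have := ha k (Nat.lt_succ_iff.1 (Finset.mem_range.1 hk))
    fun_prop
  have hset : {ω | a n ω ≠ 0 ∧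
      j ≤ (coeffPolynomial (fun k => a k ω) n).roots.countP (· ∈ annularSector r α β)} =
      {ω | a n ω ≠ 0} ∩ ⋃ T ∈ {T : Finset (Fin n) | j ≤ T.card},
        (fun (ω : Ω) (l : Fin (n + 1)) => (coeffPolynomial (fun k => a k ω) n).eval (l : ℂ)) ⁻¹'
        ((fun (p : ℂ × (Fin n → ℂ)) (l : Fin (n + 1)) => p.1 * ∏ i, ((l : ℂ) - p.2 i)) ''
          {p | ∀ i ∈ T, p.2 i ∈ ⋃ m, K m}) := by
    ext ω
    simp only [Set.mem_inter_iff, Set.mem_ofPred_eq, Set.mem_iUnion, Set.mem_preimage,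
      Set.mem_image]
    refine and_congr_right fun hω => ?_
    have hdeg := natDegree_coeffPolynomial (a := fun k => a k ω) hω
    have hne : coeffPolynomial (fun k => a k ω) n ≠ 0 := fun h => by
      have := coeff_coeffPolynomial (fun k => a k ω) n n
      rw [h] at this
      exact hω (by simpa using this.symm)
    rw [le_countP_roots_iff hdeg hne, hS]
    constructor
    · rintro ⟨c, z, T, h1, h2, h3⟩
      exact ⟨T, h1, (c, z), by simpa using h2, funext h3⟩
    · rintro ⟨T, h1, ⟨c, z⟩, h2, h3⟩
      exact ⟨c, z, T, h1, by simpa using h2, fun l => congrFun h3 l⟩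
  rw [hset]
  refine MeasurableSet.inter ((ha n le_rfl) (measurableSet_singleton 0).compl)
    (MeasurableSet.biUnion (Set.to_countable _) fun T _ => hval (measurableSet_values hmono hK T))

theorem integrable_polyDiscrepancy {μ : Measure Ω} [IsFiniteMeasure μ] {a : ℕ → Ω → ℂ} {n : ℕ}
    (ha : ∀ k ≤ n, Measurable (a k)) (hn : ∀ᵐ ω ∂μ, a n ω ≠ 0) {r : ℝ} (hr : 0 < r) (α β : ℝ) :
    Integrable (fun ω => polyDiscrepancy (fun k => a k ω) n r α β) μ := by
  classical
  set f : Ω → ℕ := fun ω => if a n ω ≠ 0 then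
    (coeffPolynomial (fun k => a k ω) n).roots.countP (· ∈ annularSector r α β) else 0 with hf
  have hfm : Measurable f := by
    refine measurable_of_Ici fun j => ?_
    -- Where the leading coefficient vanishes `f` is set to `0`; this affects only the trivial level
    -- `j = 0`.
    rcases j.eq_zero_or_pos with rfl | hj
    · convert MeasurableSet.univ
      ext ω
      simp
    · convert measurableSet_le_countP_roots ha hr α β j using 1
      ext ω
      simp only [hf, Set.mem_preimage, Set.mem_Ici, Set.mem_ofPred_eq]
      by_cases h : a n ω = 0
      · simp [h, hj.ne']
      · simp only [ne_eq, h, not_false_eq_true, if_true, true_and]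
  have heq : (fun ω => polyDiscrepancy (fun k => a k ω) n r α β) =ᵐ[μ]
      fun ω => |(n : ℝ)⁻¹ * f ω - (β - α) / (2 * Real.pi)| := by
    filter_upwards [hn] with ω hω
    rw [polyDiscrepancy, zeroCountingMeasure_real_eq,
      natDegree_coeffPolynomial (a := fun k => a k ω) hω]
    simp only [hf, ne_eq, hω, not_false_eq_true, if_true]
  refine Integrable.congr ?_ heq.symm
  have hm : Measurable fun ω => |(n : ℝ)⁻¹ * f ω - (β - α) / (2 * Real.pi)| := by
    have : Measurable fun ω => (f ω : ℝ) := measurable_from_nat.comp hfm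
    fun_prop
  refine Integrable.of_bound hm.aestronglyMeasurable (1 + |(β - α) / (2 * Real.pi)|)
    (Eventually.of_forall fun ω => ?_)
  rw [Real.norm_eq_abs, abs_abs]
  refine (abs_sub _ _).trans (add_le_add ?_ le_rfl)
  have hle : (f ω : ℝ) ≤ n := by
    by_cases h : a n ω = 0
    · simp [hf, h]
    · have h1 := (Multiset.countP_le_card (· ∈ annularSector r α β) _).trans
        (Polynomial.card_roots' (coeffPolynomial (fun k => a k ω) n))
      rw [natDegree_coeffPolynomial (a := fun k => a k ω) h] at h1
      simp only [hf, ne_eq, h, not_false_eq_true, if_true]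
      exact_mod_cast h1
  rw [abs_of_nonneg (by positivity), ← div_eq_inv_mul]
  exact div_le_one_of_le₀ hle n.cast_nonneg

end

/-! ### From the hypotheses to the coefficient bounds. -/

section

variable {Ω : Type*} [MeasurableSpace Ω] {μ : Measure Ω}

theorem toENNReal_log_enorm (z : ℂ) :
    (ENNReal.log ‖z‖ₑ).toENNReal = ENNReal.ofReal (Real.log ‖z‖) := by
  rcases eq_or_ne z 0 with rfl | hz
  · simp
  · rw [ENNReal.log_pos_real (by simpa using hz) (by simp), EReal.toENNReal_of_ne_top (by simp)]
    simp

theorem toENNReal_neg_log_enorm {z : ℂ} (hz : z ≠ 0) :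
    (-ENNReal.log ‖z‖ₑ).toENNReal = ENNReal.ofReal (-Real.log ‖z‖) := by
  rw [ENNReal.log_pos_real (by simpa using hz) (by simp), ← EReal.coe_neg,
    EReal.toENNReal_of_ne_top (by simp)]
  simp

/-- Only an inequality, because at a zero of `X` the left integrand is `0` by `Real.log 0 = 0` while
the right one is `⊤`. -/
theorem lintegral_neg_log_le_toENNReal (X : Ω → ℂ) :
    ∫⁻ ω, ENNReal.ofReal (-Real.log ‖X ω‖) ∂μ ≤ ∫⁻ ω, (-ENNReal.log ‖X ω‖ₑ).toENNReal ∂μ := by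
  refine lintegral_mono fun ω => ?_
  rcases eq_or_ne (X ω) 0 with h | h
  · simp [h]
  · rw [toENNReal_neg_log_enorm h]

theorem lintegral_toENNReal_log_le {t : ℝ} (ht : 0 < t) (X : Ω → ℂ) :
    ∫⁻ ω, (ENNReal.log ‖X ω‖ₑ).toENNReal ∂μ ≤
      ENNReal.ofReal (1 / t) * ∫⁻ ω, ‖X ω‖ₑ ^ t ∂μ := by
  rw [← lintegral_const_mul' _ _ ENNReal.ofReal_ne_top]
  refine lintegral_mono fun ω => ?_
  rw [toENNReal_log_enorm, ← ofReal_norm, ENNReal.ofReal_rpow_of_nonneg (norm_nonneg _) ht.le,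
    ← ENNReal.ofReal_mul (by positivity)]
  refine ENNReal.ofReal_le_ofReal ((Real.log_le_rpow_div (norm_nonneg _) ht).trans_eq ?_)
  ring

/-- A lower bound for `E log |X|` controls the negative part. -/
theorem lintegral_neg_log_le {X : Ω → ℂ} {M L : ℝ} {t : ℝ} (ht : 0 < t)
    (hM : ∫⁻ ω, ‖X ω‖ₑ ^ t ∂μ ≤ ENNReal.ofReal M) (hM0 : 0 ≤ M)
    (hL : (L : EReal) ≤ expectedLogNorm μ X) :
    ∫⁻ ω, (-ENNReal.log ‖X ω‖ₑ).toENNReal ∂μ ≤ ENNReal.ofReal (M / t - L) := by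
  unfold expectedLogNorm at hL
  have hpos : ∫⁻ ω, (ENNReal.log ‖X ω‖ₑ).toENNReal ∂μ ≤ ENNReal.ofReal (M / t) := by
    refine (lintegral_toENNReal_log_le ht X).trans ((mul_le_mul' le_rfl hM).trans_eq ?_)
    rw [← ENNReal.ofReal_mul (by positivity)]
    congr 1
    ring
  generalize ∫⁻ ω, (ENNReal.log ‖X ω‖ₑ).toENNReal ∂μ = p at hL hpos
  generalize ∫⁻ ω, (-ENNReal.log ‖X ω‖ₑ).toENNReal ∂μ = q at hL ⊢
  have hp : p ≠ ⊤ := ne_top_of_le_ne_top ENNReal.ofReal_ne_top hpos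
  -- An infinite negative part would make the expectation `⊥`, below the real number `L`.
  have hq : q ≠ ⊤ := by
    intro hq
    rw [hq, EReal.coe_ennreal_top, EReal.sub_top] at hL
    exact absurd hL (by simp)
  lift p to NNReal using hp
  lift q to NNReal using hq
  have h1 : L ≤ (p : ℝ) - q := by
    rw [EReal.coe_nnreal_eq_coe_real, EReal.coe_nnreal_eq_coe_real] at hL
    exact_mod_cast hL
  have h2 : (p : ℝ) ≤ M / t := by
    rw [← ENNReal.ofReal_coe_nnreal] at hpos
    exact (ENNReal.ofReal_le_ofReal_iff (by positivity)).1 hpos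
  rw [← ENNReal.ofReal_coe_nnreal]
  exact ENNReal.ofReal_le_ofReal (by linarith)

theorem ae_ne_zero_of_lintegral_neg_log {X : Ω → ℂ} (hX : Measurable X)
    (h : ∫⁻ ω, (-ENNReal.log ‖X ω‖ₑ).toENNReal ∂μ ≠ ⊤) : ∀ᵐ ω ∂μ, X ω ≠ 0 := by
  have hm : Measurable fun ω => (-ENNReal.log ‖X ω‖ₑ).toENNReal := by fun_prop
  filter_upwards [ae_lt_top hm h] with ω hω h0
  simp [h0] at hω

theorem lintegral_rpow_le_one_add [IsProbabilityMeasure μ] {X : Ω → ℂ} {s t : ℝ} (hs : 0 ≤ s)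
    (hst : s ≤ t) {M : ℝ} (hM0 : 0 ≤ M) (hM : ∫⁻ ω, ‖X ω‖ₑ ^ t ∂μ ≤ ENNReal.ofReal M) :
    ∫⁻ ω, ‖X ω‖ₑ ^ s ∂μ ≤ ENNReal.ofReal (1 + M) := by
  calc ∫⁻ ω, ‖X ω‖ₑ ^ s ∂μ ≤ ∫⁻ ω, (1 + ‖X ω‖ₑ ^ t) ∂μ := by
        refine lintegral_mono fun ω => ?_
        rcases le_total ‖X ω‖ₑ 1 with h | h
        · exact (ENNReal.rpow_le_one h hs).trans le_self_add
        · exact (ENNReal.rpow_le_rpow_of_exponent_le h hst).trans le_add_self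
    _ = 1 + ∫⁻ ω, ‖X ω‖ₑ ^ t ∂μ := by
        rw [lintegral_add_left measurable_const, lintegral_const, measure_univ, mul_one]
    _ ≤ _ := by
        rw [ENNReal.ofReal_add zero_le_one hM0, ENNReal.ofReal_one]
        gcongr

end

/-! ### The choice of scales and the asymptotic comparison. -/

theorem logGrowth_le {s m c : ℝ} (hs : 0 < s) (hm : 0 ≤ m) (hc : 0 ≤ c) {n : ℕ}
    (hn : 1 ≤ Real.log (n + 1)) :
    logGrowth s m c n ≤ (1 / s * (Real.log (1 + m) + 2) + c) * Real.log (n + 1) := by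
  unfold logGrowth
  have h1 : Real.log (1 + m * (n + 1)) ≤ Real.log (1 + m) + Real.log (n + 1) := by
    rw [← Real.log_mul (by positivity) (by positivity)]
    refine Real.log_le_log (by positivity) ?_
    nlinarith [n.cast_nonneg (α := ℝ)]
  have hlm : 0 ≤ Real.log (1 + m) := Real.log_nonneg (by linarith)
  have h2 : Real.log (1 + m * (n + 1)) + 1 ≤ (Real.log (1 + m) + 2) * Real.log (n + 1) := by
    nlinarith
  have h3 := mul_le_mul_of_nonneg_left h2 (by positivity : 0 ≤ 1 / s)
  nlinarith

/-- The choice of scales `R = q / w` and `κ = q ^ 3 / w`, where `q ^ 4 = log (n + 1)` and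
`w ^ 2 = n`. -/
theorem scaled_bound_le {q w T D G N : ℝ} (hq : 1 ≤ q) (hw : 1 ≤ w) (hN : w ^ 2 = N) (hT : 0 ≤ T)
    (hG : G ≤ D * q ^ 4) :
    N * (q / w) / Real.pi + 2 / (Real.pi * (q / w) ^ 2) * (6 * (3 * (q ^ 3 / w) + (q / w) ^ 2) * T +
      q / w / (q ^ 3 / w) * (8 * (q / w)) * (8 * Real.pi * G)) + 2 / (q ^ 3 / w) * (2 * G) ≤
    (1 / Real.pi + 48 * T / Real.pi + 132 * D) * (w * q) := by
  have hpi := Real.pi_pos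
  have hq0 : 0 < q := by linarith
  have hw0 : 0 < w := by linarith
  have e : N * (q / w) / Real.pi + 2 / (Real.pi * (q / w) ^ 2) *
      (6 * (3 * (q ^ 3 / w) + (q / w) ^ 2) * T +
      q / w / (q ^ 3 / w) * (8 * (q / w)) * (8 * Real.pi * G)) + 2 / (q ^ 3 / w) * (2 * G) =
      (1 / Real.pi + 36 * T / Real.pi) * (w * q) + 12 * T / Real.pi + 132 * (G * (w / q ^ 3)) := by
    rw [← hN]
    field_simp
    ring
  rw [e]
  have h1 : G * (w / q ^ 3) ≤ D * (w * q) := by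
    refine (mul_le_mul_of_nonneg_right hG (by positivity)).trans_eq ?_
    field_simp
  have h2 : 12 * T / Real.pi ≤ 12 * T / Real.pi * (w * q) :=
    le_mul_of_one_le_right (by positivity) (by nlinarith)
  have e2 : (1 / Real.pi + 48 * T / Real.pi + 132 * D) * (w * q) =
      (1 / Real.pi + 36 * T / Real.pi) * (w * q) + 12 * T / Real.pi * (w * q) +
        132 * (D * (w * q)) := by ring
  linarith

/-- The fourth root of `log (n + 1)`. -/
noncomputable def logRoot (n : ℕ) : ℝ := Real.log (n + 1) ^ (1 / 4 : ℝ)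

theorem logRoot_pow_four (n : ℕ) : logRoot n ^ 4 = Real.log (n + 1) := by
  rw [logRoot, ← Real.rpow_natCast, ← Real.rpow_mul (Real.log_nonneg (by
    linarith [n.cast_nonneg (α := ℝ)]))]
  norm_num

theorem tendsto_natCast_add_one : Tendsto (fun n : ℕ => (n : ℝ) + 1) atTop atTop :=
  tendsto_atTop_add_const_right _ _ tendsto_natCast_atTop_atTop

theorem tendsto_logRoot : Tendsto logRoot atTop atTop :=
  (tendsto_rpow_atTop (by norm_num)).comp (Real.tendsto_log_atTop.comp tendsto_natCast_add_one)

theorem eventually_logRoot_pow_le : ∀ᶠ n : ℕ in atTop, 3 * logRoot n ^ 5 ≤ Real.sqrt n := by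
  have h1 : ∀ᶠ n : ℕ in atTop, Real.log ((n : ℝ) + 1) ^ 3 ≤ (n : ℝ) + 1 := by
    filter_upwards [tendsto_natCast_add_one.eventually
      ((Real.isLittleO_pow_log_id_atTop (n := 3)).bound one_pos)] with n hn
    rw [one_mul, id, Real.norm_of_nonneg (by positivity : (0 : ℝ) ≤ n + 1)] at hn
    exact (le_abs_self _).trans hn
  filter_upwards [h1, tendsto_logRoot.eventually_ge_atTop 5, eventually_ge_atTop 1] with n h1 h2 h3
  have hn : (1 : ℝ) ≤ n := by exact_mod_cast h3
  refine Real.le_sqrt_of_sq_le ?_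
  rw [← logRoot_pow_four] at h1
  set q := logRoot n
  -- Since `q ^ 12 = log(n + 1)³ ≤ n + 1 ≤ 2n`, two spare powers of `q ≥ 5` absorb the constant `9`.
  have h4 : q ^ 10 * 25 ≤ q ^ 10 * q ^ 2 := by
    gcongr
    nlinarith
  nlinarith

/-- Lower bound for the square root factor of the discrepancy bound. -/
theorem eventually_le_sqrt {t : ℝ} (ht : 0 < t) (b L : ℝ) : ∀ᶠ n : ℕ in atTop,
    logRoot n ^ 2 / Real.sqrt (2 * t) / Real.sqrt n ≤
      Real.sqrt (1 / (n : ℝ) * ((Real.log ((n : ℝ) + 1) + b) / t - L)) := by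
  have h1 := (Real.tendsto_log_atTop.comp tendsto_natCast_add_one).eventually_ge_atTop
    (2 * (t * L - b))
  filter_upwards [h1, eventually_ge_atTop 1] with n h1 h2
  have hn : (0 : ℝ) < n := by exact_mod_cast h2
  simp only [Function.comp_apply] at h1
  refine Real.le_sqrt_of_sq_le ?_
  rw [div_pow, div_pow, Real.sq_sqrt hn.le, Real.sq_sqrt (by positivity), ← pow_mul,
    logRoot_pow_four, ← one_div_mul_eq_div]
  refine mul_le_mul_of_nonneg_left ?_ (by positivity)
  rw [div_sub' ht.ne', div_le_div_iff₀ (by positivity) ht]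
  nlinarith

theorem isBigO_sqrt {t : ℝ} (ht : 0 < t) (b L : ℝ) :
    (fun n : ℕ => Real.sqrt (1 / (n : ℝ) * ((Real.log ((n : ℝ) + 1) + b) / t - L))) =O[atTop]
      (fun n : ℕ => Real.sqrt (Real.log (n : ℝ) / (n : ℝ))) := by
  refine IsBigO.of_bound (Real.sqrt ((2 + |b|) / t + |L|)) ?_
  have h1 := (Real.tendsto_log_atTop.comp tendsto_natCast_atTop_atTop).eventually_ge_atTop 1
  filter_upwards [h1, eventually_ge_atTop 2] with n h1 h2
  simp only [Function.comp_apply] at h1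
  have hn : (2 : ℝ) ≤ n := by exact_mod_cast h2
  rw [Real.norm_of_nonneg (Real.sqrt_nonneg _), Real.norm_of_nonneg (Real.sqrt_nonneg _),
    ← Real.sqrt_mul (by positivity)]
  refine Real.sqrt_le_sqrt ?_
  have h3 : Real.log ((n : ℝ) + 1) ≤ 2 * Real.log n := by
    have : Real.log ((n : ℝ) + 1) ≤ Real.log ((n : ℝ) ^ 2) :=
      Real.log_le_log (by positivity) (by nlinarith)
    rwa [Real.log_pow] at this
  have h4 : (Real.log ((n : ℝ) + 1) + b) / t ≤ (2 + |b|) / t * Real.log n := by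
    rw [div_mul_eq_mul_div]
    gcongr
    nlinarith [le_abs_self b, abs_nonneg b]
  have h5 : -L ≤ |L| * Real.log n := by nlinarith [neg_le_abs L, abs_nonneg L]
  rw [mul_div_assoc', one_div_mul_eq_div]
  gcongr
  linarith

theorem sectorConst_pos {r : ℝ} (hr : r < 1) : 0 < sectorConst r := by
  unfold sectorConst
  have : 0 < 1 - r := by linarith
  positivity

theorem eventually_integral_sectorDiscrepancy_le {Ω : Type*} [MeasurableSpace Ω] {μ : Measure Ω}
    [IsProbabilityMeasure μ] {A : ℕ → ℕ → Ω → ℂ} {s m c : ℝ} (hs0 : 0 < s) (hs1 : s ≤ 1)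
    (hm : 0 < m) (hc : 0 ≤ c) (hA : ∀ n, 1 ≤ n → CoeffBounds μ (fun k => A k n) n s m c)
    (h0 : ∀ n, 1 ≤ n → ∀ᵐ ω ∂μ, A 0 n ω ≠ 0) (hn : ∀ n, 1 ≤ n → ∀ᵐ ω ∂μ, A n n ω ≠ 0)
    {r α β : ℝ} (hr0 : 0 < r) (hr1 : r < 1) (hαβ : α < β) (hβ : β ≤ α + 2 * Real.pi) :
    ∃ C : ℝ, ∀ᶠ n : ℕ in atTop,
      ∫ ω, sectorDiscrepancy A r α β n ω ∂μ ≤ C * logRoot n / Real.sqrt n := by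
  set U : ℝ≥0∞ := 2 * (tangentTail s m + ENNReal.ofReal (16 / s * (Real.log (1 + m) + 1))) +
    ENNReal.ofReal (2 * Real.pi) * ENNReal.ofReal c with hU
  have hUtop : U ≠ ⊤ := by
    have h1 := (tangentTail_lt_top hs0 hm).ne
    exact ENNReal.add_ne_top.2 ⟨ENNReal.mul_ne_top (by simp) (ENNReal.add_ne_top.2
      ⟨h1, ENNReal.ofReal_ne_top⟩), ENNReal.mul_ne_top ENNReal.ofReal_ne_top ENNReal.ofReal_ne_top⟩
  set D := 1 / s * (Real.log (1 + m) + 2) + c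
  have hlr : 0 < -Real.log r := by linarith [Real.log_neg hr0 hr1]
  have hlm : 0 ≤ Real.log (1 + m) := Real.log_nonneg (by linarith)
  -- This is the constant of `scaled_bound_le` with `T = U.toReal`, where `U` is the tangent bound
  -- after `R ≤ 1`.
  refine ⟨1 / Real.pi + 48 * U.toReal / Real.pi + 132 * D, ?_⟩
  filter_upwards [eventually_logRoot_pow_le, tendsto_logRoot.eventually_ge_atTop 2,
    tendsto_logRoot.eventually_gt_atTop (1 / -Real.log r), eventually_ge_atTop 1]
    with n hqw hq2 hqr hn1
  have hnpos : (0 : ℝ) < n := by exact_mod_cast hn1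
  have hq4 := logRoot_pow_four n
  have hw2 : Real.sqrt n ^ 2 = n := Real.sq_sqrt hnpos.le
  set q := logRoot n
  set w := Real.sqrt n
  have hq0 : 0 < q := by linarith
  have hq1 : 1 ≤ q := by linarith
  have hq5 : q ≤ q ^ 5 := le_self_pow₀ hq1 (by norm_num)
  have hw1 : 1 ≤ w := by linarith
  have hw0 : 0 < w := by linarith
  have hR0 : 0 < q / w := by positivity
  have hR1 : q / w ≤ 1 := (div_le_one hw0).2 (by linarith)
  have hRκ : 2 * (q / w) ≤ q ^ 3 / w := by
    rw [mul_div_assoc']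
    gcongr
    nlinarith [mul_nonneg hq0.le (by nlinarith : (0 : ℝ) ≤ q ^ 2 - 2)]
  have hrκ : q ^ 3 / w / 2 < -Real.log r := by
    have h1 : q ^ 3 / w ≤ 1 / q := by
      rw [div_le_div_iff₀ hw0 hq0]
      have : q ^ 3 * q ≤ q ^ 5 := by
        rw [← pow_succ]
        exact pow_le_pow_right₀ hq1 (by norm_num)
      linarith
    have h2 : 1 / q < -Real.log r := by
      rw [div_lt_iff₀ hq0]
      rwa [div_lt_iff₀ hlr, mul_comm] at hqr
    have h3 : 0 < 1 / q := by positivity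
    linarith
  -- The product is `q (q⁴ + q² + 1) / w`, and `3 q⁵ ≤ w`.
  have hRl : q / w * (Real.log (n + 1) + n * (q / w) ^ 2 + 1) ≤ 1 := by
    have e : (n : ℝ) * (q / w) ^ 2 = q ^ 2 := by
      rw [← hw2]
      field_simp
    rw [e, ← hq4, div_mul_eq_mul_div, div_le_one hw0]
    have h1 : q ^ 3 ≤ q ^ 5 := pow_le_pow_right₀ hq1 (by norm_num)
    nlinarith
  have hT : ∀ b : ℕ → Ω → ℂ, CoeffBounds μ b n s m c →
      ∫⁻ ω, tangentBound (fun k => b k ω) n ((q / w) ^ 2) ∂μ ≤ ENNReal.ofReal U.toReal := by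
    intro b hb
    rw [ENNReal.ofReal_toReal hUtop]
    refine (hb.lintegral_tangentBound_le hs0 hs1 hm hR0 hRl).trans ?_
    rw [hU]
    gcongr
    exact mul_le_of_le_one_left hlm hR1
  have hmain := (hA n hn1).lintegral_polyDiscrepancy_le hs0 hs1 hm hc hn1 (h0 n hn1) (hn n hn1)
    hR0 hR1 hRκ hr0 hrκ hαβ hβ hT ENNReal.toReal_nonneg
  have hlog1 : 1 ≤ Real.log ((n : ℝ) + 1) := by
    rw [← hq4]
    exact one_le_pow₀ hq1
  have hG := logGrowth_le hs0 hm.le hc hlog1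
  rw [← hq4] at hG
  have hbound := hmain.trans (ENNReal.ofReal_le_ofReal
    (scaled_bound_le hq1 hw1 hw2 ENNReal.toReal_nonneg hG))
  have hint := integrable_polyDiscrepancy (hA n hn1).measurable (hn n hn1) hr0 α β
  rw [← ofReal_integral_eq_lintegral_ofReal (hint.const_mul _) (Eventually.of_forall fun ω => by
    unfold polyDiscrepancy
    positivity)] at hbound
  have hD0 : 0 ≤ (1 / Real.pi + 48 * U.toReal / Real.pi + 132 * D) * (w * q) := by
    have := Real.pi_pos
    positivity
  rw [ENNReal.ofReal_le_ofReal_iff hD0, integral_const_mul] at hbound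
  rw [le_div_iff₀ hw0]
  refine le_of_mul_le_mul_left (le_trans (le_of_eq ?_) (hbound.trans (le_of_eq ?_))) hw0
  · rw [← hw2]
    change w * (_ * w) = w ^ 2 * ∫ ω, sectorDiscrepancy A r α β n ω ∂μ
    ring
  · ring

theorem corollary2p2 {Ω : Type*} [MeasurableSpace Ω] (μ : Measure Ω) [IsProbabilityMeasure μ]
    (A : ℕ → ℕ → Ω → ℂ) (hA : ∀ n k : ℕ, 1 ≤ n → k ≤ n → Measurable (A k n))
    (t : ℝ) (ht : 0 < t)
    (hM : coeffMomentSup μ A t < ⊤) (hL : ⊥ < endCoeffLogInf μ A)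
    (r α β : ℝ) (hr0 : 0 < r) (hr1 : r < 1) (hαβ : α < β) (hβ : β ≤ α + 2 * Real.pi) :
    (∀ n : ℕ, 1 ≤ n → Integrable (sectorDiscrepancy A r α β n) μ) ∧
    (∀ᶠ n : ℕ in atTop, ∫ ω, sectorDiscrepancy A r α β n ω ∂μ ≤
      discrepancyBound r t (coeffMomentSup μ A t).toReal (endCoeffLogInf μ A).toReal n) ∧
    (fun n : ℕ =>
        discrepancyBound r t (coeffMomentSup μ A t).toReal (endCoeffLogInf μ A).toReal n)
      =O[atTop] (fun n : ℕ => Real.sqrt (Real.log (n : ℝ) / (n : ℝ))) := by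
  set M := (coeffMomentSup μ A t).toReal with hMdef
  set L := (endCoeffLogInf μ A).toReal with hLdef
  have hM0 : 0 ≤ M := ENNReal.toReal_nonneg
  have hmom : ∀ n k : ℕ, 1 ≤ n → k ≤ n → ∫⁻ ω, ‖A k n ω‖ₑ ^ t ∂μ ≤ ENNReal.ofReal M := by
    intro n k hn hk
    rw [hMdef, ENNReal.ofReal_toReal hM.ne]
    exact le_sSup ⟨n, k, hn, hk, rfl⟩
  have hlog : ∀ n k : ℕ, 1 ≤ n → (k = 0 ∨ k = n) →
      (L : EReal) ≤ expectedLogNorm μ (A k n) := fun n k hn hk =>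
    -- Only `≠ ⊥` is required: were the infimum `⊤`, its `toReal` would be `0`, still a lower bound.
    (EReal.coe_toReal_le hL.ne').trans (sInf_le ⟨n, k, hn, hk, rfl⟩)
  have hneg : ∀ n k : ℕ, 1 ≤ n → (k = 0 ∨ k = n) →
      ∫⁻ ω, (-ENNReal.log ‖A k n ω‖ₑ).toENNReal ∂μ ≤ ENNReal.ofReal (M / t - L) :=
    fun n k hn hk => lintegral_neg_log_le ht (hmom n k hn (by omega)) hM0 (hlog n k hn hk)
  have hne : ∀ n k : ℕ, 1 ≤ n → (k = 0 ∨ k = n) → ∀ᵐ ω ∂μ, A k n ω ≠ 0 := fun n k hn hk =>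
    ae_ne_zero_of_lintegral_neg_log (hA n k hn (by omega))
      (ne_top_of_le_ne_top ENNReal.ofReal_ne_top (hneg n k hn hk))
  have hint : ∀ n : ℕ, 1 ≤ n → Integrable (sectorDiscrepancy A r α β n) μ := fun n hn =>
    integrable_polyDiscrepancy (a := fun k => A k n) (fun k hk => hA n k hn hk)
      (hne n n hn (Or.inr rfl)) hr0 α β
  refine ⟨hint, ?_, (isBigO_sqrt ht (Real.log M) L).const_mul_left (sectorConst r)⟩
  -- The exponent is lowered to `min t 1` because the power sums are estimated by subadditivity of
  -- `x ↦ x^s`; the moment bound then becomes `1 + M`.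
  have hbounds : ∀ n, 1 ≤ n → CoeffBounds μ (fun k => A k n) n (min t 1) (1 + M) |M / t - L| :=
    fun n hn =>
    { measurable := fun k hk => hA n k hn hk
      moment := fun k hk =>
        lintegral_rpow_le_one_add (by positivity) (min_le_left _ _) hM0 (hmom n k hn hk)
      first := (lintegral_neg_log_le_toENNReal _).trans ((hneg n 0 hn (Or.inl rfl)).trans
        (ENNReal.ofReal_le_ofReal (le_abs_self _)))
      last := (lintegral_neg_log_le_toENNReal _).trans ((hneg n n hn (Or.inr rfl)).trans
        (ENNReal.ofReal_le_ofReal (le_abs_self _))) }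
  obtain ⟨C, hC⟩ := eventually_integral_sectorDiscrepancy_le (lt_min ht one_pos) (min_le_right _ _)
    (by linarith) (abs_nonneg _) hbounds (fun n hn => hne n 0 hn (Or.inl rfl))
    (fun n hn => hne n n hn (Or.inr rfl)) hr0 hr1 hαβ hβ
  have hS := sectorConst_pos hr1
  -- The required bound exceeds a positive multiple of `logRoot n ^ 2 / √n`, the proved one is a
  -- multiple of `logRoot n / √n`; the threshold is where the extra factor `logRoot n` outweighs the
  -- quotient of the constants.
  filter_upwards [hC, eventually_le_sqrt ht (Real.log M) L,
    tendsto_logRoot.eventually_ge_atTop (C * Real.sqrt (2 * t) / sectorConst r),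
    tendsto_logRoot.eventually_ge_atTop 0] with n h1 h2 h3 h4
  refine h1.trans (le_trans ?_ (mul_le_mul_of_nonneg_left h2 hS.le))
  have ht2 : 0 < Real.sqrt (2 * t) := Real.sqrt_pos.2 (by positivity)
  rw [mul_div_assoc']
  refine div_le_div_of_nonneg_right ?_ (Real.sqrt_nonneg _)
  rw [mul_div_assoc', le_div_iff₀ ht2]
  rw [div_le_iff₀ hS] at h3
  nlinarith [mul_le_mul_of_nonneg_right h3 h4]
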